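/- \textbf{Setting.} Let $K\subset\mathbb{C}$ be an imaginary quadratic field with ring of integers $\mathcal{O}_K$ and discriminant $\Delta\le -15$. Put $\epsilon=0$ if $\Delta\equiv 0 \pmod 4$, $\epsilon=1$ if $\Delta\equiv 1\pmod 4$, $\eta=\sqrt{-\Delta}>0$ and $\tau=\frac{\epsilon+\eta i}{2}$. Let $\mathrm{M\ddot ob}$ be the group of Möbius transformations of $\widehat{\mathbb{C}}=\mathbb{C}\cup\{\infty\}$ together with their compositions with complex conjugation $\mathfrak{c}$. A \emph{Kleinian group} is a discrete subgroup of $\mathrm{M\ddot ob}$; its limit set is the set of accumulation points of the orbit of $0$. \textbf{Circles.} An oriented circle in $\widehat{\mathbb{C}}$ (lines included) is given uniquely by its curvature $b\in\mathbb{R}$, co-curvature $b'\in\mathbb{R}$ and curvature-centre $a\in\mathbb{C}$ with $b'b=a\bar a-1$: it is the set of $X/Y$ with $bX\bar X-aY\bar X-\bar aX\bar Y+b'Y\bar Y=0$, and its interior and exterior are the sets where this form is $<0$ and $>0$. Put $\pi(C)=(b',b,\operatorname{Re}a,\operatorname{Im}a)^t\in\mathbb{R}^4$ and \[G_M=\begin{pmatrix}0&-\frac12&0&0\\-\frac12&0&0&0\\0&0&1&0\\0&0&0&1\end{pmatrix}.\]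 $\mathrm{M\ddot ob}$ acts on oriented circles. Identify $(b',b,r,m)^t$ with the Hermitian matrix $\begin{pmatrix}b'&r+mi\\r-mi&b\end{pmatrix}$, and let $\rho:\mathrm{M\ddot ob}\to O_M^+(\mathbb{R})$ be the isomorphism for which $\gamma\in \mathrm{PGL}_2(\mathbb{C})$ acts by $T\mapsto \gamma T\gamma^\dagger/|\det\gamma|$ and $\mathfrak{c}$ by $T\mapsto\overline T$. \textbf{Packings.} An oriented $K$-Bianchi circle is an oriented circle whose underlying circle is $M(\widehat{\mathbb{R}})$ for some $M\in\mathrm{PSL}_2(\mathcal{O}_K)$. Two circles are tangent if they have exactly one common point. A collection of oriented circles is tangency-connected if the graph on its members, with edges the tangencies, is connected; it straddles a circle $D$ if it meets both the interior and the exterior of $D$. A \emph{$K$-Apollonian packing} is a maximal tangency-connected collection of oriented $K$-Bianchi circles with pairwise disjoint interiors that straddles no $K$-Bianchi circle. The \emph{fundamental packing} $\mathcal{P}_K$ is the $K$-Apollonian packing that contains $\widehat{\mathbb{R}}$ oriented with the lower half plane as interior; $\overline{\mathcal{P}_K}$ is the closure in $\widehat{\mathbb{C}}$ of the union of its circles.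 \textbf{Clusters.} For an invertible $R\in M_4(\mathbb{R})$ let $S_R=\{W\in M_4(\mathbb{R}):W^tG_MW=R\}$. A \emph{cluster type} consists of such an $R$, an integer $n\ge4$ and integers $a_{ij}$ ($1\le i\le 4$, $1\le j\le n$) such that $W=(W_1|\cdots|W_4)\mapsto\bigl(\pi^{-1}(\sum_i a_{ij}W_i)\bigr)_{j=1}^n$ is a well-defined finite-to-one map from $S_R$ to $n$-tuples of oriented circles. The tuples in the image are the ordered clusters; an unordered cluster is the set of circles of an ordered cluster. A \emph{geometric $K$-Apollonian group} with respect to a cluster type is a finitely generated Kleinian group $\mathcal{A}<\langle \mathrm{PGL}_2(\mathcal{O}_K),\mathfrak{c}\rangle$ with limit set $\overline{\mathcal{P}_K}$ for which the set of unordered clusters contained in $\mathcal{P}_K$ is a principal homogeneous space (non-empty, with $\mathcal{A}$ acting freely and transitively). Given in addition a $W\in S_R$ whose cluster is contained in $\mathcal{P}_K$ (the base cluster), $W^{-1}\rho(\mathcal{A})W$ is the corresponding \emph{algebraic $K$-Apollonian group} if it consists of integral matrices preserving the form with Gram matrix $R$. The cluster type of \emph{$K$-clusters} (three-prongs) consists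 of the quadruples $C_1,\dots,C_4$ for which $(\pi(C_i)^tG_M\pi(C_j))_{i,j}$ equals \[R_0=\begin{pmatrix}1&-1&-1&-1\\-1&1&1+\frac\Delta2&1+\frac\Delta2\\-1&1+\frac\Delta2&1&1+\frac\Delta2\\-1&1+\frac\Delta2&1+\frac\Delta2&1\end{pmatrix}.\] If $\Delta\equiv0\pmod4$, it is given by $n=4$, $R=R_0$ and $(a_{ij})=I$. If $\Delta\equiv1\pmod4$, it is given by $n=4$, \[R=R_1=\begin{pmatrix}1&-\frac12&-\frac12&-\frac12\\-\frac12&\frac{1-\Delta}4&\frac{1+\Delta}4&\frac{1+\Delta}4\\-\frac12&\frac{1+\Delta}4&\frac{1-\Delta}4&\frac{1+\Delta}4\\-\frac12&\frac{1+\Delta}4&\frac{1+\Delta}4&\frac{1-\Delta}4\end{pmatrix},\qquad (a_{ij})=\begin{pmatrix}1&0&0&0\\0&0&1&1\\0&1&0&1\\0&1&1&0\end{pmatrix}.\] The base cluster is, for $\Delta\equiv 0$ and $\Delta\equiv1\pmod 4$ respectively, \[W=\begin{pmatrix}0&0&\eta&\eta\\0&\eta&0&\eta\\0&0&0&\eta\\-1&1&1&1\end{pmatrix},\qquad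 W=\begin{pmatrix}0&\eta&0&0\\0&0&\eta&0\\0&\frac\eta2&\frac\eta2&-\frac\eta2\\-1&\frac12&\frac12&\frac12\end{pmatrix}.\] \textbf{The groups.} Let $\mathcal{A}_K^0\subset\mathrm{M\ddot ob}$ be generated by \[\gamma_1=\begin{pmatrix}-1&2\\-1&1\end{pmatrix},\quad\gamma_2=\begin{pmatrix}1&-1\\2&-1\end{pmatrix},\quad\gamma_3=\begin{pmatrix}0&1\\-1&0\end{pmatrix},\quad\begin{pmatrix}1&1-\tau\\0&-1\end{pmatrix},\] and let $\widehat{\mathcal{A}_K^0}\subset \mathrm{GL}_4(\mathbb{R})$ be generated, if $\Delta\equiv0\pmod4$, by \[\begin{pmatrix}1&2&0&0\\0&-1&0&0\\0&2&0&1\\0&2&1&0\end{pmatrix},\begin{pmatrix}1&0&2&0\\0&0&2&1\\0&0&-1&0\\0&1&2&0\end{pmatrix},\begin{pmatrix}1&0&0&2\\0&0&1&2\\0&1&0&2\\0&0&0&-1\end{pmatrix},\begin{pmatrix}0&3+\frac\Delta4&1&7+\frac\Delta4\\0&2&0&3\\1&1-\frac\Delta4&0&5-\frac\Delta4\\0&-1&0&-2\end{pmatrix},\]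 and, if $\Delta\equiv1\pmod4$, by \[\begin{pmatrix}1&-1&1&1\\0&-1&2&2\\0&0&0&1\\0&0&1&0\end{pmatrix},\begin{pmatrix}1&1&-1&1\\0&0&0&1\\0&2&-1&2\\0&1&0&0\end{pmatrix},\begin{pmatrix}1&1&1&-1\\0&0&1&0\\0&1&0&0\\0&2&2&-1\end{pmatrix},\begin{pmatrix}0&2&\frac{\Delta+11}4&-1\\1&1&\frac{1-\Delta}4&-1\\0&0&1&0\\1&2&\frac{13-\Delta}4&-2\end{pmatrix}.\] \textbf{Theorem.} There is exactly one $K$-Apollonian packing that contains $\widehat{\mathbb{R}}$ oriented with the lower half plane as interior, so that $\mathcal{P}_K$ is well defined. With respect to the cluster type of $K$-clusters, $\mathcal{A}_K^0$ is a geometric $K$-Apollonian group; in particular its limit set is $\overline{\mathcal{P}_K}$ and it acts simply transitively on the unordered $K$-clusters contained in $\mathcal{P}_K$. Moreover $W$ is a base cluster contained in $\mathcal{P}_K$, and $\widehat{\mathcal{A}_K^0}=W^{-1}\rho(\mathcal{A}_K^0)W$ is the algebraic $K$-Apollonian group that corresponds to $\mathcal{A}_K^0$. -/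

import Mathlib

noncomputable section

namespace KApollonian

open Matrix NumberField Topology

/-! ### The group of Möbius transformations and reflections of the Riemann sphere -/

/-- Linear fractional transformations of the Riemann sphere `ℂ ∪ {∞}`. -/
def mobiusHom : GL (Fin 2) ℂ →* Equiv.Perm (OnePoint ℂ) :=
  MulAction.toPermHom (GL (Fin 2) ℂ) (OnePoint ℂ)

/-- Complex conjugation `𝔠` of the Riemann sphere. -/
def conjPerm : Equiv.Perm (OnePoint ℂ) :=
  Complex.conjCLE.toHomeomorph.onePointCongr.toEquiv

/-- `Möb`, the group of Möbius transformations and reflections. -/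
def Mob : Subgroup (Equiv.Perm (OnePoint ℂ)) :=
  Subgroup.closure (Set.range mobiusHom ∪ {conjPerm})

/-- A Kleinian group: a discrete subgroup of `Möb`. The orientation-preserving part of a subgroup
has index at most two in it and is the image of its preimage under the double cover
`SL₂(ℂ) → Möb₊`; the subgroup is discrete if and only if this preimage is. -/
def IsKleinian (A : Subgroup (Equiv.Perm (OnePoint ℂ))) : Prop :=
  A ≤ Mob ∧
    DiscreteTopology {M : SpecialLinearGroup (Fin 2) ℂ // mobiusHom (M : GL (Fin 2) ℂ) ∈ A}

/-- The limit set: the set of accumulation points of the orbit of the origin. -/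
def limitSet (A : Subgroup (Equiv.Perm (OnePoint ℂ))) : Set (OnePoint ℂ) :=
  {x | AccPt x (Filter.principal {y | ∃ g ∈ A, y = g ((0 : ℂ) : OnePoint ℂ)})}

/-! ### Oriented circles -/

/-- An oriented circle of the Riemann sphere (lines are circles through `∞`), given by its
curvature `b`, co-curvature `b'` and curvature-centre `a`, with `b' b = a ā - 1`. -/
structure OrientedCircle where
  /-- The curvature. -/
  b : ℝ
  /-- The co-curvature. -/
  b' : ℝ
  /-- The curvature-centre. -/
  a : ℂ
  eqn : b' * b = Complex.normSq a - 1

namespace OrientedCircle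

/-- The sign of the Hermitian form `b X X̄ - a Y X̄ - ā X Ȳ + b' Y Ȳ` at `X / Y`: its value at
`(z, 1)` for `X / Y = z`, and at `(1, 0)` for `X / Y = ∞`. -/
def form (C : OrientedCircle) (x : OnePoint ℂ) : ℝ :=
  x.elim C.b
    (fun z => C.b * Complex.normSq z - 2 * ((starRingEnd ℂ) C.a * z).re + C.b')

/-- The underlying circle. -/
def carrier (C : OrientedCircle) : Set (OnePoint ℂ) := {x | C.form x = 0}

/-- The interior: the bounded side if `b > 0`, the side of `∞` if `b < 0`, and the side that the
unit normal `a` points to if `b = 0`. -/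
def interior (C : OrientedCircle) : Set (OnePoint ℂ) := {x | C.form x < 0}

/-- The exterior. -/
def exterior (C : OrientedCircle) : Set (OnePoint ℂ) := {x | 0 < C.form x}

/-- The Pedoe map `π` to Minkowski space, in the coordinates `(b', b, r, m)` with `a = r + m i`. -/
def pedoe (C : OrientedCircle) : Fin 4 → ℝ := ![C.b', C.b, C.a.re, C.a.im]

/-- `C'` is the image of the oriented circle `C` under the transformation `g`. -/
def IsImage (g : Equiv.Perm (OnePoint ℂ)) (C C' : OrientedCircle) : Prop :=
  g '' C.carrier = C'.carrier ∧ g '' C.interior = C'.interior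

/-- Two circles are tangent if they have exactly one common point. -/
def Tangent (C D : OrientedCircle) : Prop := ∃ p, C.carrier ∩ D.carrier = {p}

end OrientedCircle

open OrientedCircle

/-- The image of a collection of oriented circles under the transformation `g`. -/
def mapCircles (g : Equiv.Perm (OnePoint ℂ)) (P : Set OrientedCircle) : Set OrientedCircle :=
  {C' | ∃ C ∈ P, IsImage g C C'}

/-- The extended real line as an oriented circle whose interior is the lower half plane. -/
def realCircle : OrientedCircle where
  b := 0
  b' := 0
  a := -Complex.I
  eqn := by simp

/-- The extended real line. -/
def realLine : Set (OnePoint ℂ) := {OnePoint.infty} ∪ Set.range (fun x : ℝ => ((x : ℂ) : OnePoint ℂ))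

/-! ### The Schmidt arrangement and its packings

`K` is a number field with an embedding `φ` into `ℂ`. -/

section Field

variable {K : Type*} [Field K] [NumberField K]

/-- The embedding of the ring of integers into `ℂ`. -/
def integerEmb (φ : K →+* ℂ) : 𝓞 K →+* ℂ := φ.comp (algebraMap (𝓞 K) K)

/-- The oriented `K`-Bianchi circles: oriented circles whose underlying circle is the image of the
extended real line under an element of `PSL₂(𝓞 K)`. -/
def bianchiCircles (φ : K →+* ℂ) : Set OrientedCircle :=
  {C | ∃ M : SpecialLinearGroup (Fin 2) (𝓞 K),
    C.carrier =
      mobiusHom (GeneralLinearGroup.map (integerEmb φ) (M : GL (Fin 2) (𝓞 K))) '' realLine}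

/-- The tangency graph of a collection of oriented circles. -/
def tangencyGraph (P : Set OrientedCircle) : SimpleGraph P :=
  SimpleGraph.fromRel (fun C D => Tangent C.1 D.1)

/-- The collection `P` meets both the interior and the exterior of `D`. -/
def Straddles (P : Set OrientedCircle) (D : OrientedCircle) : Prop :=
  (∃ C ∈ P, (C.carrier ∩ D.interior).Nonempty) ∧ (∃ C ∈ P, (C.carrier ∩ D.exterior).Nonempty)

/-- Tangency-connected collections of oriented `K`-Bianchi circles with disjoint interiors that do
not straddle any `K`-Bianchi circle. -/
structure IsPrePacking (φ : K →+* ℂ) (P : Set OrientedCircle) : Prop where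
  bianchi : P ⊆ bianchiCircles φ
  connected : (tangencyGraph P).Connected
  disjoint : P.PairwiseDisjoint OrientedCircle.interior
  not_straddles : ∀ D ∈ bianchiCircles φ, ¬ Straddles P D

/-- A `K`-Apollonian packing of oriented circles. -/
def IsApollonianPacking (φ : K →+* ℂ) (P : Set OrientedCircle) : Prop :=
  Maximal (IsPrePacking φ) P

/-- The fundamental packing: the `K`-Apollonian packing that contains the extended real line,
oriented so that the packing lies in the closed upper half plane. There is just one such packing,
so that the union is this packing. -/
def fundamentalPacking (φ : K →+* ℂ) : Set OrientedCircle :=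
  ⋃₀ {P | IsApollonianPacking φ P ∧ realCircle ∈ P}

/-- The group `⟨PGL₂(𝓞 K), 𝔠⟩`. -/
def extendedBianchi (φ : K →+* ℂ) : Subgroup (Equiv.Perm (OnePoint ℂ)) :=
  Subgroup.closure
    (Set.range (fun M : GL (Fin 2) (𝓞 K) => mobiusHom (GeneralLinearGroup.map (integerEmb φ) M)) ∪
      {conjPerm})

/-- A weak `K`-Apollonian group. -/
structure IsWeakApollonianGroup (φ : K →+* ℂ) (A : Subgroup (Equiv.Perm (OnePoint ℂ))) :
    Prop where
  fg : A.FG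
  kleinian : IsKleinian A
  le_bianchi : A ≤ extendedBianchi φ
  limitSet_eq : limitSet A = closure (⋃ C ∈ fundamentalPacking φ, C.carrier)

end Field

/-! ### Cluster spaces and cluster types -/

/-- The Gram matrix of the Minkowski form. -/
def gramM : Matrix (Fin 4) (Fin 4) ℝ :=
  !![0, -1/2, 0, 0;
     -1/2, 0, 0, 0;
     0, 0, 1, 0;
     0, 0, 0, 1]

/-- The cluster space `S_R`. -/
def clusterSpace (R : Matrix (Fin 4) (Fin 4) ℝ) : Set (Matrix (Fin 4) (Fin 4) ℝ) :=
  {W | Wᵀ * gramM * W = R}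

/-- The data of a cluster type: `n`-tuples of circles whose Pedoe vectors are the columns of
`W * coef`, where `W` runs over the cluster space of `R`. -/
structure ClusterData where
  /-- The number of circles in a cluster. -/
  n : ℕ
  /-- The matrix that defines the cluster space. -/
  R : Matrix (Fin 4) (Fin 4) ℝ
  /-- The coefficients `a i j`. -/
  coef : Matrix (Fin 4) (Fin n) ℤ

namespace ClusterData

/-- The vectors of the cluster given by `W`, as columns. -/
def vectors (t : ClusterData) (W : Matrix (Fin 4) (Fin 4) ℝ) : Matrix (Fin 4) (Fin t.n) ℝ :=
  W * t.coef.map (Int.cast : ℤ → ℝ)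

/-- The data define a cluster type: `R` is invertible, `n ≥ 4`, all vectors of all tuples lie on the
image `⟨v, v⟩ = 1` of the Pedoe map, and the map from the cluster space to tuples is
finite-to-one. -/
structure IsClusterType (t : ClusterData) : Prop where
  four_le : 4 ≤ t.n
  invertible : IsUnit t.R.det
  mem : ∀ W ∈ clusterSpace t.R, ∀ j, (t.vectors W).col j ⬝ᵥ (gramM *ᵥ (t.vectors W).col j) = 1
  finite_to_one : ∀ V, {W ∈ clusterSpace t.R | t.vectors W = V}.Finite

/-- The tuple `c` is the ordered cluster given by `W`. -/
def IsOrderedCluster (t : ClusterData) (W : Matrix (Fin 4) (Fin 4) ℝ)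
    (c : Fin t.n → OrientedCircle) : Prop :=
  W ∈ clusterSpace t.R ∧ ∀ j, (c j).pedoe = (t.vectors W).col j

/-- The unordered clusters that are contained in the collection `P`. -/
def clustersIn (t : ClusterData) (P : Set OrientedCircle) : Set (Set OrientedCircle) :=
  {s | s ⊆ P ∧ ∃ W c, t.IsOrderedCluster W c ∧ s = Set.range c}

end ClusterData

/-- The set `X` of collections of circles is a principal homogeneous space for `A`: it is non-empty,
`A` acts on it, and the action is free and transitive. -/
structure IsPrincipalHomogeneous (A : Subgroup (Equiv.Perm (OnePoint ℂ)))
    (X : Set (Set OrientedCircle)) : Prop where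
  nonempty : X.Nonempty
  maps : ∀ g ∈ A, ∀ s ∈ X, mapCircles g s ∈ X
  existsUnique : ∀ s ∈ X, ∀ s' ∈ X, ∃! g, g ∈ A ∧ mapCircles g s = s'

section Field

variable {K : Type*} [Field K] [NumberField K]

/-- A (strong, geometric) `K`-Apollonian group with respect to a cluster type. -/
structure IsApollonianGroup (φ : K →+* ℂ) (t : ClusterData)
    (A : Subgroup (Equiv.Perm (OnePoint ℂ))) : Prop where
  clusterType : t.IsClusterType
  weak : IsWeakApollonianGroup φ A
  torsor : IsPrincipalHomogeneous A (t.clustersIn (fundamentalPacking φ))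

end Field

/-! ### The algebraic-geometric correspondence -/

/-- The identification of Minkowski space with Hermitian matrices. -/
def hermitianMatrix (v : Fin 4 → ℝ) : Matrix (Fin 2) (Fin 2) ℂ :=
  !![(v 0 : ℂ), v 2 + v 3 * Complex.I; v 2 - v 3 * Complex.I, v 1]

/-- The graph of the exceptional isomorphism `ρ : Möb ≅ O_M⁺(ℝ)`: a matrix `M` acts on Hermitian
matrices by `T ↦ M T M† / |det M|`, and `𝔠` acts by `T ↦ T̄`. -/
def IsRho (g : Equiv.Perm (OnePoint ℂ)) (N : Matrix (Fin 4) (Fin 4) ℝ) : Prop :=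
  ∃ M : GL (Fin 2) ℂ,
    (g = mobiusHom M ∧ ∀ v, hermitianMatrix (N *ᵥ v) =
      ((‖(M : Matrix (Fin 2) (Fin 2) ℂ).det‖⁻¹ : ℝ) : ℂ) •
        ((M : Matrix (Fin 2) (Fin 2) ℂ) * hermitianMatrix v *
          (M : Matrix (Fin 2) (Fin 2) ℂ)ᴴ)) ∨
    (g = mobiusHom M * conjPerm ∧ ∀ v, hermitianMatrix (N *ᵥ v) =
      ((‖(M : Matrix (Fin 2) (Fin 2) ℂ).det‖⁻¹ : ℝ) : ℂ) •
        ((M : Matrix (Fin 2) (Fin 2) ℂ) * (hermitianMatrix v).map (starRingEnd ℂ) *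
          (M : Matrix (Fin 2) (Fin 2) ℂ)ᴴ))

/-- The image of `A` under `g ↦ W⁻¹ ρ(g) W`. -/
def algebraicImage (W : Matrix (Fin 4) (Fin 4) ℝ) (A : Subgroup (Equiv.Perm (OnePoint ℂ))) :
    Set (Matrix (Fin 4) (Fin 4) ℝ) :=
  {X | ∃ g ∈ A, ∃ N, IsRho g N ∧ X = W⁻¹ * N * W}

/-- The set `O_R(ℤ)` of integral matrices that preserve the form with Gram matrix `R`. -/
def integralOrthogonal (R : Matrix (Fin 4) (Fin 4) ℝ) : Set (Matrix (Fin 4) (Fin 4) ℝ) :=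
  {X | Xᵀ * R * X = R ∧ ∃ Y : Matrix (Fin 4) (Fin 4) ℤ, X = Y.map (Int.cast : ℤ → ℝ)}

section Field

variable {K : Type*} [Field K] [NumberField K]

/-- `H` is the algebraic `K`-Apollonian group that corresponds to the geometric `K`-Apollonian group
`A` by way of the base cluster `W` in the fundamental packing. -/
structure IsAlgebraicApollonianGroup (φ : K →+* ℂ) (t : ClusterData)
    (W : Matrix (Fin 4) (Fin 4) ℝ) (A : Subgroup (Equiv.Perm (OnePoint ℂ)))
    (H : Subgroup (GL (Fin 4) ℝ)) : Prop where
  geometric : IsApollonianGroup φ t A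
  base : ∃ c, t.IsOrderedCluster W c ∧ Set.range c ⊆ fundamentalPacking φ
  corresponds : (fun X : GL (Fin 4) ℝ => (X : Matrix (Fin 4) (Fin 4) ℝ)) '' (H : Set (GL (Fin 4) ℝ))
    = algebraicImage W A
  integral : ∀ X ∈ H, (X : Matrix (Fin 4) (Fin 4) ℝ) ∈ integralOrthogonal t.R

end Field

/-! ### `K`-clusters and the groups `A_K⁰`, for the discriminant `d` of `K` -/

/-- The trace `ε` of `τ`. -/
def eps (d : ℤ) : ℤ := if d % 4 = 0 then 0 else 1

/-- The generator `τ = (ε + √d) / 2` of the ring of integers, with positive imaginary part. -/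
def tau (d : ℤ) : ℂ := ((eps d : ℂ) + Real.sqrt (-(d : ℝ)) * Complex.I) / 2

/-- The Gram matrix `R₀` of a `K`-cluster (three-prong). -/
def gram0 (d : ℤ) : Matrix (Fin 4) (Fin 4) ℝ :=
  !![1, -1, -1, -1;
     -1, 1, 1 + d/2, 1 + d/2;
     -1, 1 + d/2, 1, 1 + d/2;
     -1, 1 + d/2, 1 + d/2, 1]

/-- The Gram matrix `R₁`, for `d ≡ 1 (mod 4)`, of
`v₁, (-v₂+v₃+v₄)/2, (v₂-v₃+v₄)/2, (v₂+v₃-v₄)/2`, where `v₁, v₂, v₃, v₄` is a `K`-cluster. -/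
def gram1 (d : ℤ) : Matrix (Fin 4) (Fin 4) ℝ :=
  !![1, -1/2, -1/2, -1/2;
     -1/2, (1 - d)/4, (1 + d)/4, (1 + d)/4;
     -1/2, (1 + d)/4, (1 - d)/4, (1 + d)/4;
     -1/2, (1 + d)/4, (1 + d)/4, (1 - d)/4]

/-- The change of variables `S`, with `R₀ = Sᵗ R₁ S`. -/
def changeS : Matrix (Fin 4) (Fin 4) ℤ :=
  !![1, 0, 0, 0;
     0, 0, 1, 1;
     0, 1, 0, 1;
     0, 1, 1, 0]

/-- The cluster type of `K`-clusters. -/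
def kCluster (d : ℤ) : ClusterData :=
  if d % 4 = 0 then ⟨4, gram0 d, 1⟩ else ⟨4, gram1 d, changeS⟩

/-- The matrix `W_D` of the base cluster, with `η = √(-d)`. -/
def baseW (d : ℤ) : Matrix (Fin 4) (Fin 4) ℝ :=
  let η : ℝ := Real.sqrt (-(d : ℝ))
  if d % 4 = 0 then
    !![0, 0, η, η;
       0, η, 0, η;
       0, 0, 0, η;
       -1, 1, 1, 1]
  else
    !![0, η, 0, 0;
       0, 0, η, 0;
       0, η/2, η/2, -η/2;
       -1, 1/2, 1/2, 1/2]

/-- The matrix `γ₁`. -/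
def gamma1 : GL (Fin 2) ℂ :=
  GeneralLinearGroup.mkOfDetNeZero !![-1, 2; -1, 1] (by simp [det_fin_two]; norm_num)

/-- The matrix `γ₂`. -/
def gamma2 : GL (Fin 2) ℂ :=
  GeneralLinearGroup.mkOfDetNeZero !![1, -1; 2, -1] (by simp [det_fin_two]; norm_num)

/-- The matrix `γ₃`. -/
def gamma3 : GL (Fin 2) ℂ :=
  GeneralLinearGroup.mkOfDetNeZero !![0, 1; -1, 0] (by simp [det_fin_two])

/-- The fourth generator, `z ↦ τ - 1 - z`. -/
def gamma4 (d : ℤ) : GL (Fin 2) ℂ :=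
  GeneralLinearGroup.mkOfDetNeZero !![1, 1 - tau d; 0, -1] (by simp [det_fin_two])

/-- The geometric group `A_K⁰`. -/
def groupA (d : ℤ) : Subgroup (Equiv.Perm (OnePoint ℂ)) :=
  Subgroup.closure
    {mobiusHom gamma1, mobiusHom gamma2, mobiusHom gamma3, mobiusHom (gamma4 d)}

/-- A matrix of order two as an element of `GL₄(ℝ)`. -/
def ofInvolution (X : Matrix (Fin 4) (Fin 4) ℝ) (h : X * X = 1) : GL (Fin 4) ℝ := ⟨X, X, h, h⟩

/-- The generators of the matrix group for `d ≡ 0 (mod 4)`. -/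
def matGens0 (d : ℤ) : Set (GL (Fin 4) ℝ) :=
  {ofInvolution
      !![1, 2, 0, 0;
         0, -1, 0, 0;
         0, 2, 0, 1;
         0, 2, 1, 0]
      (by ext i j; fin_cases i <;> fin_cases j <;> simp [Matrix.mul_apply, Fin.sum_univ_four]),
   ofInvolution
      !![1, 0, 2, 0;
         0, 0, 2, 1;
         0, 0, -1, 0;
         0, 1, 2, 0]
      (by ext i j; fin_cases i <;> fin_cases j <;> simp [Matrix.mul_apply, Fin.sum_univ_four]),
   ofInvolution
      !![1, 0, 0, 2;
         0, 0, 1, 2;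
         0, 1, 0, 2;
         0, 0, 0, -1]
      (by ext i j; fin_cases i <;> fin_cases j <;> simp [Matrix.mul_apply, Fin.sum_univ_four]),
   ofInvolution
      !![0, 3 + d/4, 1, 7 + d/4;
         0, 2, 0, 3;
         1, 1 - d/4, 0, 5 - d/4;
         0, -1, 0, -2]
      (by
        ext i j
        fin_cases i <;> fin_cases j <;> simp [Matrix.mul_apply, Fin.sum_univ_four] <;> ring)}

/-- The generators of the matrix group for `d ≡ 1 (mod 4)`. -/
def matGens1 (d : ℤ) : Set (GL (Fin 4) ℝ) :=
  {ofInvolution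
      !![1, -1, 1, 1;
         0, -1, 2, 2;
         0, 0, 0, 1;
         0, 0, 1, 0]
      (by ext i j; fin_cases i <;> fin_cases j <;> simp [Matrix.mul_apply, Fin.sum_univ_four] <;> norm_num),
   ofInvolution
      !![1, 1, -1, 1;
         0, 0, 0, 1;
         0, 2, -1, 2;
         0, 1, 0, 0]
      (by ext i j; fin_cases i <;> fin_cases j <;> simp [Matrix.mul_apply, Fin.sum_univ_four] <;> norm_num),
   ofInvolution
      !![1, 1, 1, -1;
         0, 0, 1, 0;
         0, 1, 0, 0;
         0, 2, 2, -1]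
      (by ext i j; fin_cases i <;> fin_cases j <;> simp [Matrix.mul_apply, Fin.sum_univ_four] <;> norm_num),
   ofInvolution
      !![0, 2, (d + 11)/4, -1;
         1, 1, (1 - d)/4, -1;
         0, 0, 1, 0;
         1, 2, (13 - d)/4, -2]
      (by
        ext i j
        fin_cases i <;> fin_cases j <;> simp [Matrix.mul_apply, Fin.sum_univ_four] <;> ring)}

/-- The matrix counterpart of the group `A_K⁰`. -/
def groupAhat (d : ℤ) : Subgroup (GL (Fin 4) ℝ) :=
  Subgroup.closure (if d % 4 = 0 then matGens0 d else matGens1 d)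

end KApollonian

end

/-! Write R for `realCircle`, L for the parallel line at height η/2 (`tangentCircle d 1 0`), E for
the group generated by γ₁, γ₂, γ₃, and Γ for the group generated by E and γ₄. The plan is to
identify the fundamental packing with the Γ-orbit of R (`orbitPacking`) and to read everything off
from that.

The modular group SL₂(ℤ) fixes R and carries L to the circles tangent to R at the cusps p/q. The
half-turn γ₄ exchanges R and L. Modulo ±1, E acts simply transitively on the SL₂(ℤ)-images of the
triple of cusps ∞, 0, 1 (Farey triangles): transitivity is `exists_elliptic_basicProng`, and
freeness, by reduction modulo 3, is `elliptic_eq_one`.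

The orbit is a packing. Integrality of the coordinates (`bianchi_coords`) shows that no Bianchi
circle crosses R, and then that none separates R from L (`outside_adjacentLines_or`). Hence the set
of oriented Bianchi circles that have R and L outside is invariant under SL₂(ℤ) and γ₄, so under Γ
(`outside_adjacentLines_act`). Applied to arbitrary circles this excludes straddling; applied to R
it gives disjoint interiors.

The packing is unique. If a packing contains R, a member tangent to R can be moved by SL₂(ℤ) to a
horizontal line. Were this line higher than L, the packing would straddle L, so it is L
(`exists_zHom_of_tangent`). Walking along tangencies, every such packing lies in the orbit
(`subset_orbitPacking`).

The limit set contains R because the E-orbit of 0 contains ℚ; invariance under Γ does the rest.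
Discreteness holds because products of two entries of a matrix of determinant one in the group are
algebraic integers of K.

For the simply transitive action, a cluster in the packing is moved so that its central circle is R.
The other three circles then touch R at cusps whose pairwise determinants are ±1, which is a Farey
triangle. Freeness requires that the stabilizer of R in Γ be no larger than E. This is a ping-pong
argument (`Reduced`), which rests on the fact that unit discs around ℤ and around τ + ℤ do not
overlap when Δ ≤ -15.

The algebraic group is obtained by comparing ρ(γᵢ)W with W times the listed matrices. -/

noncomputable section

namespace KApollonian

open Matrix NumberField Topology

namespace OrientedCircle

/-! ### Oriented circles and their images -/

attribute [ext] OrientedCircle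

lemma form_infty (C : OrientedCircle) : C.form OnePoint.infty = C.b := rfl

lemma form_coe (C : OrientedCircle) (z : ℂ) :
    C.form (z : OnePoint ℂ) =
      C.b * (z.re ^ 2 + z.im ^ 2) - 2 * (C.a.re * z.re + C.a.im * z.im) + C.b' := by
  change C.b * Complex.normSq z - 2 * ((starRingEnd ℂ) C.a * z).re + C.b' = _
  rw [Complex.normSq_apply, Complex.mul_re, Complex.conj_re, Complex.conj_im]
  ring

lemma eqn_re_im (C : OrientedCircle) : C.b' * C.b = C.a.re ^ 2 + C.a.im ^ 2 - 1 := by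
  rw [C.eqn, Complex.normSq_apply]; ring

lemma mem_carrier {C : OrientedCircle} {x : OnePoint ℂ} : x ∈ C.carrier ↔ C.form x = 0 := Iff.rfl

lemma mem_interior {C : OrientedCircle} {x : OnePoint ℂ} : x ∈ C.interior ↔ C.form x < 0 := Iff.rfl

lemma mem_exterior {C : OrientedCircle} {x : OnePoint ℂ} : x ∈ C.exterior ↔ 0 < C.form x := Iff.rfl

lemma pedoe_injective : Function.Injective pedoe := by
  intro C D h
  have h0 := congrFun h 0
  have h1 := congrFun h 1
  have h2 := congrFun h 2
  have h3 := congrFun h 3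
  simp [pedoe] at h0 h1 h2 h3
  exact OrientedCircle.ext h1 h0 (Complex.ext h2 h3)

/-- The circle with the opposite orientation. -/
def neg (C : OrientedCircle) : OrientedCircle where
  b := -C.b
  b' := -C.b'
  a := -C.a
  eqn := by rw [Complex.normSq_neg, ← C.eqn]; ring

lemma form_neg (C : OrientedCircle) (x : OnePoint ℂ) : C.neg.form x = -C.form x := by
  induction x using OnePoint.rec with
  | infty => rfl
  | coe z => simp only [form_coe, neg, Complex.neg_re, Complex.neg_im]; ring

lemma carrier_neg (C : OrientedCircle) : C.neg.carrier = C.carrier := by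
  ext x; simp [mem_carrier, form_neg]

/-- Circles with the same underlying set agree up to orientation. -/
lemma eq_or_eq_neg_of_carrier_eq {C D : OrientedCircle} (h : C.carrier = D.carrier) :
    D = C ∨ D = C.neg := by
  have key : ∀ x, C.form x = 0 → D.form x = 0 := fun x hx => by
    have : x ∈ C.carrier := hx
    rw [h] at this; exact this
  have key' : ∀ x, D.form x = 0 → C.form x = 0 := fun x hx => by
    have : x ∈ D.carrier := hx
    rw [← h] at this; exact this
  have eC := C.eqn_re_im
  have eD := D.eqn_re_im
  -- Pedoe vectors have norm one, so proportional ones agree up to sign. Both cases below only have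
  -- to establish proportionality.
  have fin : ∀ s : ℝ, D.b = s * C.b → D.b' = s * C.b' → D.a.re = s * C.a.re →
      D.a.im = s * C.a.im → D = C ∨ D = C.neg := by
    intro s h1 h2 h3 h4
    have : s ^ 2 = 1 := by rw [h1, h2, h3, h4] at eD; linear_combination s ^ 2 * eC - eD
    rcases sq_eq_one_iff.mp this with rfl | rfl
    · left; apply pedoe_injective; simp [pedoe, *]
    · right; apply pedoe_injective; simp [pedoe, neg, *]
  by_cases hb : C.b = 0
  · have hDb : D.b = 0 := key OnePoint.infty hb
    rw [hb] at eC
    rw [hDb] at eD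
    -- A line is parametrized by its foot point `a b' / 2` and its direction `i a`; two of its
    -- points suffice.
    have hp : ∀ t : ℝ, D.b' - 2 * (D.a.re * (C.a.re * (C.b' / 2) - t * C.a.im) +
        D.a.im * (C.a.im * (C.b' / 2) + t * C.a.re)) = 0 := by
      intro t
      have := key ((⟨C.a.re * (C.b' / 2) - t * C.a.im, C.a.im * (C.b' / 2) + t * C.a.re⟩ : ℂ) :
        OnePoint ℂ) (by rw [form_coe, hb]; linear_combination C.b' * eC)
      rw [form_coe, hDb] at this
      linear_combination this
    have h0 := hp 0
    have h1 := hp 1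
    have h2 : D.a.im * C.a.re - D.a.re * C.a.im = 0 := by linear_combination (h0 - h1) / 2
    refine fin (D.a.re * C.a.re + D.a.im * C.a.im) (by rw [hb, hDb]; ring) ?_ ?_ ?_
    · linear_combination h0
    · linear_combination D.a.re * eC - C.a.im * h2
    · linear_combination D.a.im * eC + C.a.re * h2
  -- A circle with `b ≠ 0` has centre `a / b` and radius `1 / |b|`; its four compass points suffice.
  · have hp : ∀ u v : ℝ, u ^ 2 + v ^ 2 = 1 →
        D.b * (((C.a.re + u) / C.b) ^ 2 + ((C.a.im + v) / C.b) ^ 2) -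
          2 * (D.a.re * ((C.a.re + u) / C.b) + D.a.im * ((C.a.im + v) / C.b)) + D.b' = 0 := by
      intro u v huv
      have := key ((⟨(C.a.re + u) / C.b, (C.a.im + v) / C.b⟩ : ℂ) : OnePoint ℂ) (by
        rw [form_coe]; field_simp; linear_combination huv + eC)
      rw [form_coe] at this
      exact this
    have h1 := hp 1 0 (by norm_num)
    have h2 := hp (-1) 0 (by norm_num)
    have h3 := hp 0 1 (by norm_num)
    have h4 := hp 0 (-1) (by norm_num)
    have e1 : D.a.re = D.b / C.b * C.a.re := by
      field_simp at h1 h2 ⊢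
      linear_combination (-h1 + h2) / 4
    have e2 : D.a.im = D.b / C.b * C.a.im := by
      field_simp at h3 h4 ⊢
      linear_combination (-h3 + h4) / 4
    refine fin (D.b / C.b) (by field_simp) ?_ e1 e2
    rw [e1, e2] at h1
    field_simp at h1 ⊢
    apply mul_left_cancel₀ hb
    linear_combination h1 - D.b * eC

lemma eq_of_carrier_interior {C D : OrientedCircle} (h : C.carrier = D.carrier)
    (h' : C.interior = D.interior) : C = D := by
  rcases eq_or_eq_neg_of_carrier_eq h with rfl | rfl
  · rfl
  · exfalso
    have hx : ∀ x, C.form x < 0 ↔ C.neg.form x < 0 := fun x => by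
      have : x ∈ C.interior ↔ x ∈ C.neg.interior := by rw [h']
      exact this
    simp only [form_neg] at hx
    -- Reversing the orientation exchanges the signs, so equal interiors would leave no point off
    -- the circle.
    have hz : ∀ x, C.form x = 0 := fun x => by
      by_contra hne
      rcases lt_or_gt_of_ne hne with h1 | h1
      · have := (hx x).mp h1; linarith
      · have := (hx x).mpr (by linarith); linarith
    have h0 := hz OnePoint.infty
    have h1 := hz ((0 : ℂ) : OnePoint ℂ)
    have h2 := hz ((1 : ℂ) : OnePoint ℂ)
    have h3 := hz ((Complex.I : ℂ) : OnePoint ℂ)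
    simp only [form_infty, form_coe] at h0 h1 h2 h3
    simp [h0] at h1 h2 h3
    have := C.eqn_re_im
    rw [h0] at this
    simp [h1] at h2 h3
    rw [h2, h3] at this
    norm_num at this

/-- The Minkowski product of the Pedoe vectors. -/
def pair (C D : OrientedCircle) : ℝ :=
  -(C.b' * D.b + C.b * D.b') / 2 + C.a.re * D.a.re + C.a.im * D.a.im

lemma pair_eq (C D : OrientedCircle) : C.pedoe ⬝ᵥ (gramM *ᵥ D.pedoe) = pair C D := by
  simp [pedoe, gramM, pair, Matrix.mulVec, dotProduct, Fin.sum_univ_four]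
  ring

lemma pair_self (C : OrientedCircle) : pair C C = 1 := by
  have := C.eqn_re_im
  unfold pair; linear_combination -this

lemma pair_comm (C D : OrientedCircle) : pair C D = pair D C := by unfold pair; ring

end OrientedCircle

open OrientedCircle

lemma OrientedCircle.IsImage.unique {g : Equiv.Perm (OnePoint ℂ)} {C D D' : OrientedCircle}
    (h : IsImage g C D) (h' : IsImage g C D') : D = D' :=
  eq_of_carrier_interior (h.1.symm.trans h'.1) (h.2.symm.trans h'.2)

/-- Carrier and interior depend only on the sign of the form, so a positive factor that varies with
the point is harmless. -/
lemma isImage_of_form {g : Equiv.Perm (OnePoint ℂ)} {C D : OrientedCircle}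
    (h : ∀ x, ∃ c : ℝ, 0 < c ∧ D.form (g x) = c * C.form x) : IsImage g C D := by
  constructor
  · ext y
    obtain ⟨x, rfl⟩ := g.surjective y
    obtain ⟨c, hc, e⟩ := h x
    rw [g.injective.mem_set_image, mem_carrier, mem_carrier, e]
    simp [hc.ne']
  · ext y
    obtain ⟨x, rfl⟩ := g.surjective y
    obtain ⟨c, hc, e⟩ := h x
    rw [g.injective.mem_set_image, mem_interior, mem_interior, e]
    constructor <;> intro h <;> nlinarith

/-! ### The action of `GL₂(ℂ)` on oriented circles -/

/-- The image of an oriented circle under the linear fractional transformation of a matrix. -/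
def act (M : GL (Fin 2) ℂ) (C : OrientedCircle) : OrientedCircle where
  b := ‖M.1.det‖⁻¹ * (Complex.normSq (M 1 0) * C.b' + Complex.normSq (M 1 1) * C.b +
    2 * (M 1 0 * C.a * (starRingEnd ℂ) (M 1 1)).re)
  b' := ‖M.1.det‖⁻¹ * (Complex.normSq (M 0 0) * C.b' + Complex.normSq (M 0 1) * C.b +
    2 * (M 0 0 * C.a * (starRingEnd ℂ) (M 0 1)).re)
  a := (‖M.1.det‖⁻¹ : ℝ) *
    ((M 0 0 * C.b' + M 0 1 * (starRingEnd ℂ) C.a) * (starRingEnd ℂ) (M 1 0) +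
      (M 0 0 * C.a + M 0 1 * C.b) * (starRingEnd ℂ) (M 1 1))
  eqn := by
    have hD : ‖M.1.det‖ ≠ 0 := norm_ne_zero_iff.mpr M.det_ne_zero
    have hD2 : ‖M.1.det‖ ^ 2 = Complex.normSq M.1.det := (Complex.normSq_eq_norm_sq _).symm
    rw [Complex.normSq_mul, Complex.normSq_ofReal]
    generalize ‖M.1.det‖ = D at *
    field_simp
    rw [hD2, det_fin_two]
    have e := C.eqn_re_im
    generalize C.a = a at *
    generalize M 0 0 = p
    generalize M 0 1 = q
    generalize M 1 0 = r
    generalize M 1 1 = s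
    simp [Complex.normSq_apply]
    -- The defining equation says that the Hermitian matrix has determinant -1, and `T ↦ M T M†`
    -- multiplies the determinant by `|det M|²`.
    linear_combination ((p.re * s.re - p.im * s.im - (q.re * r.re - q.im * r.im)) ^ 2 +
      (p.re * s.im + p.im * s.re - (q.re * r.im + q.im * r.re)) ^ 2) * e

lemma mobiusHom_apply (M : GL (Fin 2) ℂ) (x : OnePoint ℂ) : mobiusHom M x = M • x := rfl

lemma act_form (M : GL (Fin 2) ℂ) (C : OrientedCircle) (x : OnePoint ℂ) :
    ∃ c : ℝ, 0 < c ∧ (act M C).form (mobiusHom M x) = c * C.form x := by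
  have hdet := M.det_ne_zero
  have hD : ‖M.1.det‖ ≠ 0 := norm_ne_zero_iff.mpr M.det_ne_zero
  have hDp : 0 < ‖M.1.det‖ := norm_pos_iff.mpr M.det_ne_zero
  have hD2 : ‖M.1.det‖ ^ 2 = Complex.normSq M.1.det := (Complex.normSq_eq_norm_sq _).symm
  rw [mobiusHom_apply]
  -- In homogeneous coordinates the form is just multiplied by `|det M|`; the remaining positive
  -- factor comes from dehomogenizing on both sides.
  have main : ∀ X Y : ℂ,
      (act M C).b * Complex.normSq (M 0 0 * X + M 0 1 * Y) -
        2 * ((starRingEnd ℂ) (act M C).a * (M 0 0 * X + M 0 1 * Y) *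
          (starRingEnd ℂ) (M 1 0 * X + M 1 1 * Y)).re +
        (act M C).b' * Complex.normSq (M 1 0 * X + M 1 1 * Y) =
      ‖M.1.det‖ * (C.b * Complex.normSq X - 2 * ((starRingEnd ℂ) C.a * X * (starRingEnd ℂ) Y).re +
        C.b' * Complex.normSq Y) := by
    intro X Y
    have e : ‖M.1.det‖ = ‖M.1.det‖⁻¹ * Complex.normSq M.1.det := by
      rw [← hD2]; field_simp
    conv_rhs => rw [e]
    simp only [act]
    generalize ‖M.1.det‖⁻¹ = D
    rw [det_fin_two]
    generalize C.a = a
    generalize M 0 0 = p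
    generalize M 0 1 = q
    generalize M 1 0 = r
    generalize M 1 1 = s
    simp [Complex.normSq_apply]
    ring
  have fin : ∀ X Y z : ℂ, Y ≠ 0 → ∀ D : OrientedCircle, z = X / Y →
      D.form (z : OnePoint ℂ) = (Complex.normSq Y)⁻¹ * (D.b * Complex.normSq X -
        2 * ((starRingEnd ℂ) D.a * X * (starRingEnd ℂ) Y).re + D.b' * Complex.normSq Y) := by
    rintro X Y z hY D rfl
    change D.b * Complex.normSq (X / Y) - 2 * ((starRingEnd ℂ) D.a * (X / Y)).re + D.b' = _
    have hn : Complex.normSq Y ≠ 0 := by simpa using hY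
    have : (starRingEnd ℂ) D.a * (X / Y) =
        (((Complex.normSq Y)⁻¹ : ℝ) : ℂ) * ((starRingEnd ℂ) D.a * X * (starRingEnd ℂ) Y) := by
      rw [div_eq_mul_inv, Complex.inv_def]; push_cast; ring
    rw [this, Complex.re_ofReal_mul, Complex.normSq_div]
    field_simp
  have hv : ∀ X Y : ℂ, (X ≠ 0 ∨ Y ≠ 0) → M 1 0 * X + M 1 1 * Y = 0 →
      M 0 0 * X + M 0 1 * Y ≠ 0 := by
    intro X Y hXY h1 h2
    rw [det_fin_two] at hdet
    rcases hXY with h | h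
    · apply hdet; apply mul_right_cancel₀ h
      linear_combination M 1 1 * h2 - M 0 1 * h1
    · apply hdet; apply mul_right_cancel₀ h
      linear_combination M 0 0 * h1 - M 1 0 * h2
  induction x using OnePoint.rec with
  | infty =>
    have m := main 1 0
    simp at m
    rw [OnePoint.smul_infty_eq_ite]
    split_ifs with h
    · have := hv 1 0 (by simp) (by simpa using h)
      simp at this
      simp [h] at m
      have hn : 0 < Complex.normSq (M 0 0) := Complex.normSq_pos.mpr this
      refine ⟨‖M.1.det‖ / Complex.normSq (M 0 0), by positivity, ?_⟩
      rw [form_infty, form_infty]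
      field_simp
      linarith
    · have hn : 0 < Complex.normSq (M 1 0) := Complex.normSq_pos.mpr h
      refine ⟨‖M.1.det‖ / Complex.normSq (M 1 0), by positivity, ?_⟩
      rw [fin _ _ _ h _ rfl, form_infty, Complex.mul_re]
      field_simp
      simp at m ⊢
      linarith
  | coe z =>
    have m := main z 1
    simp only [mul_one, map_one] at m
    have e : C.form (z : OnePoint ℂ) =
      C.b * Complex.normSq z - 2 * ((starRingEnd ℂ) C.a * z).re + C.b' := rfl
    rw [OnePoint.smul_some_eq_ite]
    split_ifs with h
    · have := hv z 1 (by simp) (by simpa using h)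
      simp only [mul_one] at this
      have hn : 0 < Complex.normSq (M 0 0 * z + M 0 1) := Complex.normSq_pos.mpr this
      refine ⟨‖M.1.det‖ / Complex.normSq (M 0 0 * z + M 0 1), by positivity, ?_⟩
      rw [form_infty, e]
      rw [h] at m
      simp only [map_zero, mul_zero, Complex.zero_re, sub_zero, add_zero] at m
      rw [div_mul_eq_mul_div, eq_div_iff hn.ne', m]
    · have hn : 0 < Complex.normSq (M 1 0 * z + M 1 1) := Complex.normSq_pos.mpr h
      refine ⟨‖M.1.det‖ / Complex.normSq (M 1 0 * z + M 1 1), by positivity, ?_⟩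
      rw [fin _ _ _ h _ rfl, e, m]
      field_simp

lemma isImage_act (M : GL (Fin 2) ℂ) (C : OrientedCircle) :
    IsImage (mobiusHom M) C (act M C) :=
  isImage_of_form (act_form M C)

lemma isImage_mobius_iff {M : GL (Fin 2) ℂ} {C D : OrientedCircle} :
    IsImage (mobiusHom M) C D ↔ D = act M C :=
  ⟨fun h => IsImage.unique h (isImage_act M C), fun h => h ▸ isImage_act M C⟩

lemma OrientedCircle.IsImage.mul {g h : Equiv.Perm (OnePoint ℂ)} {C D E : OrientedCircle}
    (h1 : IsImage h C D) (h2 : IsImage g D E) : IsImage (g * h) C E := by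
  constructor
  · rw [← h2.1, ← h1.1, Set.image_image]; rfl
  · rw [← h2.2, ← h1.2, Set.image_image]; rfl

/-- No matrix computation is needed: an oriented circle has at most one image, and images compose.
-/
lemma act_mul (M N : GL (Fin 2) ℂ) (C : OrientedCircle) : act (M * N) C = act M (act N C) := by
  symm
  rw [← isImage_mobius_iff, map_mul]
  exact (isImage_act N C).mul (isImage_act M _)

lemma act_one (C : OrientedCircle) : act 1 C = C := by
  symm
  rw [← isImage_mobius_iff, map_one]
  constructor <;> simp [Equiv.Perm.coe_one]

lemma act_congr {M N : GL (Fin 2) ℂ} (h : mobiusHom M = mobiusHom N) (C : OrientedCircle) :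
    act M C = act N C := by
  rw [← isImage_mobius_iff, ← h]; exact isImage_act M C

lemma act_inv_act (M : GL (Fin 2) ℂ) (C : OrientedCircle) : act M⁻¹ (act M C) = C := by
  rw [← act_mul, inv_mul_cancel, act_one]

lemma act_act_inv (M : GL (Fin 2) ℂ) (C : OrientedCircle) : act M (act M⁻¹ C) = C := by
  rw [← act_mul, mul_inv_cancel, act_one]

lemma act_injective (M : GL (Fin 2) ℂ) : Function.Injective (act M) :=
  Function.LeftInverse.injective (act_inv_act M)

lemma carrier_act (M : GL (Fin 2) ℂ) (C : OrientedCircle) :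
    (act M C).carrier = mobiusHom M '' C.carrier := (isImage_act M C).1.symm

lemma interior_act (M : GL (Fin 2) ℂ) (C : OrientedCircle) :
    (act M C).interior = mobiusHom M '' C.interior := (isImage_act M C).2.symm

lemma act_neg (M : GL (Fin 2) ℂ) (C : OrientedCircle) : act M C.neg = (act M C).neg := by
  apply pedoe_injective
  ext i
  fin_cases i <;> simp [pedoe, act, OrientedCircle.neg] <;> ring

/-- The Minkowski product is the polarization of minus the determinant, which the normalized action
`T ↦ M T M† / |det M|` preserves. -/
lemma pair_act (M : GL (Fin 2) ℂ) (C D : OrientedCircle) :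
    pair (act M C) (act M D) = pair C D := by
  have hD : ‖M.1.det‖ ≠ 0 := norm_ne_zero_iff.mpr M.det_ne_zero
  have hD2 : ‖M.1.det‖ ^ 2 = Complex.normSq M.1.det := (Complex.normSq_eq_norm_sq _).symm
  have e : pair C D = ‖M.1.det‖⁻¹ ^ 2 * Complex.normSq M.1.det * pair C D := by
    rw [← hD2]; field_simp
  rw [e]
  simp only [act, pair, Complex.re_ofReal_mul, Complex.im_ofReal_mul]
  generalize ‖M.1.det‖⁻¹ = E
  rw [det_fin_two]
  generalize C.a = a
  generalize D.a = a'
  generalize M 0 0 = p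
  generalize M 0 1 = q
  generalize M 1 0 = r
  generalize M 1 1 = s
  simp [Complex.normSq_apply]
  ring

lemma act_form_nonneg {M : GL (Fin 2) ℂ} {C : OrientedCircle} {x : OnePoint ℂ} :
    0 ≤ (act M C).form (mobiusHom M x) ↔ 0 ≤ C.form x := by
  obtain ⟨c, hc, e⟩ := act_form M C x
  rw [e]; constructor <;> intro h <;> nlinarith

lemma act_form_pos {M : GL (Fin 2) ℂ} {C : OrientedCircle} {x : OnePoint ℂ} :
    0 < (act M C).form (mobiusHom M x) ↔ 0 < C.form x := by
  obtain ⟨c, hc, e⟩ := act_form M C x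
  rw [e]; constructor <;> intro h <;> nlinarith

section Field

variable {K : Type*} [Field K] [NumberField K]

/-! ### The ring of integers of an imaginary quadratic field -/

/-- The ring of integers of a quadratic field has a basis that contains `1`. -/
lemma exists_basis_one (hK : Module.finrank ℚ K = 2) :
    ∃ b : Module.Basis (Fin 2) ℤ (𝓞 K), b 0 = 1 := by
  have hr : Module.finrank ℤ (𝓞 K) = 2 := by rw [RingOfIntegers.rank, hK]
  let b : Module.Basis (Fin 2) ℤ (𝓞 K) :=
    (Module.finBasis ℤ (𝓞 K)).reindex (finCongr hr)
  set x := b.repr 1 0 with hx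
  set y := b.repr 1 1 with hy
  have h1 : (1 : 𝓞 K) = x • b 0 + y • b 1 := by
    have := b.sum_repr 1
    rw [Fin.sum_univ_two] at this
    exact this.symm
  -- If `g` divides both coordinates then `1 = g y` in the ring, and taking norms gives that `g²`
  -- divides 1.
  have hg : Int.gcd x y = 1 := by
    obtain ⟨x', hx'⟩ := Int.gcd_dvd_left x y
    obtain ⟨y', hy'⟩ := Int.gcd_dvd_right x y
    have e : (1 : 𝓞 K) = algebraMap ℤ (𝓞 K) (Int.gcd x y : ℤ) * (x' • b 0 + y' • b 1) := by
      rw [← Algebra.smul_def, smul_add, smul_smul, smul_smul, ← hx', ← hy']; exact h1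
    have e2 := congrArg (Algebra.norm ℤ) e
    rw [map_one, map_mul, Algebra.norm_algebraMap, hr] at e2
    have h3 : ((Int.gcd x y : ℤ)) ∣ 1 := ⟨Int.gcd x y * Algebra.norm ℤ (x' • b 0 + y' • b 1), by
      rw [e2]; ring⟩
    have := Int.natAbs_dvd_natAbs.mpr h3
    simpa using this
  -- Bézout coefficients complete the coordinates of 1 to a unimodular matrix, whose second row
  -- gives `ω`.
  obtain ⟨v, u, huv⟩ : ∃ v u : ℤ, x * v - y * u = 1 := by
    refine ⟨Int.gcdA x y, -Int.gcdB x y, ?_⟩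
    have := Int.gcd_eq_gcd_ab x y
    rw [hg] at this
    push_cast at this
    linarith
  set ω := u • b 0 + v • b 1 with hω
  have li : LinearIndependent ℤ ![(1 : 𝓞 K), ω] := by
    rw [LinearIndependent.pair_iff]
    intro s t hst
    have e : (s * x + t * u) • b 0 + (s * y + t * v) • b 1 = 0 := by
      rw [h1, hω] at hst
      rw [← hst]
      module
    have li := LinearIndependent.pair_iff.mp (by
      have := b.linearIndependent
      have e : (b : Fin 2 → 𝓞 K) = ![b 0, b 1] := by ext i; fin_cases i <;> rfl
      rwa [e] at this) _ _ e
    obtain ⟨e1, e2⟩ := li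
    constructor
    · linear_combination v * e1 - u * e2 - s * huv
    · linear_combination x * e2 - y * e1 - t * huv
  have sp : ⊤ ≤ Submodule.span ℤ (Set.range ![(1 : 𝓞 K), ω]) := by
    rw [← b.span_eq, Submodule.span_le]
    rintro _ ⟨i, rfl⟩
    have m1 : (1 : 𝓞 K) ∈ Submodule.span ℤ (Set.range ![(1 : 𝓞 K), ω]) :=
      Submodule.subset_span ⟨0, rfl⟩
    have m2 : ω ∈ Submodule.span ℤ (Set.range ![(1 : 𝓞 K), ω]) :=
      Submodule.subset_span ⟨1, rfl⟩
    have e0 : b 0 = v • (1 : 𝓞 K) - y • ω := by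
      rw [h1, hω]
      have : v • (x • b 0 + y • b 1) - y • (u • b 0 + v • b 1) = (x * v - y * u) • b 0 := by module
      rw [this, huv, one_smul]
    have e1 : b 1 = x • ω - u • (1 : 𝓞 K) := by
      rw [h1, hω]
      have : x • (u • b 0 + v • b 1) - u • (x • b 0 + y • b 1) = (x * v - y * u) • b 1 := by module
      rw [this, huv, one_smul]
    fin_cases i
    · change b 0 ∈ _
      rw [e0]
      exact Submodule.sub_mem _ (Submodule.smul_mem _ _ m1) (Submodule.smul_mem _ _ m2)
    · change b 1 ∈ _
      rw [e1]
      exact Submodule.sub_mem _ (Submodule.smul_mem _ _ m2) (Submodule.smul_mem _ _ m1)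
  exact ⟨Module.Basis.mk li sp, by simp⟩

/-- Completing 1 to a basis shows that the ring is `ℤ[ω]`; the trace form in the basis `1, ω` then
has determinant `t² - 4n`. -/
lemma exists_generator (hK : Module.finrank ℚ K = 2) :
    ∃ (ω : 𝓞 K) (t n : ℤ), (∀ x : 𝓞 K, ∃ i j : ℤ, x = i + j * ω) ∧ ω * ω = t * ω - n ∧
      t ^ 2 - 4 * n = discr K := by
  obtain ⟨b, hb⟩ := exists_basis_one hK
  have rep : ∀ x : 𝓞 K, x = (b.repr x 0 : 𝓞 K) + (b.repr x 1 : 𝓞 K) * b 1 := by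
    intro x
    have := b.sum_repr x
    rw [Fin.sum_univ_two, hb] at this
    conv_lhs => rw [← this]
    simp [zsmul_eq_mul]
  set t := b.repr (b 1 * b 1) 1 with ht
  set n := -b.repr (b 1 * b 1) 0 with hn
  have hω : b 1 * b 1 = t * b 1 - n := by
    have := rep (b 1 * b 1)
    rw [← ht, show b.repr (b 1 * b 1) 0 = -n by rw [hn]; ring] at this
    rw [this]; push_cast; ring
  refine ⟨b 1, t, n, fun x => ⟨_, _, rep x⟩, hω, ?_⟩
  have tr : ∀ i j : ℤ, Algebra.trace ℤ (𝓞 K) ((i : 𝓞 K) + j * b 1) = 2 * i + j * t := by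
    have t1 : Algebra.trace ℤ (𝓞 K) (b 1) = t := by
      rw [Algebra.trace_eq_matrix_trace b, Matrix.trace_fin_two, Algebra.leftMulMatrix_eq_repr_mul,
        Algebra.leftMulMatrix_eq_repr_mul, hb, mul_one, ← ht]
      simp
    have t0 : Algebra.trace ℤ (𝓞 K) 1 = 2 := by
      rw [← map_one (algebraMap ℤ (𝓞 K)), Algebra.trace_algebraMap, RingOfIntegers.rank, hK]
      simp
    intro i j
    have : (i : 𝓞 K) + j * b 1 = i • (1 : 𝓞 K) + j • b 1 := by simp [zsmul_eq_mul]
    rw [this, map_add, map_smul, map_smul, t1, t0, smul_eq_mul, smul_eq_mul]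
    ring
  rw [← NumberField.discr_eq_discr K b, Algebra.discr_def, det_fin_two]
  simp only [Algebra.traceMatrix_apply, Algebra.traceForm_apply, hb, one_mul, mul_one]
  have a1 := tr 1 0
  have a2 := tr 0 1
  have a3 := tr (-n) t
  rw [show ((-n : ℤ) : 𝓞 K) + (t : 𝓞 K) * b 1 = b 1 * b 1 by rw [hω]; push_cast; ring] at a3
  simp at a1 a2
  rw [a1, a2, a3]
  ring

lemma discr_mod_four (hK : Module.finrank ℚ K = 2) : discr K % 4 = 0 ∨ discr K % 4 = 1 := by
  obtain ⟨-, t, n, -, -, h⟩ := exists_generator hK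
  rw [← h]
  rcases Int.even_or_odd' t with ⟨k, rfl | rfl⟩
  · left; ring_nf; omega
  · right; ring_nf; omega

/-- The image of the ring of integers in `ℂ` is `ℤ + ℤ τ`. -/
lemma range_integerEmb (hK : Module.finrank ℚ K = 2) (hd : discr K < 0) (φ : K →+* ℂ) (z : ℂ) :
    (∃ x, integerEmb φ x = z) ↔ ∃ m n : ℤ, z = m + n * tau (discr K) := by
  obtain ⟨ω, t, n, hspan, hω, hdisc⟩ := exists_generator hK
  set η : ℝ := Real.sqrt (-(discr K : ℝ)) with hη
  have hη2 : η ^ 2 = -(discr K : ℝ) := Real.sq_sqrt (by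
    have : (discr K : ℝ) < 0 := by exact_mod_cast hd
    linarith)
  set w := integerEmb φ ω with hw
  have e1 : w * w = t * w - n := by
    have := congrArg (integerEmb φ) hω
    simpa using this
  have e2 : (2 * w - t - η * Complex.I) * (2 * w - t + η * Complex.I) = 0 := by
    have h3 : ((η ^ 2 : ℝ) : ℂ) = -((discr K : ℤ) : ℂ) := by rw [hη2]; push_cast; rfl
    rw [← hdisc] at h3
    push_cast at h3
    linear_combination 4 * e1 - (η : ℂ) ^ 2 * Complex.I_sq + h3
  have hpar : ∃ k : ℤ, t = eps (discr K) + 2 * k := by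
    unfold eps
    rw [← hdisc]
    rcases Int.even_or_odd' t with ⟨k, rfl | rfl⟩
    · rw [if_pos (by ring_nf; omega)]; exact ⟨k, by ring⟩
    · rw [if_neg (by ring_nf; omega)]; exact ⟨k, by ring⟩
  obtain ⟨k, hk⟩ := hpar
  -- The embedding may send `ω` to either root of its quadratic, hence the sign `s`; both roots span
  -- the same lattice together with 1.
  have htau : ∃ s i : ℤ, s * s = 1 ∧ w = i + s * tau (discr K) := by
    have ht : tau (discr K) = ((eps (discr K) : ℂ) + η * Complex.I) / 2 := rfl
    rw [ht]
    rcases mul_eq_zero.mp e2 with h | h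
    · refine ⟨1, k, by norm_num, ?_⟩
      have : (t : ℂ) = eps (discr K) + 2 * k := by exact_mod_cast hk
      push_cast
      linear_combination h / 2 + this / 2
    · refine ⟨-1, k + eps (discr K), by norm_num, ?_⟩
      have : (t : ℂ) = eps (discr K) + 2 * k := by exact_mod_cast hk
      push_cast
      linear_combination h / 2 + this / 2
  obtain ⟨s, i, hs, hwi⟩ := htau
  have hsC : (s : ℂ) * s = 1 := by exact_mod_cast hs
  constructor
  · rintro ⟨x, rfl⟩
    obtain ⟨p, q, rfl⟩ := hspan x
    refine ⟨p + q * i, q * s, ?_⟩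
    rw [map_add, map_mul, map_intCast, map_intCast, ← hw, hwi]
    push_cast; ring
  · rintro ⟨p, q, rfl⟩
    refine ⟨((p - q * s * i : ℤ) : 𝓞 K) + ((q * s : ℤ) : 𝓞 K) * ω, ?_⟩
    rw [map_add, map_mul, map_intCast, map_intCast, ← hw, hwi]
    push_cast
    linear_combination (q : ℂ) * tau (discr K) * hsC

end Field

/-! ### The modular group and its subgroup of index three -/

/-- The modular group as a group of complex matrices. -/
def zHom : SpecialLinearGroup (Fin 2) ℤ →* GL (Fin 2) ℂ :=
  SpecialLinearGroup.toGL.comp (SpecialLinearGroup.map (Int.castRingHom ℂ))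

lemma zHom_apply (M : SpecialLinearGroup (Fin 2) ℤ) (i j : Fin 2) : zHom M i j = (M i j : ℂ) := rfl

lemma det_zHom (M : SpecialLinearGroup (Fin 2) ℤ) : (zHom M).1.det = 1 :=
  (SpecialLinearGroup.map (Int.castRingHom ℂ) M).2

lemma sl_det (M : SpecialLinearGroup (Fin 2) ℤ) : M 0 0 * M 1 1 - M 0 1 * M 1 0 = 1 := by
  have := M.2
  rwa [det_fin_two] at this

lemma sl_det_real (M : SpecialLinearGroup (Fin 2) ℤ) :
    (M 0 0 : ℝ) * M 1 1 - M 0 1 * M 1 0 = 1 := by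
  exact_mod_cast sl_det M

/-- The square root of the absolute value of the discriminant. -/
def eta (d : ℤ) : ℝ := Real.sqrt (-(d : ℝ))

/-- The circle that is tangent to the extended real line at `p / q` and has curvature `η q²`. -/
def tangentCircle (d p q : ℤ) : OrientedCircle where
  b := eta d * q ^ 2
  b' := eta d * p ^ 2
  a := ⟨eta d * p * q, 1⟩
  eqn := by rw [Complex.normSq_mk]; ring

lemma tangentCircle_neg (d p q : ℤ) : tangentCircle d (-p) (-q) = tangentCircle d p q := by
  simp [tangentCircle]

lemma act_zHom_tangentCircle (M : SpecialLinearGroup (Fin 2) ℤ) (d p q : ℤ) :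
    act (zHom M) (tangentCircle d p q) =
      tangentCircle d (M 0 0 * p + M 0 1 * q) (M 1 0 * p + M 1 1 * q) := by
  apply pedoe_injective
  have h := sl_det_real M
  ext i
  fin_cases i <;>
    simp [pedoe, act, det_zHom, tangentCircle, zHom_apply, Complex.normSq_apply, pow_two] <;>
    first
    | ring1
    | linear_combination h

lemma act_zHom_realCircle (M : SpecialLinearGroup (Fin 2) ℤ) :
    act (zHom M) realCircle = realCircle := by
  apply pedoe_injective
  have h := sl_det_real M
  ext i
  fin_cases i <;>
    simp [pedoe, act, det_zHom, realCircle, zHom_apply]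
  linarith

/-- The three-prong at the real line and the circles at `∞`, `0` and `1`. -/
def basicProng (d : ℤ) : Set OrientedCircle :=
  {realCircle, tangentCircle d 1 0, tangentCircle d 0 1, tangentCircle d 1 1}

lemma act_zHom_basicProng (M : SpecialLinearGroup (Fin 2) ℤ) (d : ℤ) :
    act (zHom M) '' basicProng d = {realCircle, tangentCircle d (M 0 0) (M 1 0),
      tangentCircle d (M 0 1) (M 1 1), tangentCircle d (M 0 0 + M 0 1) (M 1 0 + M 1 1)} := by
  simp [basicProng, Set.image_insert_eq, act_zHom_realCircle, act_zHom_tangentCircle]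

/-- `γ₁` in the modular group. -/
def g1 : SpecialLinearGroup (Fin 2) ℤ := ⟨!![-1, 2; -1, 1], by decide⟩

/-- `γ₂` in the modular group. -/
def g2 : SpecialLinearGroup (Fin 2) ℤ := ⟨!![1, -1; 2, -1], by decide⟩

/-- `γ₃` in the modular group. -/
def g3 : SpecialLinearGroup (Fin 2) ℤ := ⟨!![0, 1; -1, 0], by decide⟩

/-- The subgroup of index three of the modular group that is generated by the elliptic elements of
order two. -/
def ellipticSubgroup : Subgroup (SpecialLinearGroup (Fin 2) ℤ) := Subgroup.closure {g1, g2, g3}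

lemma zHom_g1 : zHom g1 = gamma1 := by
  ext i j; fin_cases i <;> fin_cases j <;> rw [zHom_apply] <;> simp [g1, gamma1]

lemma zHom_g2 : zHom g2 = gamma2 := by
  ext i j; fin_cases i <;> fin_cases j <;> rw [zHom_apply] <;> simp [g2, gamma2]

lemma zHom_g3 : zHom g3 = gamma3 := by
  ext i j; fin_cases i <;> fin_cases j <;> rw [zHom_apply] <;> simp [g3, gamma3]

lemma g1_mem : g1 ∈ ellipticSubgroup := Subgroup.subset_closure (by simp)
lemma g2_mem : g2 ∈ ellipticSubgroup := Subgroup.subset_closure (by simp)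
lemma g3_mem : g3 ∈ ellipticSubgroup := Subgroup.subset_closure (by simp)

lemma conj_mem_elliptic {x : SpecialLinearGroup (Fin 2) ℤ}
    (h1 : x * g1 * x⁻¹ ∈ ellipticSubgroup) (h2 : x * g2 * x⁻¹ ∈ ellipticSubgroup)
    (h3 : x * g3 * x⁻¹ ∈ ellipticSubgroup) :
    ∀ y ∈ ellipticSubgroup, x * y * x⁻¹ ∈ ellipticSubgroup := by
  have : ellipticSubgroup ≤ ellipticSubgroup.comap (MulAut.conj x).toMonoidHom := by
    refine (Subgroup.closure_le _).mpr ?_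
    rintro y (rfl | rfl | rfl)
    · exact h1
    · exact h2
    · exact h3
  exact this

/-- Normality is what allows words in `S` and `T` to be rewritten. Conjugation by `T` and by its
inverse are checked separately, since mapping a subgroup into itself does not make conjugation
surjective. -/
lemma T_conj_mem : ∀ y ∈ ellipticSubgroup,
    ModularGroup.T * y * ModularGroup.T⁻¹ ∈ ellipticSubgroup := by
  apply conj_mem_elliptic
  · rw [show ModularGroup.T * g1 * ModularGroup.T⁻¹ = g1 * g2⁻¹ * g1⁻¹ by decide]
    exact mul_mem (mul_mem g1_mem (inv_mem g2_mem)) (inv_mem g1_mem)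
  · rw [show ModularGroup.T * g2 * ModularGroup.T⁻¹ = g1 * g3⁻¹ * g1⁻¹ by decide]
    exact mul_mem (mul_mem g1_mem (inv_mem g3_mem)) (inv_mem g1_mem)
  · rw [show ModularGroup.T * g3 * ModularGroup.T⁻¹ = g1 by decide]
    exact g1_mem

lemma T_inv_conj_mem : ∀ y ∈ ellipticSubgroup,
    ModularGroup.T⁻¹ * y * ModularGroup.T⁻¹⁻¹ ∈ ellipticSubgroup := by
  apply conj_mem_elliptic
  · rw [show ModularGroup.T⁻¹ * g1 * ModularGroup.T⁻¹⁻¹ = g3 by decide]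
    exact g3_mem
  · rw [show ModularGroup.T⁻¹ * g2 * ModularGroup.T⁻¹⁻¹ = g3 * g1⁻¹ * g3⁻¹ by decide]
    exact mul_mem (mul_mem g3_mem (inv_mem g1_mem)) (inv_mem g3_mem)
  · rw [show ModularGroup.T⁻¹ * g3 * ModularGroup.T⁻¹⁻¹ = g3 * g2⁻¹ * g3⁻¹ by decide]
    exact mul_mem (mul_mem g3_mem (inv_mem g2_mem)) (inv_mem g3_mem)

lemma image_act_mul (M N : GL (Fin 2) ℂ) (s : Set OrientedCircle) :
    act (M * N) '' s = act M '' (act N '' s) := by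
  rw [Set.image_image]; simp only [act_mul]

/-- `T` and `γ₁` both carry the cusps ∞, 0, 1 to ∞, 1, 2 in some order, so they differ by a rotation
of the Farey triangle. Thus `T` may be traded for an element of the elliptic subgroup. -/
lemma act_T_basicProng (d : ℤ) :
    act (zHom ModularGroup.T) '' basicProng d = act (zHom g1) '' basicProng d := by
  rw [act_zHom_basicProng, act_zHom_basicProng]
  have := tangentCircle_neg d 1 1
  simp [ModularGroup.T, g1] at this ⊢
  rw [this]
  ext C
  simp only [Set.mem_insert_iff, Set.mem_singleton_iff]
  tauto

lemma act_T_inv_basicProng (d : ℤ) :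
    act (zHom ModularGroup.T⁻¹) '' basicProng d = act (zHom g3) '' basicProng d := by
  have e : ModularGroup.T⁻¹ 0 0 = 1 ∧ ModularGroup.T⁻¹ 0 1 = -1 ∧ ModularGroup.T⁻¹ 1 0 = 0 ∧
      ModularGroup.T⁻¹ 1 1 = 1 := by decide
  rw [act_zHom_basicProng, act_zHom_basicProng, e.1, e.2.1, e.2.2.1, e.2.2.2]
  have h1 := tangentCircle_neg d 0 1
  have h2 := tangentCircle_neg d 1 (-1)
  simp [g3] at h1 h2 ⊢
  rw [h1, h2]
  ext C
  simp only [Set.mem_insert_iff, Set.mem_singleton_iff]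
  tauto

/-- The elliptic subgroup acts transitively on the images of the basic three-prong under the
modular group. -/
lemma exists_elliptic_basicProng (d : ℤ) (M : SpecialLinearGroup (Fin 2) ℤ) :
    ∃ h ∈ ellipticSubgroup, act (zHom M) '' basicProng d = act (zHom h) '' basicProng d := by
  have hM : M ∈ Subgroup.closure {ModularGroup.S, ModularGroup.T} := by
    rw [SpecialLinearGroup.SL2Z_generators]; trivial
  have hS : ModularGroup.S ∈ ellipticSubgroup := by
    rw [show ModularGroup.S = g3⁻¹ by decide]
    exact inv_mem g3_mem
  induction hM using Subgroup.closure_induction_left with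
  | one => exact ⟨1, one_mem _, rfl⟩
  | mul_left x hx y hy ih =>
    obtain ⟨h, hh, e⟩ := ih
    rcases hx with rfl | rfl
    · exact ⟨_ * h, mul_mem hS hh, by rw [map_mul, map_mul, image_act_mul, image_act_mul, e]⟩
    -- Applied to the basic prong, `T h = (T h T⁻¹) T` has the same effect as `(T h T⁻¹) γ₁`.
    · refine ⟨(ModularGroup.T * h * ModularGroup.T⁻¹) * g1,
        mul_mem (T_conj_mem h hh) g1_mem, ?_⟩
      rw [map_mul _ _ y, image_act_mul, e, map_mul _ _ g1, image_act_mul _ (zHom g1),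
        ← act_T_basicProng, ← image_act_mul, ← image_act_mul, ← map_mul, ← map_mul]
      simp [mul_assoc]
  | inv_mul_cancel x hx y hy ih =>
    obtain ⟨h, hh, e⟩ := ih
    rcases hx with rfl | rfl
    · exact ⟨_ * h, mul_mem (inv_mem hS) hh,
        by rw [map_mul, map_mul, image_act_mul, image_act_mul, e]⟩
    · refine ⟨(ModularGroup.T⁻¹ * h * ModularGroup.T⁻¹⁻¹) * g3,
        mul_mem (T_inv_conj_mem h hh) g3_mem, ?_⟩
      rw [map_mul _ _ y, image_act_mul, e, map_mul _ _ g3, image_act_mul _ (zHom g3),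
        ← act_T_inv_basicProng, ← image_act_mul, ← image_act_mul, ← map_mul, ← map_mul]
      simp [mul_assoc]

lemma sl_mul_apply (x y : SpecialLinearGroup (Fin 2) ℤ) (i j : Fin 2) :
    (x * y) i j = x i 0 * y 0 j + x i 1 * y 1 j := by
  change (x.1 * y.1) i j = _
  rw [Matrix.mul_apply, Fin.sum_univ_two]

/-- The reduction modulo three lies in the quaternion group in `SL₂(𝔽₃)`. -/
def QuaternionModThree (h : SpecialLinearGroup (Fin 2) ℤ) : Prop :=
  ((h 0 0 : ZMod 3) = h 1 1 ∧ (h 0 1 : ZMod 3) = 0 ∧ (h 1 0 : ZMod 3) = 0) ∨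
    (h 0 0 + h 1 1 : ZMod 3) = 0

/-- The generators have trace zero, and in `SL₂(𝔽₃)` the matrices of trace zero together with ±1
form the quaternion group of order eight. The rotations of order three of the Farey triangle have
trace ±1 and so are excluded. -/
lemma elliptic_mod_three {h : SpecialLinearGroup (Fin 2) ℤ} (hh : h ∈ ellipticSubgroup) :
    QuaternionModThree h := by
  have key : ∀ x ∈ ({g1, g2, g3} : Set (SpecialLinearGroup (Fin 2) ℤ)),
      ∀ y, QuaternionModThree y → QuaternionModThree (x * y) := by
    intro x hx y
    -- The determinant condition is essential here: without it the trace condition is not preserved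
    -- by multiplication.
    have hdet : (y 0 0 : ZMod 3) * y 1 1 - y 0 1 * y 1 0 = 1 := by
      have := congrArg (fun t : ℤ => (t : ZMod 3)) (sl_det y)
      push_cast at this
      exact this
    unfold QuaternionModThree
    simp only [sl_mul_apply]
    rcases hx with rfl | rfl | rfl <;>
      simp [g1, g2, g3] <;>
      revert hdet <;>
      generalize (y 0 0 : ZMod 3) = a <;> generalize (y 0 1 : ZMod 3) = b <;>
      generalize (y 1 0 : ZMod 3) = c <;> generalize (y 1 1 : ZMod 3) = e <;>
      revert a b c e <;> decide
  have neg : ∀ y, QuaternionModThree y → QuaternionModThree (-y) := by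
    intro y
    unfold QuaternionModThree
    simp only [SpecialLinearGroup.coe_neg, Matrix.neg_apply]
    push_cast
    rw [neg_inj, neg_eq_zero, neg_eq_zero, ← neg_add, neg_eq_zero]
    exact id
  induction hh using Subgroup.closure_induction_left with
  | one => left; simp
  | mul_left x hx y hy ih => exact key x hx y ih
  | inv_mul_cancel x hx y hy ih =>
    have : x⁻¹ = -x := by rcases hx with rfl | rfl | rfl <;> decide
    rw [this, neg_mul]
    exact neg _ (key x hx y ih)

/-- An element of the elliptic subgroup that permutes the cusps `∞`, `0` and `1` is trivial. -/
lemma elliptic_eq_one {h : SpecialLinearGroup (Fin 2) ℤ} (hh : h ∈ ellipticSubgroup)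
    (h0 : ∀ p q : ℤ, (p = h 0 0 ∧ q = h 1 0) ∨ (p = h 0 1 ∧ q = h 1 1) ∨
      (p = h 0 0 + h 0 1 ∧ q = h 1 0 + h 1 1) →
      (p ^ 2 = 1 ∧ q ^ 2 = 0) ∨ (p ^ 2 = 0 ∧ q ^ 2 = 1) ∨ (p ^ 2 = 1 ∧ q ^ 2 = 1 ∧ p * q = 1)) :
    h = 1 ∨ h = -1 := by
  have h3 := elliptic_mod_three hh
  have hdet := sl_det h
  have e1 := h0 _ _ (Or.inl ⟨rfl, rfl⟩)
  have e2 := h0 _ _ (Or.inr (Or.inl ⟨rfl, rfl⟩))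
  have e3 := h0 _ _ (Or.inr (Or.inr ⟨rfl, rfl⟩))
  have fin : (h 0 0 = 1 ∧ h 0 1 = 0 ∧ h 1 0 = 0 ∧ h 1 1 = 1) ∨
      (h 0 0 = -1 ∧ h 0 1 = 0 ∧ h 1 0 = 0 ∧ h 1 1 = -1) := by
    have cast : ∀ x : ℤ, ((x : ℤ) : ZMod 3) = 0 ↔ (3 : ℤ) ∣ x := fun x =>
      ZMod.intCast_zmod_eq_zero_iff_dvd x 3 |>.trans (by norm_num)
    have h3' : ((3 : ℤ) ∣ h 0 0 - h 1 1 ∧ (3 : ℤ) ∣ h 0 1 ∧ (3 : ℤ) ∣ h 1 0) ∨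
        (3 : ℤ) ∣ h 0 0 + h 1 1 := by
      rw [← cast, ← cast, ← cast, ← cast]; push_cast; rw [sub_eq_zero]; exact h3
    clear h3 h0
    have bd : ∀ x : ℤ, x ^ 2 = 0 ∨ x ^ 2 = 1 → x ∈ Finset.Icc (-1 : ℤ) 1 := by
      intro x hx
      rw [Finset.mem_Icc]
      rcases hx with hx | hx <;> constructor <;> nlinarith
    have b1 := bd (h 0 0) (by tauto)
    have b2 := bd (h 0 1) (by tauto)
    have b3 := bd (h 1 0) (by tauto)
    have b4 := bd (h 1 1) (by tauto)
    revert hdet e1 e2 e3 h3' b1 b2 b3 b4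
    generalize h 0 0 = a
    generalize h 0 1 = b
    generalize h 1 0 = c
    generalize h 1 1 = e
    -- All entries lie in {-1, 0, 1}. Among these matrices only ±1 and the order-three rotations
    -- permute the cusps, and the condition modulo 3 rejects the rotations.
    have main : ∀ a ∈ Finset.Icc (-1 : ℤ) 1, ∀ b ∈ Finset.Icc (-1 : ℤ) 1,
      ∀ c ∈ Finset.Icc (-1 : ℤ) 1, ∀ e ∈ Finset.Icc (-1 : ℤ) 1, a * e - b * c = 1 →
      ((a + b) ^ 2 = 1 ∧ (c + e) ^ 2 = 0 ∨ (a + b) ^ 2 = 0 ∧ (c + e) ^ 2 = 1 ∨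
        (a + b) ^ 2 = 1 ∧ (c + e) ^ 2 = 1 ∧ (a + b) * (c + e) = 1) →
      (((3 : ℤ) ∣ a - e ∧ (3 : ℤ) ∣ b ∧ (3 : ℤ) ∣ c) ∨ (3 : ℤ) ∣ a + e) →
      (a = 1 ∧ b = 0 ∧ c = 0 ∧ e = 1) ∨ (a = -1 ∧ b = 0 ∧ c = 0 ∧ e = -1) := by decide
    intro hdet _ _ e3 h3 b1 b2 b3 b4
    exact main a b1 b b2 c b3 e b4 hdet e3 h3
  rcases fin with ⟨ha, hb, hc, he⟩ | ⟨ha, hb, hc, he⟩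
  · left; ext i j; fin_cases i <;> fin_cases j <;> simp [ha, hb, hc, he]
  · right; ext i j; fin_cases i <;> fin_cases j <;> simp [ha, hb, hc, he]

/-! ### Normal forms in the group `A_K⁰` -/

lemma eta_sq {d : ℤ} (hd : d ≤ -15) : eta d ^ 2 = -d :=
  Real.sq_sqrt (by
    have : (d : ℝ) ≤ -15 := by exact_mod_cast hd
    linarith)

lemma eta_gt {d : ℤ} (hd : d ≤ -15) : 3 < eta d := by
  have h : (d : ℝ) ≤ -15 := by exact_mod_cast hd
  have h0 : 0 ≤ eta d := Real.sqrt_nonneg _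
  have := eta_sq hd
  nlinarith

lemma tau_re (d : ℤ) : (tau d).re = (eps d : ℝ) / 2 := by
  simp [tau]

lemma tau_im (d : ℤ) : (tau d).im = eta d / 2 := by
  simp [tau, eta]

/-- This is where the bound -15 enters. If Δ ≡ 0 then Δ ≤ -16 and η²/4 ≥ 4; if Δ ≡ 1 the real part
contributes at least 1/4 and η²/4 at least 15/4. Hence unit discs around integers and around points
of τ + ℤ do not overlap. -/
lemma le_normSq_tau_add {d : ℤ} (hd : d ≤ -15) (hm : d % 4 = 0 ∨ d % 4 = 1) (k : ℤ) :
    4 ≤ Complex.normSq (tau d + k) := by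
  rw [Complex.normSq_apply, Complex.add_re, Complex.add_im, tau_re, tau_im, Complex.intCast_re,
    Complex.intCast_im]
  have h := eta_sq hd
  rcases hm with hm | hm
  · have : d ≤ -16 := by omega
    have : (d : ℝ) ≤ -16 := by exact_mod_cast this
    nlinarith [sq_nonneg ((eps d : ℝ) / 2 + k)]
  · have h1 : (d : ℝ) ≤ -15 := by exact_mod_cast hd
    have he : eps d = 1 := by unfold eps; rw [if_neg (by omega)]
    rw [he]
    have : (0 : ℤ) ≤ k * (k + 1) := by
      rcases le_or_gt 0 k with hk | hk
      · positivity
      · nlinarith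
    have : (0 : ℝ) ≤ k * (k + 1) := by exact_mod_cast this
    push_cast
    nlinarith

/-- The points of the upper half plane that have distance at least one from all integers. -/
def cuspRegion : Set ℂ := {z | 0 < z.im ∧ ∀ n : ℤ, 1 ≤ Complex.normSq (z - n)}

lemma normSq_sub_int (z : ℂ) (n : ℤ) : Complex.normSq (z - n) = (z.re - n) ^ 2 + z.im ^ 2 := by
  rw [Complex.normSq_apply]; simp; ring

lemma one_le_of_mem_cuspRegion {z : ℂ} (hz : z ∈ cuspRegion) {c : ℤ} (hc : c ≠ 0) (e : ℤ) :
    1 ≤ Complex.normSq (c * z + e) := by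
  have hN : Complex.normSq (c * z + e) = (c * z.re + e) ^ 2 + c ^ 2 * z.im ^ 2 := by
    rw [Complex.normSq_apply]; simp; ring
  rw [hN]
  obtain ⟨-, h⟩ := hz
  simp only [normSq_sub_int] at h
  have hr := abs_sub_round z.re
  -- The nearest integer differs from the real part by at most 1/2. This height settles all `|c| ≥
  -- 2`, while `|c| = 1` is the definition of the region.
  have h34 : 3 / 4 ≤ z.im ^ 2 := by
    have h1 := h (round z.re)
    have : (z.re - round z.re) ^ 2 ≤ 1 / 4 := by
      rw [← sq_abs]; nlinarith [abs_nonneg (z.re - round z.re)]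
    linarith
  by_cases hc1 : c ^ 2 = 1
  · have hcR : (c : ℝ) ^ 2 = 1 := by exact_mod_cast hc1
    have := h (-(c * e))
    push_cast at this
    calc (1 : ℝ) ≤ (z.re - -(c * e)) ^ 2 + z.im ^ 2 := this
      _ = _ := by linear_combination (-(z.re ^ 2) - z.im ^ 2 + (e : ℝ) ^ 2) * hcR
  · have : 4 ≤ c ^ 2 := by
      have : 2 ≤ |c| := by
        by_contra hlt
        have h1 : |c| < 2 := by omega
        have h2 := abs_lt.mp h1
        have : c = 1 ∨ c = -1 := by omega
        rcases this with rfl | rfl <;> simp at hc1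
      rw [← sq_abs]; nlinarith
    have : (4 : ℝ) ≤ (c : ℝ) ^ 2 := by exact_mod_cast this
    nlinarith [sq_nonneg (c * z.re + e : ℝ)]

/-- Modular transformations that do not fix `∞` map the neighbourhood of the cusp `∞` to points
that have distance at most one from an integer. -/
lemma exists_near_int {h : SpecialLinearGroup (Fin 2) ℤ} (hc : h 1 0 ≠ 0) {z : ℂ}
    (hz : z ∈ cuspRegion) :
    ∃ w : ℂ, mobiusHom (zHom h) (z : OnePoint ℂ) = w ∧ 0 < w.im ∧
      ∃ n : ℤ, Complex.normSq (w - n) ≤ 1 := by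
  have hN := one_le_of_mem_cuspRegion hz hc (h 1 1)
  have hne : (h 1 0 : ℂ) * z + h 1 1 ≠ 0 := by
    intro h0; rw [h0] at hN; norm_num at hN
  have hdet : (h 0 0 : ℂ) * h 1 1 - h 0 1 * h 1 0 = 1 := by exact_mod_cast sl_det h
  refine ⟨(h 0 0 * z + h 0 1) / (h 1 0 * z + h 1 1), ?_, ?_⟩
  · rw [mobiusHom_apply, OnePoint.smul_some_eq_ite, zHom_apply, zHom_apply, if_neg hne]
    rfl
  set w := ((h 0 0 : ℂ) * z + h 0 1) / (h 1 0 * z + h 1 1) with hw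
  -- This is `w - a/c = -1 / (c (c z + e))`, multiplied by `c`; so `w` has distance at most `1/|c|`
  -- from `a/c`.
  have e : (h 1 0 : ℂ) * w - h 0 0 = -((h 1 0 : ℂ) * z + h 1 1)⁻¹ := by
    rw [hw]; field_simp; linear_combination -hdet
  have hcR : (h 1 0 : ℝ) ≠ 0 := by exact_mod_cast hc
  have him : w.im = z.im / Complex.normSq ((h 1 0 : ℂ) * z + h 1 1) := by
    have := congrArg Complex.im e
    simp only [Complex.sub_im, Complex.mul_im, Complex.intCast_re, Complex.intCast_im, zero_mul,
      add_zero, sub_zero, Complex.neg_im, Complex.inv_im, Complex.add_im] at this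
    apply mul_left_cancel₀ hcR
    rw [this]; ring
  have hn : Complex.normSq ((h 1 0 : ℂ) * w - h 0 0) ≤ 1 := by
    rw [e, Complex.normSq_neg, Complex.normSq_inv]
    exact inv_le_one_of_one_le₀ hN
  refine ⟨by rw [him]; exact div_pos hz.1 (by linarith), ?_⟩
  have hn' : (h 1 0 * w.re - h 0 0) ^ 2 + (h 1 0 : ℝ) ^ 2 * w.im ^ 2 ≤ 1 := by
    rw [Complex.normSq_apply] at hn
    simp at hn
    linarith
  simp only [normSq_sub_int]
  by_cases hc1 : (h 1 0) ^ 2 = 1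
  · refine ⟨h 1 0 * h 0 0, ?_⟩
    have hcR : (h 1 0 : ℝ) ^ 2 = 1 := by exact_mod_cast hc1
    push_cast
    calc (w.re - h 1 0 * h 0 0) ^ 2 + w.im ^ 2 =
        (h 1 0 * w.re - h 0 0) ^ 2 + (h 1 0 : ℝ) ^ 2 * w.im ^ 2 := by
          linear_combination (-(w.re ^ 2) - w.im ^ 2 + (h 0 0 : ℝ) ^ 2) * hcR
      _ ≤ 1 := hn'
  -- For `|c| ≥ 2` the height of `w` is at most 1/2, so the nearest integer is close enough.
  · refine ⟨round w.re, ?_⟩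
    have : 4 ≤ (h 1 0) ^ 2 := by
      have : 2 ≤ |h 1 0| := by
        by_contra hlt
        have h1 : |h 1 0| < 2 := by omega
        have h2 := abs_lt.mp h1
        have : h 1 0 = 1 ∨ h 1 0 = -1 := by omega
        rcases this with h' | h' <;> simp [h'] at hc1
      rw [← sq_abs]; nlinarith
    have : (4 : ℝ) ≤ (h 1 0 : ℝ) ^ 2 := by exact_mod_cast this
    have hr := abs_sub_round w.re
    have : (w.re - round w.re) ^ 2 ≤ 1 / 4 := by
      rw [← sq_abs]; nlinarith [abs_nonneg (w.re - round w.re)]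
    nlinarith [sq_nonneg (h 1 0 * w.re - h 0 0 : ℝ), sq_nonneg w.im]

lemma gamma4_coe (d : ℤ) (z : ℂ) :
    mobiusHom (gamma4 d) (z : OnePoint ℂ) = ((tau d - 1 - z : ℂ) : OnePoint ℂ) := by
  rw [mobiusHom_apply, OnePoint.smul_some_eq_ite]
  simp [gamma4]
  ring

/-- The triangle inequality suffices: points of τ + ℤ have absolute value at least 2, and `w` is
within 1 of an integer. The height stays positive because η/2 > 1. -/
lemma gamma4_mem_cuspRegion {d : ℤ} (hd : d ≤ -15) (hm : d % 4 = 0 ∨ d % 4 = 1) {w : ℂ}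
    (hw : 0 ≤ w.im) {n : ℤ} (hn : Complex.normSq (w - n) ≤ 1) : tau d - 1 - w ∈ cuspRegion := by
  have he := eta_gt hd
  constructor
  · have : w.im ≤ 1 := by
      rw [normSq_sub_int] at hn
      nlinarith [sq_nonneg (w.re - n)]
    simp only [Complex.sub_im, tau_im, Complex.one_im]
    linarith
  · intro m
    have h1 : ‖w - n‖ ≤ 1 := by
      rw [Complex.normSq_eq_norm_sq] at hn
      nlinarith [norm_nonneg (w - n)]
    have h2 : 2 ≤ ‖tau d + ((-1 - m - n : ℤ) : ℂ)‖ := by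
      have := le_normSq_tau_add hd hm (-1 - m - n)
      rw [Complex.normSq_eq_norm_sq] at this
      nlinarith [norm_nonneg (tau d + ((-1 - m - n : ℤ) : ℂ))]
    have h3 : tau d - 1 - w - m = (tau d + ((-1 - m - n : ℤ) : ℂ)) - (w - n) := by push_cast; ring
    have h4 := norm_sub_norm_le (tau d + ((-1 - m - n : ℤ) : ℂ)) (w - n)
    rw [h3, Complex.normSq_eq_norm_sq]
    nlinarith

lemma gamma4_real_mem_cuspRegion {d : ℤ} (hd : d ≤ -15) (x : ℝ) :
    tau d - 1 - x ∈ cuspRegion := by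
  have he := eta_gt hd
  constructor
  · simp only [Complex.sub_im, tau_im, Complex.one_im, Complex.ofReal_im]; linarith
  · intro n
    rw [normSq_sub_int]
    simp only [Complex.sub_im, tau_im, Complex.one_im, Complex.ofReal_im]
    nlinarith [sq_nonneg ((tau d - 1 - x : ℂ).re - n)]

lemma gamma4_mul_self (d : ℤ) : gamma4 d * gamma4 d = 1 := by
  ext i j; fin_cases i <;> fin_cases j <;> simp [gamma4, Matrix.mul_apply, Fin.sum_univ_two]

/-- A modular element that fixes ∞ is a translation up to sign, and a half-turn inverts
translations. In this case the ping-pong breaks down, but the word becomes shorter instead. -/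
lemma gamma4_conj {d : ℤ} {h : SpecialLinearGroup (Fin 2) ℤ} (hc : h 1 0 = 0) :
    gamma4 d * zHom h * gamma4 d = zHom h⁻¹ := by
  have hdet := sl_det h
  rw [hc, mul_zero, sub_zero] at hdet
  have he : h 0 0 = h 1 1 := by
    rcases Int.eq_one_or_neg_one_of_mul_eq_one' hdet with ⟨h1, h2⟩ | ⟨h1, h2⟩ <;> rw [h1, h2]
  have hi : h⁻¹ 0 0 = h 1 1 ∧ h⁻¹ 0 1 = -h 0 1 ∧ h⁻¹ 1 0 = -h 1 0 ∧ h⁻¹ 1 1 = h 0 0 := by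
    have := SpecialLinearGroup.SL2_inv_expl h
    rw [this]; simp
  have e1 : (zHom h).1 = !![(h 0 0 : ℂ), h 0 1; h 1 0, h 1 1] := by
    ext i j; fin_cases i <;> fin_cases j <;> rfl
  have e2 : (zHom h⁻¹).1 = !![(h⁻¹ 0 0 : ℂ), h⁻¹ 0 1; h⁻¹ 1 0, h⁻¹ 1 1] := by
    ext i j; fin_cases i <;> fin_cases j <;> rfl
  have e3 : (gamma4 d).1 = !![1, 1 - tau d; 0, -1] := rfl
  apply Units.ext
  rw [Units.val_mul, Units.val_mul, e1, e2, e3, hi.1, hi.2.1, hi.2.2.1, hi.2.2.2, hc, he]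
  ext i j
  fin_cases i <;> fin_cases j <;> simp
  ring

lemma realCircle_form (z : ℂ) : realCircle.form (z : OnePoint ℂ) = 2 * z.im := by
  rw [form_coe]; simp [realCircle]

lemma mem_carrier_realCircle {z : ℂ} : (z : OnePoint ℂ) ∈ realCircle.carrier ↔ z.im = 0 := by
  rw [mem_carrier, realCircle_form]; simp

lemma infty_mem_realCircle : OnePoint.infty ∈ realCircle.carrier := rfl

lemma carrier_realCircle : realCircle.carrier = realLine := by
  ext x
  induction x using OnePoint.rec with
  | infty => simp [realLine, infty_mem_realCircle]
  | coe z =>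
    rw [mem_carrier_realCircle]
    simp only [realLine, Set.mem_union, Set.mem_singleton_iff, OnePoint.coe_ne_infty, false_or,
      Set.mem_range, OnePoint.coe_eq_coe]
    constructor
    · intro h; exact ⟨z.re, Complex.ext rfl (by simp [h])⟩
    · rintro ⟨x, rfl⟩; simp

lemma zHom_mem_realCircle {h : SpecialLinearGroup (Fin 2) ℤ} {x : OnePoint ℂ} :
    mobiusHom (zHom h) x ∈ realCircle.carrier ↔ x ∈ realCircle.carrier := by
  conv_lhs => rw [← act_zHom_realCircle h]
  rw [carrier_act, (mobiusHom (zHom h)).injective.mem_set_image]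

/-- Products of elements of the elliptic subgroup and `γ₄` whose action on some real point can be
followed by a ping-pong argument. -/
inductive Reduced (d : ℤ) : Equiv.Perm (OnePoint ℂ) → Prop
  | base (h : SpecialLinearGroup (Fin 2) ℤ) (hh : h ∈ ellipticSubgroup) :
      Reduced d (mobiusHom (zHom h))
  | step (g : Equiv.Perm (OnePoint ℂ)) (h : SpecialLinearGroup (Fin 2) ℤ)
      (hg : Reduced d g) (hh : h ∈ ellipticSubgroup) (x : OnePoint ℂ)
      (hx : x ∈ realCircle.carrier) (z : ℂ) (hz : z ∈ cuspRegion)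
      (e : mobiusHom (gamma4 d) (g x) = z) :
      Reduced d (mobiusHom (zHom h) * mobiusHom (gamma4 d) * g)

lemma Reduced.mul_left {d : ℤ} {g : Equiv.Perm (OnePoint ℂ)} (hg : Reduced d g)
    {k : SpecialLinearGroup (Fin 2) ℤ} (hk : k ∈ ellipticSubgroup) :
    Reduced d (mobiusHom (zHom k) * g) := by
  cases hg with
  | base h hh =>
    rw [← map_mul, ← map_mul]
    exact .base _ (mul_mem hk hh)
  | step g h hg hh x hx z hz e =>
    have e1 : mobiusHom (zHom k) * (mobiusHom (zHom h) * mobiusHom (gamma4 d) * g) =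
        mobiusHom (zHom (k * h)) * mobiusHom (gamma4 d) * g := by
      rw [map_mul zHom, map_mul mobiusHom]; simp only [mul_assoc]
    rw [e1]
    exact .step g _ hg (mul_mem hk hh) x hx z hz e

/-- If the last elliptic factor moves ∞, it takes the followed point from the cusp region to within
distance one of an integer, and γ₄ brings it back to the region. If it fixes ∞, the two letters γ₄
cancel. -/
lemma Reduced.gamma4_mul {d : ℤ} (hd : d ≤ -15) (hm : d % 4 = 0 ∨ d % 4 = 1)
    {g : Equiv.Perm (OnePoint ℂ)} (hg : Reduced d g) :
    Reduced d (mobiusHom (gamma4 d) * g) := by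
  cases hg with
  | base h hh =>
    -- The point to follow is the one that `h` sends to 0; then γ₄ sends it to `τ - 1`.
    have := Reduced.step (d := d) _ 1 (.base h hh) (one_mem _)
      (mobiusHom (zHom h⁻¹) ((0 : ℂ) : OnePoint ℂ)) ?_ _
      (gamma4_real_mem_cuspRegion hd 0) ?_
    · rwa [map_one, map_one, one_mul] at this
    · rw [zHom_mem_realCircle, mem_carrier_realCircle]; simp
    · rw [← Equiv.Perm.mul_apply (mobiusHom (zHom h)), ← map_mul, ← map_mul, mul_inv_cancel,
        map_one, map_one, Equiv.Perm.one_apply, gamma4_coe]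
      simp
  | step g h hg hh x hx z hz e =>
    by_cases hc : h 1 0 = 0
    · have : mobiusHom (gamma4 d) * (mobiusHom (zHom h) * mobiusHom (gamma4 d) * g) =
          mobiusHom (zHom h⁻¹) * g := by
        rw [← gamma4_conj (d := d) hc, map_mul, map_mul]
        simp only [mul_assoc]
      rw [this]
      exact hg.mul_left (inv_mem hh)
    · obtain ⟨w, hw, hpos, n, hn⟩ := exists_near_int hc hz
      have := Reduced.step (d := d) _ 1 (.step g h hg hh x hx z hz e) (one_mem _) x hx _
        (gamma4_mem_cuspRegion hd hm hpos.le hn) ?_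
      · rwa [map_one, map_one, one_mul] at this
      rw [Equiv.Perm.mul_apply, Equiv.Perm.mul_apply, e, hw, gamma4_coe]

lemma reduced_of_mem {d : ℤ} (hd : d ≤ -15) (hm : d % 4 = 0 ∨ d % 4 = 1)
    {g : Equiv.Perm (OnePoint ℂ)} (hg : g ∈ groupA d) : Reduced d g := by
  have h4 : (mobiusHom (gamma4 d))⁻¹ = mobiusHom (gamma4 d) := by
    rw [inv_eq_iff_mul_eq_one, ← map_mul, gamma4_mul_self, map_one]
  unfold groupA at hg
  rw [← zHom_g1, ← zHom_g2, ← zHom_g3] at hg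
  induction hg using Subgroup.closure_induction_left with
  | one =>
    have := Reduced.base (d := d) 1 (one_mem _)
    rwa [map_one, map_one] at this
  | mul_left x hx y hy ih =>
    rcases hx with rfl | rfl | rfl | rfl
    · exact ih.mul_left g1_mem
    · exact ih.mul_left g2_mem
    · exact ih.mul_left g3_mem
    · exact ih.gamma4_mul hd hm
  | inv_mul_cancel x hx y hy ih =>
    rcases hx with rfl | rfl | rfl | rfl
    · rw [← map_inv, ← map_inv]; exact ih.mul_left (inv_mem g1_mem)
    · rw [← map_inv, ← map_inv]; exact ih.mul_left (inv_mem g2_mem)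
    · rw [← map_inv, ← map_inv]; exact ih.mul_left (inv_mem g3_mem)
    · rw [h4]; exact ih.gamma4_mul hd hm

/-- The stabilizer of the extended real line in `A_K⁰` is generated by `γ₁`, `γ₂` and `γ₃`. -/
lemma exists_elliptic_of_stabilizes {d : ℤ} (hd : d ≤ -15) (hm : d % 4 = 0 ∨ d % 4 = 1)
    {g : Equiv.Perm (OnePoint ℂ)} (hg : g ∈ groupA d)
    (hs : ∀ x ∈ realCircle.carrier, g x ∈ realCircle.carrier) :
    ∃ h ∈ ellipticSubgroup, g = mobiusHom (zHom h) := by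
  cases reduced_of_mem hd hm hg with
  | base h hh => exact ⟨h, hh, rfl⟩
  | step g h hg hh x hx z hz e =>
    -- The recorded real point is moved off the real line by `γ₄ g`, and `h` preserves the real
    -- line.
    exfalso
    have := hs x hx
    rw [Equiv.Perm.mul_apply, Equiv.Perm.mul_apply, e, zHom_mem_realCircle,
      mem_carrier_realCircle] at this
    exact hz.1.ne' this

lemma zHom_mem_groupA {d : ℤ} {h : SpecialLinearGroup (Fin 2) ℤ} (hh : h ∈ ellipticSubgroup) :
    mobiusHom (zHom h) ∈ groupA d := by
  have : ellipticSubgroup ≤ (groupA d).comap (mobiusHom.comp zHom) := by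
    refine (Subgroup.closure_le _).mpr ?_
    rintro x (rfl | rfl | rfl)
    · change mobiusHom (zHom g1) ∈ groupA d
      rw [zHom_g1]; exact Subgroup.subset_closure (by simp)
    · change mobiusHom (zHom g2) ∈ groupA d
      rw [zHom_g2]; exact Subgroup.subset_closure (by simp)
    · change mobiusHom (zHom g3) ∈ groupA d
      rw [zHom_g3]; exact Subgroup.subset_closure (by simp)
  exact this hh

section Field

variable {K : Type*} [Field K]

/-! ### Bianchi circles -/

/-- Invertible integral matrices of determinant `1` or `-1`, as complex matrices. -/
def signedUnimodular (φ : K →+* ℂ) : Subgroup (GL (Fin 2) ℂ) :=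
  (((powMonoidHom 2).comp (GeneralLinearGroup.det : GL (Fin 2) (𝓞 K) →* (𝓞 K)ˣ)).ker).map
    (GeneralLinearGroup.map (integerEmb φ))

lemma mem_signedUnimodular {φ : K →+* ℂ} {N : GL (Fin 2) ℂ} :
    N ∈ signedUnimodular φ ↔ ∃ M : GL (Fin 2) (𝓞 K), (M.1.det = 1 ∨ M.1.det = -1) ∧
      GeneralLinearGroup.map (integerEmb φ) M = N := by
  unfold signedUnimodular
  simp only [Subgroup.mem_map, MonoidHom.mem_ker, MonoidHom.comp_apply, powMonoidHom_apply]
  refine exists_congr fun M => and_congr_left fun _ => ?_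
  rw [Units.ext_iff, Units.val_pow_eq_pow_val, Units.val_one, sq_eq_one_iff]
  rfl

lemma sl_mem_signedUnimodular (φ : K →+* ℂ) (M : SpecialLinearGroup (Fin 2) (𝓞 K)) :
    GeneralLinearGroup.map (integerEmb φ) (M : GL (Fin 2) (𝓞 K)) ∈ signedUnimodular φ :=
  mem_signedUnimodular.mpr ⟨M, Or.inl M.2, rfl⟩

lemma zHom_mem_signedUnimodular (φ : K →+* ℂ) (h : SpecialLinearGroup (Fin 2) ℤ) :
    zHom h ∈ signedUnimodular φ := by
  have := sl_mem_signedUnimodular φ (SpecialLinearGroup.map (Int.castRingHom (𝓞 K)) h)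
  convert this
  ext i j
  rw [zHom_apply]
  change _ = integerEmb φ ((h i j : ℤ) : 𝓞 K)
  simp

lemma mem_bianchiCircles {φ : K →+* ℂ} {C : OrientedCircle} :
    C ∈ bianchiCircles φ ↔ ∃ M : SpecialLinearGroup (Fin 2) (𝓞 K),
      C = act (GeneralLinearGroup.map (integerEmb φ) (M : GL (Fin 2) (𝓞 K))) realCircle ∨
      C = (act (GeneralLinearGroup.map (integerEmb φ) (M : GL (Fin 2) (𝓞 K))) realCircle).neg := by
  refine exists_congr fun M => ?_
  rw [← carrier_realCircle, ← carrier_act]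
  constructor
  · intro h; exact eq_or_eq_neg_of_carrier_eq h.symm
  · rintro (rfl | rfl)
    · rfl
    · rw [carrier_neg]

lemma neg_neg_circle (C : OrientedCircle) : C.neg.neg = C := by
  apply pedoe_injective; simp [pedoe, OrientedCircle.neg]

lemma neg_mem_bianchiCircles {φ : K →+* ℂ} {C : OrientedCircle} (h : C ∈ bianchiCircles φ) :
    C.neg ∈ bianchiCircles φ := by
  obtain ⟨M, hM⟩ := h
  exact ⟨M, by rw [carrier_neg]; exact hM⟩

lemma realCircle_mem_bianchiCircles (φ : K →+* ℂ) : realCircle ∈ bianchiCircles φ :=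
  mem_bianchiCircles.mpr ⟨1, Or.inl (by
    rw [map_one, map_one]; exact (act_one _).symm)⟩

/-- The reflection `z ↦ -z`, which reverses the orientation of the real line. -/
lemma act_diag_realCircle {N : GL (Fin 2) ℂ} (hN : N.1 = !![-1, 0; 0, 1]) :
    act N realCircle = realCircle.neg := by
  have e : ∀ i j, N i j = !![(-1 : ℂ), 0; 0, 1] i j := fun i j => by rw [← hN]
  have hdet : ‖N.1.det‖ = 1 := by rw [hN]; simp [det_fin_two]
  apply pedoe_injective
  ext i
  fin_cases i <;> simp [pedoe, act, OrientedCircle.neg, realCircle, e, hdet]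

lemma act_mem_bianchiCircles {φ : K →+* ℂ} {N : GL (Fin 2) ℂ} (hN : N ∈ signedUnimodular φ)
    {C : OrientedCircle} (hC : C ∈ bianchiCircles φ) : act N C ∈ bianchiCircles φ := by
  suffices h : ∀ M : GL (Fin 2) (𝓞 K), (M.1.det = 1 ∨ M.1.det = -1) →
      act (GeneralLinearGroup.map (integerEmb φ) M) realCircle ∈ bianchiCircles φ by
    obtain ⟨M, hM, rfl⟩ := mem_signedUnimodular.mp hN
    obtain ⟨M', hM'⟩ := mem_bianchiCircles.mp hC
    have := h (M * M') (by
      rw [Units.val_mul, det_mul, show (M' : GL (Fin 2) (𝓞 K)).1.det = 1 from M'.2, mul_one]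
      exact hM)
    rw [map_mul, act_mul] at this
    rcases hM' with rfl | rfl
    · exact this
    · rw [act_neg]; exact neg_mem_bianchiCircles this
  have lift : ∀ M : GL (Fin 2) (𝓞 K), M.1.det = 1 →
      ∃ M' : SpecialLinearGroup (Fin 2) (𝓞 K), (M' : GL (Fin 2) (𝓞 K)) = M :=
    fun M h => ⟨⟨M.1, h⟩, Units.ext rfl⟩
  rintro M (h | h)
  · obtain ⟨M', rfl⟩ := lift M h
    exact mem_bianchiCircles.mpr ⟨M', Or.inl rfl⟩
  -- Multiplying by diag(-1, 1) on the right restores determinant one; on the real line it only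
  -- reverses the orientation.
  · have hs : !![(-1 : 𝓞 K), 0; 0, 1] * !![(-1 : 𝓞 K), 0; 0, 1] = 1 := by
      ext i j; fin_cases i <;> fin_cases j <;> simp
    let δ : GL (Fin 2) (𝓞 K) := ⟨_, _, hs, hs⟩
    have hδ : act (GeneralLinearGroup.map (integerEmb φ) δ) realCircle = realCircle.neg := by
      apply act_diag_realCircle
      ext i j
      rw [GeneralLinearGroup.map_apply]
      fin_cases i <;> fin_cases j <;> simp [δ]
    obtain ⟨M', hM'⟩ := lift (M * δ) (by rw [Units.val_mul, det_mul, h]; simp [δ, det_fin_two])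
    refine mem_bianchiCircles.mpr ⟨M', Or.inr ?_⟩
    rw [hM', map_mul, act_mul, hδ, act_neg, neg_neg_circle]

variable [NumberField K]

lemma gamma4_mem_signedUnimodular (hK : Module.finrank ℚ K = 2) (hd : discr K ≤ -15)
    (φ : K →+* ℂ) : gamma4 (discr K) ∈ signedUnimodular φ := by
  obtain ⟨t, ht⟩ := (range_integerEmb hK (by linarith) φ (tau (discr K))).mpr ⟨0, 1, by simp⟩
  have hs : !![(1 : 𝓞 K), 1 - t; 0, -1] * !![(1 : 𝓞 K), 1 - t; 0, -1] = 1 := by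
    ext i j; fin_cases i <;> fin_cases j <;> simp
  refine mem_signedUnimodular.mpr ⟨⟨_, _, hs, hs⟩, Or.inr (by simp [det_fin_two]), ?_⟩
  ext i j
  rw [GeneralLinearGroup.map_apply]
  fin_cases i <;> fin_cases j <;> simp [gamma4, ht]

/-- The coordinates of Bianchi circles. -/
lemma bianchi_coords (hK : Module.finrank ℚ K = 2) (hd : discr K ≤ -15) {φ : K →+* ℂ}
    {C : OrientedCircle} (hC : C ∈ bianchiCircles φ) :
    ∃ s s' k l : ℤ, C.b = eta (discr K) * s ∧ C.b' = eta (discr K) * s' ∧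
      C.a.re = eta (discr K) * k / 2 ∧ (C.a.im = 1 + eta (discr K) ^ 2 / 2 * l ∨
        C.a.im = -(1 + eta (discr K) ^ 2 / 2 * l)) := by
  suffices h : ∀ M : SpecialLinearGroup (Fin 2) (𝓞 K), ∀ D : OrientedCircle,
      D = act (GeneralLinearGroup.map (integerEmb φ) (M : GL (Fin 2) (𝓞 K))) realCircle →
      ∃ s s' k l : ℤ, D.b = eta (discr K) * s ∧ D.b' = eta (discr K) * s' ∧
      D.a.re = eta (discr K) * k / 2 ∧ D.a.im = -(1 + eta (discr K) ^ 2 / 2 * l) by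
    obtain ⟨M, rfl | rfl⟩ := mem_bianchiCircles.mp hC
    · obtain ⟨s, s', k, l, h1, h2, h3, h4⟩ := h M _ rfl
      exact ⟨s, s', k, l, h1, h2, h3, Or.inr h4⟩
    · obtain ⟨s, s', k, l, h1, h2, h3, h4⟩ := h M _ rfl
      refine ⟨-s, -s', -k, l, ?_, ?_, ?_, Or.inl ?_⟩ <;>
        simp only [OrientedCircle.neg, h1, h2, h3, h4, Complex.neg_re, Complex.neg_im] <;>
        push_cast <;> ring
  rintro M D rfl
  set N := GeneralLinearGroup.map (integerEmb φ) (M : GL (Fin 2) (𝓞 K)) with hN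
  have hdet : N.1.det = 1 := by
    have e : N.1 = (integerEmb φ).mapMatrix M.1 := rfl
    rw [e, ← RingHom.map_det, M.2, map_one]
  have hent : ∀ i j, ∃ m n : ℤ, N i j = m + n * tau (discr K) := fun i j =>
    (range_integerEmb hK (by linarith) φ _).mp ⟨M i j, rfl⟩
  choose m n hmn using hent
  have hre : ∀ i j, (N i j).re = m i j + n i j * (tau (discr K)).re := fun i j => by
    rw [hmn]; simp
  have him : ∀ i j, (N i j).im = n i j * (eta (discr K) / 2) := fun i j => by
    rw [hmn, ← tau_im]; simp
  rw [det_fin_two] at hdet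
  have hdr := congrArg Complex.re hdet
  simp only [Complex.sub_re, Complex.mul_re, Complex.one_re] at hdr
  have hn : ‖N.1.det‖ = 1 := by rw [det_fin_two, hdet, norm_one]
  -- For a matrix with rows `p, q` and `r, s` the image of R has curvature `2 Im(r s̄)`,
  -- co-curvature `2 Im(p q̄)` and curvature-centre `i (q r̄ - p s̄)`. As `Im τ = η/2`, the first
  -- three coordinates are read off; the last also uses that the determinant has real part 1.
  refine ⟨n 1 0 * m 1 1 - m 1 0 * n 1 1, n 0 0 * m 0 1 - m 0 0 * n 0 1,
    n 0 0 * m 1 1 - m 0 0 * n 1 1 - (n 0 1 * m 1 0 - m 0 1 * n 1 0),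
    n 0 0 * n 1 1 - n 0 1 * n 1 0, ?_, ?_, ?_, ?_⟩
  · simp only [act, hn, realCircle]
    simp [hre, him]
    ring
  · simp only [act, hn, realCircle]
    simp [hre, him]
    ring
  · simp only [act, hn, realCircle]
    simp [hre, him]
    ring
  · simp only [act, hn, realCircle]
    simp only [hre, him] at hdr
    simp [hre, him]
    linear_combination -hdr

/-- Up to sign, `Im a` is the product with R. Since `l` is an integer and η²/2 > 4, the value `1 +
η² l / 2` cannot lie strictly between -1 and 1; so no Bianchi circle crosses R. -/
lemma one_le_im_sq (hK : Module.finrank ℚ K = 2) (hd : discr K ≤ -15) {φ : K →+* ℂ}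
    {C : OrientedCircle} (hC : C ∈ bianchiCircles φ) : 1 ≤ C.a.im ^ 2 := by
  obtain ⟨-, -, -, l, -, -, -, h⟩ := bianchi_coords hK hd hC
  have he := eta_gt hd
  have key : 1 ≤ (1 + eta (discr K) ^ 2 / 2 * l) ^ 2 := by
    rcases lt_trichotomy l 0 with hl | rfl | hl
    · have : (l : ℝ) ≤ -1 := by exact_mod_cast (by omega : l ≤ -1)
      have h2 : 1 + eta (discr K) ^ 2 / 2 * l ≤ -1 := by nlinarith
      nlinarith
    · simp
    · have : (0 : ℝ) ≤ eta (discr K) ^ 2 / 2 * l := by positivity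
      nlinarith
  rcases h with h | h <;> rw [h]
  · exact key
  · rw [neg_sq]; exact key

/-! ### Bianchi circles do not separate adjacent lines -/

/-- The points of `S` do not lie in the interior of `D`. -/
def Outside (D : OrientedCircle) (S : Set (OnePoint ℂ)) : Prop := ∀ x ∈ S, 0 ≤ D.form x

lemma outside_act {N : GL (Fin 2) ℂ} {D : OrientedCircle} {S : Set (OnePoint ℂ)} :
    Outside (act N D) (mobiusHom N '' S) ↔ Outside D S := by
  unfold Outside
  rw [Set.forall_mem_image]
  simp only [act_form_nonneg]

lemma outside_realCircle_iff {D : OrientedCircle} :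
    Outside D realCircle.carrier ↔
      0 ≤ D.b ∧ ∀ x : ℝ, 0 ≤ D.b * x ^ 2 - 2 * (D.a.re * x) + D.b' := by
  constructor
  · intro h
    refine ⟨h OnePoint.infty infty_mem_realCircle, fun x => ?_⟩
    have := h ((x : ℂ) : OnePoint ℂ) (mem_carrier_realCircle.mpr (by simp))
    rw [form_coe] at this
    simpa using this
  · rintro ⟨h0, h⟩ x hx
    induction x using OnePoint.rec with
    | infty => exact h0
    | coe z =>
      rw [mem_carrier_realCircle] at hx
      have := h z.re
      rw [form_coe, hx]
      linarith

/-- A Bianchi circle does not cross the extended real line. -/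
lemma outside_realCircle_or (hK : Module.finrank ℚ K = 2) (hd : discr K ≤ -15) {φ : K →+* ℂ}
    {D : OrientedCircle} (hD : D ∈ bianchiCircles φ) :
    Outside D realCircle.carrier ∨ Outside D.neg realCircle.carrier := by
  have h1 := one_le_im_sq hK hd hD
  have e := D.eqn_re_im
  rw [outside_realCircle_iff, outside_realCircle_iff]
  simp only [OrientedCircle.neg, Complex.neg_re]
  -- On the real line the form is a polynomial of degree at most two with quarter discriminant `1 -
  -- (Im a)² ≤ 0`, so it does not change sign.
  rcases lt_trichotomy D.b 0 with hb | hb | hb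
  · right
    refine ⟨by linarith, fun x => ?_⟩
    nlinarith [sq_nonneg (D.b * x - D.a.re)]
  · have hr : D.a.re = 0 := by
      rw [hb] at e; nlinarith
    rw [hb, hr]
    rcases le_total 0 D.b' with h | h
    · left; exact ⟨le_rfl, fun x => by linarith⟩
    · right; exact ⟨by simp, fun x => by linarith⟩
  · left
    refine ⟨hb.le, fun x => ?_⟩
    nlinarith [sq_nonneg (D.b * x - D.a.re)]

lemma act_gamma4_realCircle (d : ℤ) : act (gamma4 d) realCircle = tangentCircle d 1 0 := by
  have e : ∀ i j, gamma4 d i j = !![(1 : ℂ), 1 - tau d; 0, -1] i j := fun i j => rfl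
  have hdet : ‖(gamma4 d).1.det‖ = 1 := by
    change ‖(!![(1 : ℂ), 1 - tau d; 0, -1]).det‖ = 1
    simp [det_fin_two]
  apply pedoe_injective
  ext i
  fin_cases i <;> simp [pedoe, act, realCircle, tangentCircle, e, hdet, tau_im]
  ring

lemma act_gamma4_tangentCircle (d : ℤ) :
    act (gamma4 d) (tangentCircle d 1 0) = realCircle := by
  rw [← act_gamma4_realCircle, ← act_mul, gamma4_mul_self, act_one]

/-- The union of the extended real line and the line through `τ` that is tangent to it. -/
def adjacentLines (d : ℤ) : Set (OnePoint ℂ) :=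
  realCircle.carrier ∪ (tangentCircle d 1 0).carrier

lemma gamma4_image_adjacentLines (d : ℤ) :
    mobiusHom (gamma4 d) '' adjacentLines d = adjacentLines d := by
  unfold adjacentLines
  rw [Set.image_union, ← carrier_act, ← carrier_act, act_gamma4_realCircle,
    act_gamma4_tangentCircle, Set.union_comm]

lemma outside_adjacentLines_iff {d : ℤ} {D : OrientedCircle} :
    Outside D (adjacentLines d) ↔
      Outside D realCircle.carrier ∧ Outside D (tangentCircle d 1 0).carrier := by
  unfold Outside adjacentLines
  simp only [Set.mem_union, or_imp, forall_and]

lemma tangentCircle_one_zero_form (d : ℤ) (z : ℂ) :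
    (tangentCircle d 1 0).form (z : OnePoint ℂ) = eta d - 2 * z.im := by
  rw [form_coe]; simp [tangentCircle]; ring

lemma tangentCircle_mem_bianchiCircles (hK : Module.finrank ℚ K = 2) (hd : discr K ≤ -15)
    (φ : K →+* ℂ) : tangentCircle (discr K) 1 0 ∈ bianchiCircles φ := by
  rw [← act_gamma4_realCircle]
  exact act_mem_bianchiCircles (gamma4_mem_signedUnimodular hK hd φ)
    (realCircle_mem_bianchiCircles φ)

lemma infty_mem_tangentCircle (d : ℤ) : OnePoint.infty ∈ (tangentCircle d 1 0).carrier := by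
  rw [mem_carrier, form_infty]; simp [tangentCircle]

/-- No Bianchi circle separates two adjacent lines. -/
lemma outside_adjacentLines_or (hK : Module.finrank ℚ K = 2) (hd : discr K ≤ -15) {φ : K →+* ℂ}
    {D : OrientedCircle} (hD : D ∈ bianchiCircles φ) :
    Outside D (adjacentLines (discr K)) ∨ Outside D.neg (adjacentLines (discr K)) := by
  have he := eta_gt hd
  wlog h1 : Outside D realCircle.carrier generalizing D with H
  · have h2 := (outside_realCircle_or hK hd hD).resolve_left h1
    have := H (neg_mem_bianchiCircles hD) h2
    rw [neg_neg_circle] at this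
    exact this.symm
  -- As γ₄ exchanges the two lines, the result for the real line carries over to the other one.
  have h4 := gamma4_mem_signedUnimodular hK hd φ
  have h2 := outside_realCircle_or hK hd (act_mem_bianchiCircles h4 hD)
  rw [← outside_act (N := gamma4 (discr K)), ← outside_act (N := gamma4 (discr K)) (D := (act _ D).neg),
    ← act_neg, ← act_mul, ← act_mul, gamma4_mul_self, act_one, act_one, ← carrier_act,
    act_gamma4_realCircle] at h2
  rw [outside_adjacentLines_iff, outside_adjacentLines_iff]
  rcases h2 with h2 | h2
  · exact Or.inl ⟨h1, h2⟩
  -- Both lines pass through ∞, so a circle that has them on opposite sides passes through ∞ as well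
  -- and is a horizontal line between them.
  · have hb : D.b = 0 := by
      have a1 := h1 OnePoint.infty infty_mem_realCircle
      have a2 := h2 OnePoint.infty (infty_mem_tangentCircle _)
      rw [form_infty] at a1 a2
      simp [OrientedCircle.neg] at a2
      linarith
    have e := D.eqn_re_im
    have him := one_le_im_sq hK hd hD
    rw [hb] at e
    have hr : D.a.re = 0 := by nlinarith
    rw [hr] at e
    have form : ∀ z : ℂ, D.form (z : OnePoint ℂ) = D.b' - 2 * (D.a.im * z.im) := fun z => by
      rw [form_coe, hb, hr]; ring
    have b0 := h1 ((0 : ℂ) : OnePoint ℂ) (mem_carrier_realCircle.mpr (by simp))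
    rw [form] at b0
    simp at b0
    have b1 := h2 ((⟨0, eta (discr K) / 2⟩ : ℂ) : OnePoint ℂ) (by
      rw [mem_carrier, tangentCircle_one_zero_form]; ring)
    rw [form_neg, form] at b1
    simp only at b1
    have him1 : D.a.im = 1 := by
      have : (D.a.im - 1) * (D.a.im + 1) = 0 := by linear_combination -e
      rcases mul_eq_zero.mp this with h | h
      · linarith
      · have : D.a.im = -1 := by linarith
        rw [this] at b1; linarith
    obtain ⟨-, s, -, -, -, hs, -⟩ := bianchi_coords hK hd hD
    rw [him1] at form b1
    -- Horizontal Bianchi lines have heights in (η/2)ℤ, so `D` is one of the two lines; its form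
    -- vanishes there, and either sign is allowed on that line.
    have : 0 ≤ s ∧ s ≤ 1 := by
      constructor
      · have : (0 : ℝ) ≤ s := by
          by_contra hlt
          nlinarith
        exact_mod_cast this
      · have : (s : ℝ) ≤ 1 := by
          by_contra hlt
          nlinarith
        exact_mod_cast this
    have : s = 0 ∨ s = 1 := by omega
    rcases this with rfl | rfl
    · right
      refine ⟨?_, h2⟩
      intro x hx
      rw [form_neg]
      induction x using OnePoint.rec with
      | infty => rw [form_infty, hb, neg_zero]
      | coe z =>
        rw [mem_carrier_realCircle] at hx
        rw [form, hs, hx]; simp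
    · left
      refine ⟨h1, ?_⟩
      intro x hx
      induction x using OnePoint.rec with
      | infty => rw [form_infty, hb]
      | coe z =>
        rw [mem_carrier, tangentCircle_one_zero_form] at hx
        rw [form, hs]; push_cast; linarith

end Field

/-! ### The orbit of the real line is a tangency-connected collection without straddling -/

/-- The matrices `γ₁`, `γ₂`, `γ₃` and `γ₄` generate this group. -/
def matrixGroup (d : ℤ) : Subgroup (GL (Fin 2) ℂ) :=
  Subgroup.closure {gamma1, gamma2, gamma3, gamma4 d}

lemma map_matrixGroup (d : ℤ) : (matrixGroup d).map mobiusHom = groupA d := by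
  unfold matrixGroup groupA
  rw [MonoidHom.map_closure]
  simp only [Set.image_insert_eq, Set.image_singleton]

lemma mem_groupA {d : ℤ} {g : Equiv.Perm (OnePoint ℂ)} :
    g ∈ groupA d ↔ ∃ N ∈ matrixGroup d, mobiusHom N = g := by
  rw [← map_matrixGroup]; rfl

lemma zHom_mem_matrixGroup {d : ℤ} {h : SpecialLinearGroup (Fin 2) ℤ} (hh : h ∈ ellipticSubgroup) :
    zHom h ∈ matrixGroup d := by
  have : ellipticSubgroup ≤ (matrixGroup d).comap zHom := by
    refine (Subgroup.closure_le _).mpr ?_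
    rintro x (rfl | rfl | rfl)
    · change zHom g1 ∈ matrixGroup d
      rw [zHom_g1]; exact Subgroup.subset_closure (by simp)
    · change zHom g2 ∈ matrixGroup d
      rw [zHom_g2]; exact Subgroup.subset_closure (by simp)
    · change zHom g3 ∈ matrixGroup d
      rw [zHom_g3]; exact Subgroup.subset_closure (by simp)
  exact this hh

lemma gamma4_mem_matrixGroup (d : ℤ) : gamma4 d ∈ matrixGroup d :=
  Subgroup.subset_closure (by simp)

lemma gamma4_inv (d : ℤ) : (gamma4 d)⁻¹ = gamma4 d :=
  inv_eq_of_mul_eq_one_left (gamma4_mul_self d)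

/-- Induction on words in `γ₄` and elements of the elliptic subgroup, from the left. -/
lemma matrixGroup_induction_left {d : ℤ} {p : GL (Fin 2) ℂ → Prop} (one : p 1)
    (elliptic : ∀ h ∈ ellipticSubgroup, ∀ N ∈ matrixGroup d, p N → p (zHom h * N))
    (gamma4 : ∀ N ∈ matrixGroup d, p N → p (gamma4 d * N)) {N : GL (Fin 2) ℂ}
    (hN : N ∈ matrixGroup d) : p N := by
  unfold matrixGroup at hN
  rw [← zHom_g1, ← zHom_g2, ← zHom_g3] at hN
  have hy' : ∀ {y}, y ∈ Subgroup.closure {zHom g1, zHom g2, zHom g3, KApollonian.gamma4 d} →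
      y ∈ matrixGroup d := fun {y} hy => by
    unfold matrixGroup
    rwa [← zHom_g1, ← zHom_g2, ← zHom_g3]
  induction hN using Subgroup.closure_induction_left with
  | one => exact one
  | mul_left x hx y hy ih =>
    rcases hx with rfl | rfl | rfl | rfl
    · exact elliptic _ g1_mem _ (hy' hy) ih
    · exact elliptic _ g2_mem _ (hy' hy) ih
    · exact elliptic _ g3_mem _ (hy' hy) ih
    · exact gamma4 _ (hy' hy) ih
  | inv_mul_cancel x hx y hy ih =>
    rcases hx with rfl | rfl | rfl | rfl
    · rw [← map_inv]; exact elliptic _ (inv_mem g1_mem) _ (hy' hy) ih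
    · rw [← map_inv]; exact elliptic _ (inv_mem g2_mem) _ (hy' hy) ih
    · rw [← map_inv]; exact elliptic _ (inv_mem g3_mem) _ (hy' hy) ih
    · rw [gamma4_inv]; exact gamma4 _ (hy' hy) ih

/-- The orbit of the oriented extended real line. -/
def orbitPacking (d : ℤ) : Set OrientedCircle := {C | ∃ N ∈ matrixGroup d, C = act N realCircle}

lemma realCircle_mem_orbitPacking (d : ℤ) : realCircle ∈ orbitPacking d :=
  ⟨1, one_mem _, (act_one _).symm⟩

lemma act_mem_orbitPacking {d : ℤ} {N : GL (Fin 2) ℂ} (hN : N ∈ matrixGroup d)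
    {C : OrientedCircle} (hC : C ∈ orbitPacking d) : act N C ∈ orbitPacking d := by
  obtain ⟨M, hM, rfl⟩ := hC
  exact ⟨N * M, mul_mem hN hM, (act_mul _ _ _).symm⟩

lemma basicProng_subset (d : ℤ) : basicProng d ⊆ orbitPacking d := by
  have h0 : tangentCircle d 1 0 ∈ orbitPacking d := by
    rw [← act_gamma4_realCircle]
    exact act_mem_orbitPacking (gamma4_mem_matrixGroup d) (realCircle_mem_orbitPacking d)
  have h3 := act_mem_orbitPacking (zHom_mem_matrixGroup g3_mem) h0
  have h1 := act_mem_orbitPacking (zHom_mem_matrixGroup g1_mem) h0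
  rw [act_zHom_tangentCircle] at h1 h3
  rintro C (rfl | rfl | rfl | rfl)
  · exact realCircle_mem_orbitPacking d
  · exact h0
  · rw [← tangentCircle_neg]; simpa [g3] using h3
  · rw [← tangentCircle_neg]; simpa [g1] using h1

/-- Only the elliptic subgroup of SL₂(ℤ) is available in the group, but its translates of the basic
prong already exhaust the modular translates. -/
lemma act_zHom_tangentCircle_mem (d : ℤ) (M : SpecialLinearGroup (Fin 2) ℤ) :
    act (zHom M) (tangentCircle d 1 0) ∈ orbitPacking d := by
  obtain ⟨h, hh, e⟩ := exists_elliptic_basicProng d M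
  have : act (zHom M) (tangentCircle d 1 0) ∈ act (zHom M) '' basicProng d :=
    ⟨_, by simp [basicProng], rfl⟩
  rw [e] at this
  obtain ⟨C, hC, e'⟩ := this
  rw [← e']
  exact act_mem_orbitPacking (zHom_mem_matrixGroup hh) (basicProng_subset d hC)

lemma tangent_act {N : GL (Fin 2) ℂ} {C D : OrientedCircle} :
    Tangent (act N C) (act N D) ↔ Tangent C D := by
  suffices h : ∀ (N : GL (Fin 2) ℂ) (C D : OrientedCircle), Tangent C D →
      Tangent (act N C) (act N D) by
    refine ⟨fun hT => ?_, h N C D⟩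
    have := h N⁻¹ _ _ hT
    rwa [act_inv_act, act_inv_act] at this
  rintro N C D ⟨p, hp⟩
  refine ⟨mobiusHom N p, ?_⟩
  rw [carrier_act, carrier_act, ← Set.image_inter (mobiusHom N).injective, hp, Set.image_singleton]

lemma tangent_realCircle {d : ℤ} (hd : d ≤ -15) : Tangent realCircle (tangentCircle d 1 0) := by
  have he := eta_gt hd
  refine ⟨OnePoint.infty, ?_⟩
  ext x
  simp only [Set.mem_inter_iff, Set.mem_singleton_iff]
  constructor
  · rintro ⟨h1, h2⟩
    induction x using OnePoint.rec with
    | infty => rfl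
    | coe z =>
      rw [mem_carrier_realCircle] at h1
      rw [mem_carrier, tangentCircle_one_zero_form] at h2
      linarith
  · rintro rfl
    exact ⟨infty_mem_realCircle, infty_mem_tangentCircle d⟩

lemma outside_realCircle_adjacentLines {d : ℤ} (hd : d ≤ -15) :
    Outside realCircle (adjacentLines d) := by
  have he := eta_gt hd
  rw [outside_adjacentLines_iff]
  refine ⟨fun x hx => le_of_eq hx.symm, fun x hx => ?_⟩
  induction x using OnePoint.rec with
  | infty => exact le_of_eq infty_mem_realCircle.symm
  | coe z =>
    rw [mem_carrier, tangentCircle_one_zero_form] at hx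
    rw [realCircle_form]; linarith

lemma tangencyGraph_adj {P : Set OrientedCircle} {C D : P} :
    (tangencyGraph P).Adj C D ↔ C ≠ D ∧ Tangent C.1 D.1 := by
  have hs : ∀ {C D : OrientedCircle}, Tangent C D → Tangent D C := by
    rintro C D ⟨p, hp⟩; exact ⟨p, by rw [Set.inter_comm]; exact hp⟩
  unfold tangencyGraph
  rw [SimpleGraph.fromRel_adj]
  constructor
  · rintro ⟨h, h1 | h1⟩
    · exact ⟨h, h1⟩
    · exact ⟨h, hs h1⟩
  · rintro ⟨h, h1⟩; exact ⟨h, Or.inl h1⟩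

/-- Reading a word from the left, an elliptic letter does not move the circle, and a letter γ₄
passes from `M R` to the tangent circle `M γ₄ R`. The prefix `M` is kept general for the induction.
-/
lemma orbitPacking_connected {d : ℤ} (hd : d ≤ -15) :
    (tangencyGraph (orbitPacking d)).Connected := by
  have key : ∀ N ∈ matrixGroup d, ∀ M ∈ matrixGroup d, ∀ (h1 : act M realCircle ∈ orbitPacking d)
      (h2 : act (M * N) realCircle ∈ orbitPacking d),
      (tangencyGraph (orbitPacking d)).Reachable ⟨act M realCircle, h1⟩
        ⟨act (M * N) realCircle, h2⟩ := by
    intro N hN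
    refine matrixGroup_induction_left (p := fun N => ∀ M ∈ matrixGroup d,
      ∀ (h1 : act M realCircle ∈ orbitPacking d)
      (h2 : act (M * N) realCircle ∈ orbitPacking d),
      (tangencyGraph (orbitPacking d)).Reachable ⟨act M realCircle, h1⟩
        ⟨act (M * N) realCircle, h2⟩) ?_ ?_ ?_ hN
    · intro M hM h1 h2
      simp only [mul_one]
      exact SimpleGraph.Reachable.refl _
    · intro h hh N hN ih M hM h1 h2
      have e1 : act (M * zHom h) realCircle = act M realCircle := by
        rw [act_mul, act_zHom_realCircle]
      have := ih (M * zHom h) (mul_mem hM (zHom_mem_matrixGroup hh)) (e1 ▸ h1)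
        (by rw [mul_assoc]; exact h2)
      simp only [e1, mul_assoc] at this
      exact this
    · intro N hN ih M hM h1 h2
      have h3 := act_mem_orbitPacking (mul_mem hM (gamma4_mem_matrixGroup d))
        (realCircle_mem_orbitPacking d)
      have := ih (M * gamma4 d) (mul_mem hM (gamma4_mem_matrixGroup d)) h3
        (by rw [mul_assoc]; exact h2)
      simp only [mul_assoc] at this
      refine SimpleGraph.Reachable.trans (SimpleGraph.Adj.reachable ?_) this
      rw [tangencyGraph_adj]
      simp only [act_mul, act_gamma4_realCircle]
      refine ⟨fun h => ?_, tangent_act.mpr (tangent_realCircle hd)⟩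
      have := congrArg (fun C => C.a.im) (act_injective M (Subtype.mk.inj h))
      norm_num [realCircle, tangentCircle] at this
  have : Nonempty (orbitPacking d) := ⟨⟨_, realCircle_mem_orbitPacking d⟩⟩
  refine SimpleGraph.Connected.mk ?_
  rintro ⟨_, N, hN, rfl⟩ ⟨_, M, hM, rfl⟩
  have := key (N⁻¹ * M) (mul_mem (inv_mem hN) hM) N hN ⟨N, hN, rfl⟩
    ⟨_, mul_mem hN (mul_mem (inv_mem hN) hM), rfl⟩
  simpa only [mul_inv_cancel_left] using this

section Field

variable {K : Type*} [Field K]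

/-- The defining conditions of packings are invariant under signed unimodular matrices. -/
lemma IsPrePacking.image {φ : K →+* ℂ} {P : Set OrientedCircle} (hP : IsPrePacking φ P)
    {N : GL (Fin 2) ℂ} (hN : N ∈ signedUnimodular φ) : IsPrePacking φ (act N '' P) where
  bianchi := by
    rintro _ ⟨C, hC, rfl⟩
    exact act_mem_bianchiCircles hN (hP.bianchi hC)
  connected := by
    let e : tangencyGraph P ≃g tangencyGraph (act N '' P) :=
      { Equiv.Set.image (act N) P (act_injective N) with
        map_rel_iff' := by
          intro C D
          rw [tangencyGraph_adj, tangencyGraph_adj, (Equiv.injective _).ne_iff]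
          exact and_congr_right fun _ => tangent_act }
    exact e.connected_iff.mp hP.connected
  disjoint := by
    rintro _ ⟨C, hC, rfl⟩ _ ⟨D, hD, rfl⟩ hne
    have := hP.disjoint hC hD (fun h => hne (by rw [h]))
    simp only [Function.onFun] at this ⊢
    rw [interior_act, interior_act]
    exact (Set.disjoint_image_iff (mobiusHom N).injective).mpr this
  not_straddles := by
    rintro D hD ⟨⟨_, ⟨C, hC, rfl⟩, x, hx, hx'⟩, ⟨_, ⟨C', hC', rfl⟩, y, hy, hy'⟩⟩
    refine hP.not_straddles (act N⁻¹ D) (act_mem_bianchiCircles (inv_mem hN) hD)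
      ⟨⟨C, hC, ?_⟩, ⟨C', hC', ?_⟩⟩
    · rw [carrier_act] at hx
      obtain ⟨z, hz, rfl⟩ := hx
      refine ⟨z, hz, ?_⟩
      rw [mem_interior] at hx' ⊢
      by_contra h
      rw [not_lt, ← act_form_nonneg (M := N), act_act_inv] at h
      linarith
    · rw [carrier_act] at hy
      obtain ⟨z, hz, rfl⟩ := hy
      refine ⟨z, hz, ?_⟩
      rw [mem_exterior] at hy' ⊢
      rwa [← act_form_pos (M := N), act_act_inv]

variable [NumberField K]

lemma matrixGroup_le (hK : Module.finrank ℚ K = 2) (hd : discr K ≤ -15) (φ : K →+* ℂ) :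
    matrixGroup (discr K) ≤ signedUnimodular φ := by
  refine (Subgroup.closure_le _).mpr ?_
  rintro x (rfl | rfl | rfl | rfl)
  · rw [← zHom_g1]; exact zHom_mem_signedUnimodular φ _
  · rw [← zHom_g2]; exact zHom_mem_signedUnimodular φ _
  · rw [← zHom_g3]; exact zHom_mem_signedUnimodular φ _
  · exact gamma4_mem_signedUnimodular hK hd φ

/-- Bianchi circles that leave two adjacent lines on one side are permuted by the modular group. -/
lemma outside_adjacentLines_zHom (hK : Module.finrank ℚ K = 2) (hd : discr K ≤ -15) {φ : K →+* ℂ}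
    {D : OrientedCircle} (hD : D ∈ bianchiCircles φ) (h : SpecialLinearGroup (Fin 2) ℤ)
    (hO : Outside D (adjacentLines (discr K))) :
    Outside (act (zHom h) D) (adjacentLines (discr K)) := by
  have hb := act_mem_bianchiCircles (zHom_mem_signedUnimodular φ h) hD
  rcases outside_adjacentLines_or hK hd hb with h1 | h1
  · exact h1
  · have h2 := (outside_adjacentLines_iff.mp hO).1
    rw [← outside_act (N := zHom h), ← carrier_act, act_zHom_realCircle,
      outside_realCircle_iff] at h2
    have h3 := (outside_adjacentLines_iff.mp h1).1
    rw [outside_realCircle_iff] at h3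
    -- If the image has the wrong orientation, its form vanishes on the whole real line; the image
    -- is then ±R, which the modular group fixes.
    have e : act (zHom h) D = realCircle ∨ act (zHom h) D = realCircle.neg := by
      generalize act (zHom h) D = E at h2 h3
      obtain ⟨a1, a2⟩ := h2
      obtain ⟨a3, a4⟩ := h3
      simp only [OrientedCircle.neg, Complex.neg_re] at a3 a4
      have b0 := a2 0
      have b1 := a2 1
      have b2 := a2 (-1)
      have c0 := a4 0
      have c1 := a4 1
      have c2 := a4 (-1)
      have f1 : E.b = 0 := by linarith
      have f2 : E.b' = 0 := by linarith
      have f3 : E.a.re = 0 := by linarith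
      have f4 := E.eqn_re_im
      rw [f1, f3] at f4
      have f5 : E.a.im ^ 2 = 1 := by linarith
      rcases sq_eq_one_iff.mp f5 with h | h
      · right; apply pedoe_injective; simp [pedoe, realCircle, OrientedCircle.neg, f1, f2, f3, h]
      · left; apply pedoe_injective; simp [pedoe, realCircle, f1, f2, f3, h]
    have e' : act (zHom h) D = D := by
      have hDe : D = act (zHom h)⁻¹ (act (zHom h) D) := (act_inv_act _ _).symm
      rw [← map_inv] at hDe
      rcases e with e | e
      · rw [e, act_zHom_realCircle] at hDe; rw [e, hDe]
      · rw [e, act_neg, act_zHom_realCircle] at hDe; rw [e, hDe]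
    rw [e']; exact hO

/-- γ₄ preserves the pair of lines itself, whereas a modular element moves L; there it is the set of
Bianchi circles, not the pair of lines, that is preserved. -/
lemma outside_adjacentLines_act (hK : Module.finrank ℚ K = 2) (hd : discr K ≤ -15) {φ : K →+* ℂ}
    {N : GL (Fin 2) ℂ} (hN : N ∈ matrixGroup (discr K)) {D : OrientedCircle}
    (hD : D ∈ bianchiCircles φ) (hO : Outside D (adjacentLines (discr K))) :
    Outside (act N D) (adjacentLines (discr K)) := by
  have hb : ∀ N ∈ matrixGroup (discr K), act N D ∈ bianchiCircles φ := fun N hN =>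
    act_mem_bianchiCircles (matrixGroup_le hK hd φ hN) hD
  refine matrixGroup_induction_left (p := fun N => Outside (act N D) (adjacentLines (discr K)))
    (by rwa [act_one]) (fun h hh N hN ih => ?_) (fun N hN ih => ?_) hN
  · rw [act_mul]; exact outside_adjacentLines_zHom hK hd (hb N hN) h ih
  · rw [act_mul, ← gamma4_image_adjacentLines, outside_act]; exact ih

/-- Orient `D` so that R and L lie outside. The same then holds for `N⁻¹ D`, so `N R` lies outside
`D` for every `N` in the group. -/
lemma orbitPacking_not_straddles (hK : Module.finrank ℚ K = 2) (hd : discr K ≤ -15) (φ : K →+* ℂ) :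
    ∀ D ∈ bianchiCircles φ, ¬ Straddles (orbitPacking (discr K)) D := by
  have key : ∀ D ∈ bianchiCircles φ, Outside D (adjacentLines (discr K)) →
      ∀ C ∈ orbitPacking (discr K), Outside D C.carrier := by
    rintro D hD hO C ⟨N, hN, rfl⟩
    have := outside_adjacentLines_act hK hd (inv_mem hN) hD hO
    rw [← act_act_inv N D, carrier_act, outside_act]
    exact (outside_adjacentLines_iff.mp this).1
  rintro D hD ⟨⟨C, hC, x, hx, hx'⟩, ⟨C', hC', y, hy, hy'⟩⟩
  rcases outside_adjacentLines_or hK hd hD with h | h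
  · have := key D hD h C hC x hx
    rw [mem_interior] at hx'
    linarith
  · have := key D.neg (neg_mem_bianchiCircles hD) h C' hC' y hy
    rw [mem_exterior] at hy'
    rw [form_neg] at this
    linarith

/-- Invariance is used for `N` and for its inverse: R and L lie outside `N R`, and `N R` lies in the
closed upper half plane. So `N R` is either a disc boundary oriented inwards or a horizontal line,
and its interior lies above the real line. -/
lemma orbitPacking_disjoint_realCircle (hK : Module.finrank ℚ K = 2) (hd : discr K ≤ -15)
    (φ : K →+* ℂ) {N : GL (Fin 2) ℂ} (hN : N ∈ matrixGroup (discr K))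
    (hne : act N realCircle ≠ realCircle) :
    Disjoint realCircle.interior (act N realCircle).interior := by
  have he := eta_gt hd
  have h0 := outside_realCircle_adjacentLines hd
  have hb := realCircle_mem_bianchiCircles φ
  have h1 := outside_adjacentLines_act hK hd hN hb h0
  have h2 := outside_adjacentLines_act hK hd (inv_mem hN) hb h0
  rw [← outside_act (N := N), act_act_inv] at h2
  have h3 : Outside realCircle (act N realCircle).carrier := by
    rw [carrier_act]
    exact fun x hx => h2 x (Set.image_mono Set.subset_union_left hx)
  generalize act N realCircle = E at *
  obtain ⟨h1, h4⟩ := outside_adjacentLines_iff.mp h1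
  obtain ⟨hb0, h1⟩ := outside_realCircle_iff.mp h1
  have eqn := E.eqn_re_im
  rw [Set.disjoint_left]
  intro x hx hx'
  rw [mem_interior] at hx hx'
  induction x using OnePoint.rec with
  | infty => rw [form_infty] at hx'; linarith
  | coe z =>
    rw [realCircle_form] at hx
    rw [form_coe] at hx'
    rcases hb0.eq_or_lt with hb0 | hb0
    · rw [← hb0] at h1 eqn hx'
      have hr : E.a.re = 0 := by
        by_contra hr
        have := h1 ((E.b' + 1) / E.a.re)
        rw [mul_div_cancel₀ _ hr] at this
        have := h1 0
        linarith
      rw [hr] at eqn hx'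
      have hb' := h1 0
      simp at hb'
      have h5 := h4 ((⟨0, eta (discr K) / 2⟩ : ℂ) : OnePoint ℂ) (by
        rw [mem_carrier, tangentCircle_one_zero_form]; ring)
      rw [form_coe, ← hb0, hr] at h5
      simp only at h5
      have f5 : E.a.im ^ 2 = 1 := by linarith
      rcases sq_eq_one_iff.mp f5 with h | h
      · rw [h] at h5 hx'
        linarith
      · rcases hb'.eq_or_lt with hb' | hb'
        · apply hne
          apply pedoe_injective; simp [pedoe, realCircle, ← hb0, ← hb', hr, h]
        · have h6 := h3 ((⟨0, -(E.b' / 2)⟩ : ℂ) : OnePoint ℂ) (by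
            rw [mem_carrier, form_coe, ← hb0, hr, h]; ring)
          rw [realCircle_form] at h6
          simp only at h6
          linarith
    -- This is the lowest point of the circle; that it is not below the real line gives `Im a ≥ 1`.
    · have h6 := h3 ((⟨E.a.re / E.b, (E.a.im - 1) / E.b⟩ : ℂ) : OnePoint ℂ) (by
        rw [mem_carrier, form_coe]; field_simp; linear_combination eqn)
      rw [realCircle_form] at h6
      simp only at h6
      have h7 : 0 ≤ (E.a.im - 1) / E.b := by linarith
      rw [le_div_iff₀ hb0] at h7
      nlinarith [sq_nonneg (E.b * z.re - E.a.re), mul_pos hb0 (neg_pos.mpr (by linarith : z.im < 0))]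

lemma orbitPacking_isPrePacking (hK : Module.finrank ℚ K = 2) (hd : discr K ≤ -15) (φ : K →+* ℂ) :
    IsPrePacking φ (orbitPacking (discr K)) where
  bianchi := by
    rintro C ⟨N, hN, rfl⟩
    exact act_mem_bianchiCircles (matrixGroup_le hK hd φ hN) (realCircle_mem_bianchiCircles φ)
  connected := by
    exact orbitPacking_connected hd
  disjoint := by
    rintro _ ⟨N, hN, rfl⟩ _ ⟨M, hM, rfl⟩ hne
    simp only [Function.onFun]
    have := orbitPacking_disjoint_realCircle hK hd φ (mul_mem (inv_mem hN) hM) (by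
      intro h
      apply hne
      rw [act_mul] at h
      rw [← act_act_inv N (act M realCircle), h])
    rw [act_mul] at this
    rw [← act_act_inv N (act M realCircle), interior_act N, interior_act N]
    exact (Set.disjoint_image_iff (mobiusHom N).injective).mpr this
  not_straddles := orbitPacking_not_straddles hK hd φ

end Field

/-! ### Uniqueness of the fundamental packing -/

lemma pair_realCircle (C : OrientedCircle) : pair C realCircle = -C.a.im := by
  simp [pair, realCircle]

lemma act_zHom_im (M : SpecialLinearGroup (Fin 2) ℤ) (C : OrientedCircle) :
    (act (zHom M) C).a.im = C.a.im := by
  have := pair_act (zHom M) C realCircle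
  rw [act_zHom_realCircle, pair_realCircle, pair_realCircle] at this
  linarith

/-- Together with `one_le_im_sq` this shows that a Bianchi circle which meets R has `Im a = ±1`. -/
lemma im_sq_le_one_of_mem {C : OrientedCircle} {p : OnePoint ℂ} (hp : p ∈ realCircle.carrier)
    (hC : p ∈ C.carrier) : C.a.im ^ 2 ≤ 1 := by
  have e := C.eqn_re_im
  induction p using OnePoint.rec with
  | infty =>
    rw [mem_carrier, form_infty] at hC
    rw [hC] at e
    nlinarith [sq_nonneg C.a.re]
  | coe z =>
    rw [mem_carrier_realCircle] at hp
    rw [mem_carrier, form_coe, hp] at hC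
    have : (C.b * z.re - C.a.re) ^ 2 = 1 - C.a.im ^ 2 := by linear_combination C.b * hC - e
    nlinarith [sq_nonneg (C.b * z.re - C.a.re)]

section Field

variable {K : Type*} [Field K] [NumberField K]

/-- The point of tangency is rational and can be moved to ∞. Indeed `(Im a)² = 1` makes the binary
form `s' c² + k c f + s f²` degenerate: 4s times it equals `(2 s f + k c)²`. For `s ≠ 0` it vanishes
at the primitive vector proportional to `(2s, -k)`. -/
lemma exists_zHom_b_eq_zero (hK : Module.finrank ℚ K = 2) (hd : discr K ≤ -15) {φ : K →+* ℂ}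
    {C : OrientedCircle} (hC : C ∈ bianchiCircles φ) (him : C.a.im ^ 2 = 1) :
    ∃ M : SpecialLinearGroup (Fin 2) ℤ, (act (zHom M) C).b = 0 := by
  have he := eta_gt hd
  obtain ⟨s, s', k, -, hb, hb', hr, -⟩ := bianchi_coords hK hd hC
  have e := C.eqn_re_im
  rw [him, hb, hb', hr] at e
  have hq : 4 * (s' * s) = k ^ 2 := by
    have h2 : eta (discr K) ^ 2 * (4 * (s' * s) - k ^ 2 : ℝ) = 0 := by linear_combination 4 * e
    have := (mul_eq_zero.mp h2).resolve_left (by positivity)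
    exact_mod_cast sub_eq_zero.mp this
  have key : ∃ c f : ℤ, IsCoprime c f ∧ c ^ 2 * s' + f ^ 2 * s + c * f * k = 0 := by
    by_cases hs : s = 0
    · refine ⟨0, 1, isCoprime_one_right, ?_⟩
      rw [hs]; ring
    · have hg : 0 < Int.gcd (2 * s) (-k) := Int.gcd_pos_of_ne_zero_left _ (by omega)
      obtain ⟨g, c, f, hg0, hco, hc, hf⟩ := Int.exists_gcd_one' hg
      refine ⟨c, f, Int.isCoprime_iff_gcd_eq_one.mpr hco, ?_⟩
      have hg2 : (g : ℤ) ≠ 0 := by omega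
      have : 4 * s * (g : ℤ) ^ 2 * (c ^ 2 * s' + f ^ 2 * s + c * f * k) = 0 := by
        linear_combination (c * g) ^ 2 * hq - (2 * s * f * g + k * c * g) * k * hc
          - (2 * s * f * g + k * c * g) * 2 * s * hf
      have h4 : 4 * s * (g : ℤ) ^ 2 ≠ 0 := by positivity
      exact (mul_eq_zero.mp this).resolve_left h4
  obtain ⟨c, f, hcf, h0⟩ := key
  obtain ⟨M, -, hM⟩ := ModularGroup.bottom_row_surj (R := ℤ) (a := ![c, f]) hcf
  have h1 : M 1 0 = c := congrFun hM 0
  have h2 : M 1 1 = f := congrFun hM 1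
  refine ⟨M, ?_⟩
  simp only [act, det_zHom, zHom_apply, h1, h2, hb, hb']
  have h0R : (c : ℝ) ^ 2 * s' + f ^ 2 * s + c * f * k = 0 := by exact_mod_cast h0
  simp [hr, Complex.normSq_apply]
  linear_combination eta (discr K) * h0R

/-- In a packing that contains the extended real line, circles that are tangent to this line are
as close to it as possible. -/
lemma exists_zHom_of_tangent (hK : Module.finrank ℚ K = 2) (hd : discr K ≤ -15) {φ : K →+* ℂ}
    {P : Set OrientedCircle} (hP : IsPrePacking φ P) (hR : realCircle ∈ P) {C : OrientedCircle}
    (hC : C ∈ P) (him : C.a.im ^ 2 = 1) (h1 : C ≠ realCircle) (h2 : C ≠ realCircle.neg) :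
    ∃ M : SpecialLinearGroup (Fin 2) ℤ, C = act (zHom M) (tangentCircle (discr K) 1 0) := by
  have he := eta_gt hd
  obtain ⟨M, hM⟩ := exists_zHom_b_eq_zero hK hd (hP.bianchi hC) him
  refine ⟨M⁻¹, ?_⟩
  suffices h : act (zHom M) C = tangentCircle (discr K) 1 0 by
    rw [← h, map_inv, act_inv_act]
  have hP1 := hP.image (zHom_mem_signedUnimodular φ M)
  have hR1 : realCircle ∈ act (zHom M) '' P := ⟨_, hR, act_zHom_realCircle M⟩
  have hC1 : act (zHom M) C ∈ act (zHom M) '' P := ⟨_, hC, rfl⟩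
  have n1 : act (zHom M) C ≠ realCircle := fun h => h1 (act_injective (zHom M) (by
    rw [h, act_zHom_realCircle]))
  have n2 : act (zHom M) C ≠ realCircle.neg := fun h => h2 (act_injective (zHom M) (by
    rw [h, act_neg, act_zHom_realCircle]))
  rw [← act_zHom_im M] at him
  generalize act (zHom M) C = E at *
  generalize act (zHom M) '' P = Q at *
  have eqn := E.eqn_re_im
  rw [hM, him] at eqn
  have hr : E.a.re = 0 := by
    have : E.a.re ^ 2 = 0 := by linarith
    simpa using this
  have form : ∀ z : ℂ, E.form (z : OnePoint ℂ) = E.b' - 2 * (E.a.im * z.im) := fun z => by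
    rw [form_coe, hM, hr]; ring
  have hdis : ∀ x : OnePoint ℂ, E.form x < 0 → 0 ≤ realCircle.form x := by
    intro x hx
    have := hP1.disjoint hR1 hC1 n1.symm
    simp only [Function.onFun] at this
    rw [Set.disjoint_right] at this
    exact not_lt.mp (this (a := x) hx)
  have hb' : E.b' ≠ 0 := by
    intro h0
    rcases sq_eq_one_iff.mp him with h | h
    · apply n2; apply pedoe_injective; simp [pedoe, realCircle, OrientedCircle.neg, hM, h0, hr, h]
    · apply n1; apply pedoe_injective; simp [pedoe, realCircle, hM, h0, hr, h]
  -- With `Im a = -1` the interior would be a half plane extending downwards and would meet the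
  -- interior of R.
  have him1 : E.a.im = 1 := by
    rcases sq_eq_one_iff.mp him with h | h
    · exact h
    · exfalso
      have := hdis ((⟨0, -(|E.b'| + 1)⟩ : ℂ) : OnePoint ℂ) (by
        rw [form, h]; simp only; linarith [le_abs_self E.b', abs_nonneg E.b'])
      rw [realCircle_form] at this
      simp only at this
      linarith [abs_nonneg E.b']
  rw [him1] at form
  have hpos : 0 < E.b' := by
    by_contra hneg
    have hlt : E.b' < 0 := lt_of_le_of_ne (not_lt.mp hneg) hb'
    have := hdis ((⟨0, E.b' / 4⟩ : ℂ) : OnePoint ℂ) (by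
        rw [form]; simp only; linarith)
    rw [realCircle_form] at this
    simp only at this
    linarith
  obtain ⟨-, s, -, -, -, hs, -⟩ := bianchi_coords hK hd (hP1.bianchi hC1)
  -- A line at height `s η/2` with `s ≥ 2` lies in the interior of L, while R lies in its exterior;
  -- the packing would straddle L.
  have hs1 : s = 1 := by
    have : (0 : ℝ) < s := by
      by_contra hlt
      nlinarith
    have : 0 < s := by exact_mod_cast this
    by_contra hne
    have h2 : (2 : ℝ) ≤ s := by exact_mod_cast (by omega : 2 ≤ s)
    refine hP1.not_straddles _ (tangentCircle_mem_bianchiCircles hK hd φ) ⟨⟨E, hC1,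
      ((⟨0, E.b' / 2⟩ : ℂ) : OnePoint ℂ), ?_, ?_⟩, ⟨realCircle, hR1, ((0 : ℂ) : OnePoint ℂ), ?_, ?_⟩⟩
    · rw [mem_carrier, form]; ring
    · rw [mem_interior, tangentCircle_one_zero_form, hs]; simp only; nlinarith
    · rw [mem_carrier_realCircle]; simp
    · rw [mem_exterior, tangentCircle_one_zero_form]; simp; linarith
  apply pedoe_injective
  simp [pedoe, tangentCircle, hM, hs, hs1, hr, him1]

/-- Along a path of tangencies, each circle already known to be `N R` is moved back to R. Its
neighbour then becomes a modular image of L, which is in the orbit. -/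
lemma subset_orbitPacking (hK : Module.finrank ℚ K = 2) (hd : discr K ≤ -15) {φ : K →+* ℂ}
    {P : Set OrientedCircle} (hP : IsPrePacking φ P) (hR : realCircle ∈ P) :
    P ⊆ orbitPacking (discr K) := by
  intro C hC
  have hreach := hP.connected.preconnected ⟨realCircle, hR⟩ ⟨C, hC⟩
  rw [SimpleGraph.reachable_iff_reflTransGen] at hreach
  suffices h : ∀ D : P, Relation.ReflTransGen (tangencyGraph P).Adj ⟨realCircle, hR⟩ D →
      D.1 ∈ orbitPacking (discr K) from h _ hreach
  intro D hD
  induction hD with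
  | refl => exact realCircle_mem_orbitPacking _
  | @tail E F _ hadj ih =>
    obtain ⟨N, hN, hE⟩ := ih
    have hN' := inv_mem hN
    have hP1 := hP.image (matrixGroup_le hK hd φ hN')
    have hR1 : realCircle ∈ act N⁻¹ '' P := ⟨E.1, E.2, by rw [hE, act_inv_act]⟩
    have hF1 : act N⁻¹ F.1 ∈ act N⁻¹ '' P := ⟨F.1, F.2, rfl⟩
    have hT : Tangent realCircle (act N⁻¹ F.1) := by
      have := (tangencyGraph_adj.mp hadj).2
      rw [hE] at this
      rw [← tangent_act (N := N), act_act_inv]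
      exact this
    obtain ⟨p, hp⟩ := hT
    have hmem : p ∈ realCircle.carrier ∩ (act N⁻¹ F.1).carrier := by rw [hp]; rfl
    have him : (act N⁻¹ F.1).a.im ^ 2 = 1 :=
      le_antisymm (im_sq_le_one_of_mem hmem.1 hmem.2) (one_le_im_sq hK hd (hP1.bianchi hF1))
    have hcar : (act N⁻¹ F.1).carrier ≠ realCircle.carrier := by
      intro h
      rw [h, Set.inter_self] at hp
      have a1 : OnePoint.infty ∈ realCircle.carrier := infty_mem_realCircle
      have a2 : ((0 : ℂ) : OnePoint ℂ) ∈ realCircle.carrier :=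
        mem_carrier_realCircle.mpr (by simp)
      rw [hp] at a1 a2
      rw [Set.mem_singleton_iff] at a1 a2
      exact OnePoint.infty_ne_coe (0 : ℂ) (a1.trans a2.symm)
    obtain ⟨M, hM⟩ := exists_zHom_of_tangent hK hd hP1 hR1 hF1 him
      (fun h => hcar (by rw [h])) (fun h => hcar (by rw [h, carrier_neg]))
    have := act_mem_orbitPacking hN (act_zHom_tangentCircle_mem (discr K) M)
    rw [← hM, act_act_inv] at this
    exact this

lemma isApollonianPacking_orbitPacking (hK : Module.finrank ℚ K = 2) (hd : discr K ≤ -15)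
    (φ : K →+* ℂ) : IsApollonianPacking φ (orbitPacking (discr K)) :=
  ⟨orbitPacking_isPrePacking hK hd φ, fun _ hP hle =>
    subset_orbitPacking hK hd hP (hle (realCircle_mem_orbitPacking _))⟩

lemma eq_orbitPacking (hK : Module.finrank ℚ K = 2) (hd : discr K ≤ -15) {φ : K →+* ℂ}
    {P : Set OrientedCircle} (hP : IsApollonianPacking φ P) (hR : realCircle ∈ P) :
    P = orbitPacking (discr K) := by
  have h := subset_orbitPacking hK hd hP.1 hR
  exact h.antisymm (hP.2 (orbitPacking_isPrePacking hK hd φ) h)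

lemma fundamentalPacking_eq (hK : Module.finrank ℚ K = 2) (hd : discr K ≤ -15) (φ : K →+* ℂ) :
    fundamentalPacking φ = orbitPacking (discr K) := by
  have : {P | IsApollonianPacking φ P ∧ realCircle ∈ P} = {orbitPacking (discr K)} := by
    ext P
    constructor
    · rintro ⟨h1, h2⟩; exact eq_orbitPacking hK hd h1 h2
    · rintro rfl
      exact ⟨isApollonianPacking_orbitPacking hK hd φ, realCircle_mem_orbitPacking _⟩
  rw [fundamentalPacking, this, Set.sUnion_singleton]

end Field

/-! ### The limit set -/

/-- Continuity lets group elements carry accumulation points to accumulation points; it is checked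
for affine maps and for the inversion, which generate the maps that are needed. -/
lemma continuous_affine {M : GL (Fin 2) ℂ} {a t : ℂ} (ha : a ≠ 0)
    (h : M.1 = !![a, t; 0, 1]) : Continuous (mobiusHom M) := by
  have e : ∀ i j, M i j = !![a, t; 0, 1] i j := fun i j => by rw [← h]
  have : (mobiusHom M : OnePoint ℂ → OnePoint ℂ) =
      ((Homeomorph.mulLeft₀ a ha).trans (Homeomorph.addRight t)).onePointCongr := by
    funext x
    rw [mobiusHom_apply]
    induction x using OnePoint.rec with
    | infty =>
      rw [OnePoint.smul_infty_eq_ite, if_pos (by simp [e])]; rfl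
    | coe z =>
      rw [OnePoint.smul_some_eq_ite, if_neg (by simp [e])]
      simp [e]
  rw [this]
  exact Homeomorph.continuous _

lemma continuous_gamma3 : Continuous (mobiusHom gamma3) := by
  have e : ∀ i j, gamma3 i j = !![(0 : ℂ), 1; -1, 0] i j := fun i j => rfl
  have h0 : mobiusHom gamma3 ((0 : ℂ) : OnePoint ℂ) = OnePoint.infty := by
    rw [mobiusHom_apply, OnePoint.smul_some_eq_ite, if_pos (by simp [e])]
  have hz : ∀ z : ℂ, z ≠ 0 → mobiusHom gamma3 (z : OnePoint ℂ) = ((-z⁻¹ : ℂ) : OnePoint ℂ) := by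
    intro z hz
    rw [mobiusHom_apply, OnePoint.smul_some_eq_ite, if_neg (by simp [e, hz])]
    simp [e, div_eq_mul_inv]
  have hi : mobiusHom gamma3 OnePoint.infty = ((0 : ℂ) : OnePoint ℂ) := by
    rw [mobiusHom_apply, OnePoint.smul_infty_eq_ite, if_neg (by simp [e])]
    simp [e]
  rw [continuous_iff_continuousAt]
  intro x
  induction x using OnePoint.rec with
  | infty =>
    rw [OnePoint.continuousAt_infty', hi, Filter.coclosedCompact_eq_cocompact,
      ← Metric.cobounded_eq_cocompact]
    have h1 : Filter.Tendsto (fun z : ℂ => ((-z⁻¹ : ℂ) : OnePoint ℂ)) (Bornology.cobounded ℂ)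
        (𝓝 ((0 : ℂ) : OnePoint ℂ)) := by
      refine (OnePoint.continuous_coe.tendsto 0).comp ?_
      simpa using (Filter.tendsto_inv₀_cobounded (α := ℂ)).neg
    refine h1.congr' ?_
    filter_upwards [Bornology.eventually_ne_cobounded (0 : ℂ)] with z hz'
    exact (hz z hz').symm
  | coe z =>
    rw [OnePoint.continuousAt_coe]
    by_cases h : z = 0
    · subst h
      rw [← continuousWithinAt_compl_self, ContinuousWithinAt, Function.comp_apply, h0]
      have h1 : Filter.Tendsto (fun z : ℂ => ((-z⁻¹ : ℂ) : OnePoint ℂ)) (𝓝[≠] 0)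
          (𝓝 OnePoint.infty) := by
        have h2 := OnePoint.tendsto_coe_infty (X := ℂ)
        rw [Filter.coclosedCompact_eq_cocompact, ← Metric.cobounded_eq_cocompact] at h2
        exact h2.comp ((Filter.tendsto_neg_cobounded (E := ℂ)).comp
          (Filter.tendsto_inv₀_nhdsNE_zero (α := ℂ)))
      refine h1.congr' ?_
      filter_upwards [self_mem_nhdsWithin] with z hz'
      exact (hz z hz').symm
    · have h1 : ContinuousAt (fun z : ℂ => ((-z⁻¹ : ℂ) : OnePoint ℂ)) z :=
        OnePoint.continuous_coe.continuousAt.comp (continuousAt_inv₀ h).neg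
      refine h1.congr ?_
      filter_upwards [isOpen_ne.mem_nhds h] with z hz'
      exact (hz z hz').symm

lemma mobiusHom_zHom_neg_one : mobiusHom (zHom (-1)) = 1 := by
  ext x
  have hf : (zHom (-1)) 0 0 = -1 ∧ (zHom (-1)) 0 1 = 0 ∧ (zHom (-1)) 1 0 = 0 ∧
      (zHom (-1)) 1 1 = -1 := by
    refine ⟨?_, ?_, ?_, ?_⟩ <;> rw [zHom_apply] <;> simp
  rw [mobiusHom_apply]
  induction x using OnePoint.rec with
  | infty => rw [OnePoint.smul_infty_eq_ite, if_pos hf.2.2.1]; rfl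
  | coe z =>
    rw [OnePoint.smul_some_eq_ite, hf.1, hf.2.1, hf.2.2.1, hf.2.2.2, if_neg (by simp)]
    simp

lemma continuous_zHom (h : SpecialLinearGroup (Fin 2) ℤ) : Continuous (mobiusHom (zHom h)) := by
  have hM : h ∈ Subgroup.closure {ModularGroup.S, ModularGroup.T} := by
    rw [SpecialLinearGroup.SL2Z_generators]; trivial
  have h3 : mobiusHom gamma3 * mobiusHom gamma3 = 1 := by
    have hm : gamma3 * gamma3 = zHom (-1) := by
      rw [← zHom_g3, ← map_mul]; congr 1; decide
    rw [← map_mul, hm, mobiusHom_zHom_neg_one]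
  have hS : mobiusHom (zHom ModularGroup.S) = mobiusHom gamma3 := by
    rw [show ModularGroup.S = g3⁻¹ by decide, map_inv, zHom_g3, map_inv, inv_eq_iff_mul_eq_one, h3]
  have hT : Continuous (mobiusHom (zHom ModularGroup.T)) := by
    refine continuous_affine (a := 1) (t := 1) one_ne_zero ?_
    ext i j; rw [zHom_apply]; fin_cases i <;> fin_cases j <;> simp [ModularGroup.T]
  have hT' : Continuous (mobiusHom (zHom ModularGroup.T⁻¹)) := by
    refine continuous_affine (a := 1) (t := -1) one_ne_zero ?_
    have e : ModularGroup.T⁻¹ 0 0 = 1 ∧ ModularGroup.T⁻¹ 0 1 = -1 ∧ ModularGroup.T⁻¹ 1 0 = 0 ∧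
      ModularGroup.T⁻¹ 1 1 = 1 := by decide
    ext i j; rw [zHom_apply]
    fin_cases i <;> fin_cases j <;> simp [e]
  induction hM using Subgroup.closure_induction_left with
  | one => rw [map_one, map_one]; exact continuous_id
  | mul_left x hx y hy ih =>
    rw [map_mul, map_mul]
    rcases hx with rfl | rfl
    · rw [hS]; exact continuous_gamma3.comp ih
    · exact hT.comp ih
  | inv_mul_cancel x hx y hy ih =>
    rw [map_mul, map_mul]
    rcases hx with rfl | rfl
    · rw [map_inv, map_inv, hS, inv_eq_of_mul_eq_one_left h3]; exact continuous_gamma3.comp ih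
    · exact hT'.comp ih

lemma continuous_gamma4 (d : ℤ) : Continuous (mobiusHom (gamma4 d)) := by
  have hs : !![(-1 : ℂ), tau d - 1; 0, 1] * !![(-1 : ℂ), tau d - 1; 0, 1] = 1 := by
    ext i j; fin_cases i <;> fin_cases j <;> simp
  let M : GL (Fin 2) ℂ := ⟨_, _, hs, hs⟩
  have hM : M.1 = !![(-1 : ℂ), tau d - 1; 0, 1] := rfl
  have e : ∀ i j, M i j = !![(-1 : ℂ), tau d - 1; 0, 1] i j := fun i j => rfl
  have : mobiusHom (gamma4 d) = mobiusHom M := by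
    ext x
    induction x using OnePoint.rec with
    | infty =>
      rw [mobiusHom_apply, mobiusHom_apply, OnePoint.smul_infty_eq_ite, OnePoint.smul_infty_eq_ite,
        if_pos (show gamma4 d 1 0 = 0 from rfl), if_pos (show M 1 0 = 0 from rfl)]
    | coe z =>
      rw [gamma4_coe, mobiusHom_apply, OnePoint.smul_some_eq_ite, if_neg (by simp [e])]
      simp [e]
      ring
  rw [this]
  exact continuous_affine (by simp) hM

lemma continuous_matrixGroup {d : ℤ} {N : GL (Fin 2) ℂ} (hN : N ∈ matrixGroup d) :
    Continuous (mobiusHom N) := by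
  refine matrixGroup_induction_left (p := fun N => Continuous (mobiusHom N)) ?_ ?_ ?_ hN
  · rw [map_one]; exact continuous_id
  · intro h hh N hN ih
    rw [map_mul]; exact (continuous_zHom h).comp ih
  · intro N hN ih
    rw [map_mul]; exact (continuous_gamma4 d).comp ih

lemma act_mem_limitSet {d : ℤ} {N : GL (Fin 2) ℂ} (hN : N ∈ matrixGroup d) {x : OnePoint ℂ}
    (hx : x ∈ limitSet (groupA d)) : mobiusHom N x ∈ limitSet (groupA d) := by
  have hx' : AccPt x (Filter.principal {y | ∃ g ∈ groupA d, y = g ((0 : ℂ) : OnePoint ℂ)}) := hx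
  change AccPt _ (Filter.principal _)
  rw [accPt_iff_nhds] at hx' ⊢
  intro U hU
  obtain ⟨y, ⟨hy, g, hg, rfl⟩, hne⟩ := hx' _ ((continuous_matrixGroup hN).continuousAt hU)
  exact ⟨_, ⟨hy, mobiusHom N * g, mul_mem (mem_groupA.mpr ⟨N, hN, rfl⟩) hg, rfl⟩,
    fun h => hne ((mobiusHom N).injective h)⟩

/-- The elliptic subgroup is transitive on cusps: it is so on Farey triangles, and within the basic
one `γ₃` and `γ₁γ₃` carry 0 to ∞ and to 1. -/
lemma exists_elliptic_tangentCircle {d : ℤ} (M : SpecialLinearGroup (Fin 2) ℤ) :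
    ∃ h ∈ ellipticSubgroup,
      tangentCircle d (M 0 0) (M 1 0) = tangentCircle d (h 0 1) (h 1 1) := by
  obtain ⟨h, hh, e⟩ := exists_elliptic_basicProng d M
  have h0 : act (zHom M) (tangentCircle d 1 0) ∈ act (zHom M) '' basicProng d :=
    ⟨_, by simp [basicProng], rfl⟩
  rw [e, act_zHom_tangentCircle] at h0
  simp only [mul_one, mul_zero, add_zero] at h0
  have key : ∀ k ∈ ellipticSubgroup, ∀ p q : ℤ, tangentCircle d p q =
      tangentCircle d (k 0 1) (k 1 1) → act (zHom h) (tangentCircle d p q) =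
      tangentCircle d ((h * k) 0 1) ((h * k) 1 1) := by
    intro k hk p q e
    rw [e, act_zHom_tangentCircle, sl_mul_apply, sl_mul_apply]
  obtain ⟨C, hC, e'⟩ := h0
  rcases hC with rfl | rfl | rfl | rfl
  · rw [act_zHom_realCircle] at e'
    have := congrArg (fun C => C.a.im) e'
    norm_num [realCircle, tangentCircle] at this
  · exact ⟨_, mul_mem hh g3_mem, e'.symm.trans (key g3 g3_mem 1 0 (by simp [g3]))⟩
  · exact ⟨_, mul_mem hh (one_mem _), e'.symm.trans (key 1 (one_mem _) 0 1 (by simp))⟩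
  · refine ⟨_, mul_mem hh (mul_mem g1_mem g3_mem),
      e'.symm.trans (key (g1 * g3) (mul_mem g1_mem g3_mem) 1 1 ?_)⟩
    rw [sl_mul_apply, sl_mul_apply, ← tangentCircle_neg]
    simp [g1, g3]

lemma exists_elliptic_smul_zero {d : ℤ} (hd : d ≤ -15) (q : ℚ) :
    ∃ h ∈ ellipticSubgroup,
      mobiusHom (zHom h) ((0 : ℂ) : OnePoint ℂ) = ((q : ℂ) : OnePoint ℂ) := by
  have he := eta_gt hd
  -- A matrix with bottom row `(-den, num)` has an inverse with first column `(num, den)`.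
  have hco : IsCoprime (-(q.den : ℤ)) q.num := by
    rw [IsCoprime.neg_left_iff, Int.isCoprime_iff_gcd_eq_one, Int.gcd_comm]
    exact q.reduced
  obtain ⟨M, -, hM⟩ := ModularGroup.bottom_row_surj (R := ℤ) (a := ![-(q.den : ℤ), q.num]) hco
  have h1 : M 1 0 = -(q.den : ℤ) := congrFun hM 0
  have h2 : M 1 1 = q.num := congrFun hM 1
  have e0 : M⁻¹ 0 0 = q.num ∧ M⁻¹ 1 0 = q.den := by
    rw [SpecialLinearGroup.SL2_inv_expl M]; simp [h1, h2]
  obtain ⟨h, hh, e⟩ := exists_elliptic_tangentCircle (d := d) M⁻¹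
  refine ⟨h, hh, ?_⟩
  rw [e0.1, e0.2] at e
  have hb := congrArg (fun C => C.b) e
  have ha := congrArg (fun C => C.a.re) e
  simp only [tangentCircle] at hb ha
  -- A tangent circle determines its cusp vector only up to sign; `q²` and `p q` are enough to
  -- recover the quotient.
  have hb' : ((q.den : ℤ) : ℝ) ^ 2 = (h 1 1 : ℝ) ^ 2 := mul_left_cancel₀ (by positivity) hb
  have ha' : (q.num : ℝ) * ((q.den : ℤ) : ℝ) = (h 0 1 : ℝ) * h 1 1 := by
    apply mul_left_cancel₀ (a := eta d) (by positivity)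
    linear_combination ha
  have hb2 : (q.den : ℤ) ^ 2 = (h 1 1) ^ 2 := by exact_mod_cast hb'
  have ha2 : q.num * (q.den : ℤ) = h 0 1 * h 1 1 := by exact_mod_cast ha'
  have hden : (q.den : ℤ) ≠ 0 := by exact_mod_cast q.den_nz
  have h11 : h 1 1 ≠ 0 := by
    intro h0; rw [h0] at hb2; simp at hb2
  have h11' : (h 1 1 : ℂ) ≠ 0 := by exact_mod_cast h11
  have hden' : (q.den : ℂ) ≠ 0 := by exact_mod_cast q.den_nz
  rw [mobiusHom_apply, OnePoint.smul_some_eq_ite, zHom_apply, zHom_apply, zHom_apply, zHom_apply,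
    if_neg (by simpa using h11')]
  rw [OnePoint.coe_eq_coe, Rat.cast_def]
  simp only [mul_zero, zero_add]
  rw [div_eq_div_iff h11' hden']
  have : h 0 1 * (q.den : ℤ) = q.num * h 1 1 := by
    apply mul_left_cancel₀ (mul_ne_zero hden h11)
    linear_combination (h 0 1 * h 1 1) * hb2 - (h 1 1) ^ 2 * ha2
  exact_mod_cast this

lemma realCircle_subset_limitSet {d : ℤ} (hd : d ≤ -15) :
    realCircle.carrier ⊆ limitSet (groupA d) := by
  have horb : ∀ q : ℚ, ((q : ℂ) : OnePoint ℂ) ∈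
      {y | ∃ g ∈ groupA d, y = g ((0 : ℂ) : OnePoint ℂ)} := fun q => by
    obtain ⟨h, hh, e⟩ := exists_elliptic_smul_zero hd q
    exact ⟨_, zHom_mem_groupA hh, e.symm⟩
  intro x hx
  change AccPt _ (Filter.principal _)
  rw [accPt_iff_nhds]
  intro U hU
  induction x using OnePoint.rec with
  | infty =>
    have h1 : Filter.Tendsto (fun n : ℕ => ((n : ℂ) : OnePoint ℂ)) Filter.atTop
        (𝓝 OnePoint.infty) := by
      have h2 := OnePoint.tendsto_coe_infty (X := ℂ)
      rw [Filter.coclosedCompact_eq_cocompact, ← Metric.cobounded_eq_cocompact] at h2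
      exact h2.comp (tendsto_natCast_atTop_cobounded (α := ℂ))
    obtain ⟨n, hn⟩ := (h1.eventually hU).exists
    refine ⟨_, ⟨hn, ?_⟩, OnePoint.coe_ne_infty _⟩
    have := horb n
    simpa using this
  | coe z =>
    rw [mem_carrier_realCircle] at hx
    have hz : z = (z.re : ℂ) := Complex.ext rfl (by simp [hx])
    have hc : Continuous (fun x : ℝ => ((x : ℂ) : OnePoint ℂ)) :=
      OnePoint.continuous_coe.comp Complex.continuous_ofReal
    rw [hz] at hU
    obtain ⟨ε, hε, hball⟩ := Metric.mem_nhds_iff.mp (hc.continuousAt hU)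
    obtain ⟨q, hq1, hq2⟩ := exists_rat_btwn (lt_add_of_pos_right z.re hε)
    have hmem : ((q : ℝ) : ℝ) ∈ Metric.ball z.re ε := by
      rw [Metric.mem_ball, Real.dist_eq, abs_lt]; constructor <;> linarith
    have h2 := hball hmem
    simp only [Set.mem_preimage, Complex.ofReal_ratCast] at h2
    refine ⟨_, ⟨h2, horb q⟩, ?_⟩
    rw [hz, Ne, OnePoint.coe_eq_coe]
    intro h
    have := congrArg Complex.re h
    simp at this
    linarith

/-- The orbit of 0 lies on the circles of the packing. Conversely the limit set is closed, invariant
and contains R. -/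
lemma limitSet_groupA {d : ℤ} (hd : d ≤ -15) :
    limitSet (groupA d) = closure (⋃ C ∈ orbitPacking d, C.carrier) := by
  apply Set.Subset.antisymm
  · intro x hx
    have hx' : AccPt x (Filter.principal {y | ∃ g ∈ groupA d, y = g ((0 : ℂ) : OnePoint ℂ)}) := hx
    have h1 := mem_closure_iff_clusterPt.mpr hx'.clusterPt
    refine closure_mono ?_ h1
    rintro y ⟨g, hg, rfl⟩
    obtain ⟨N, hN, rfl⟩ := mem_groupA.mp hg
    refine Set.mem_biUnion ⟨N, hN, rfl⟩ ?_
    rw [carrier_act]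
    exact ⟨_, mem_carrier_realCircle.mpr (by simp), rfl⟩
  · refine closure_minimal ?_ (isClosed_derivedSet _)
    intro x hx
    simp only [Set.mem_iUnion] at hx
    obtain ⟨C, ⟨N, hN, rfl⟩, hx⟩ := hx
    rw [carrier_act] at hx
    obtain ⟨y, hy, rfl⟩ := hx
    exact act_mem_limitSet hN (realCircle_subset_limitSet hd hy)

/-! ### Discreteness -/

lemma groupA_le_Mob (d : ℤ) : groupA d ≤ Mob := by
  intro g hg
  obtain ⟨N, -, rfl⟩ := mem_groupA.mp hg
  exact Subgroup.subset_closure (Or.inl ⟨N, rfl⟩)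

/-- The matrix of a linear fractional transformation that fixes `∞`, `0` and `1` is scalar. -/
lemma entries_of_fix {P : GL (Fin 2) ℂ} (hi : P • (OnePoint.infty : OnePoint ℂ) = OnePoint.infty)
    (h0 : P • ((0 : ℂ) : OnePoint ℂ) = ((0 : ℂ) : OnePoint ℂ))
    (h1 : P • ((1 : ℂ) : OnePoint ℂ) = ((1 : ℂ) : OnePoint ℂ)) :
    P 1 0 = 0 ∧ P 0 1 = 0 ∧ P 0 0 = P 1 1 := by
  have h10 : P 1 0 = 0 := OnePoint.smul_infty_eq_self_iff.mp hi
  have hdet := P.det_ne_zero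
  rw [det_fin_two, h10, mul_zero, sub_zero] at hdet
  have h11 : P 1 1 ≠ 0 := right_ne_zero_of_mul hdet
  have h01 : P 0 1 = 0 := by
    rw [OnePoint.smul_some_eq_ite, if_neg (by simpa using h11), OnePoint.coe_eq_coe] at h0
    simpa [h11] using h0
  rw [OnePoint.smul_some_eq_ite, if_neg (by simpa [h10] using h11), OnePoint.coe_eq_coe,
    h10, h01, mul_one, add_zero, zero_mul, zero_add, div_eq_one_iff_eq h11] at h1
  exact ⟨h10, h01, h1⟩

/-- Matrices with the same linear fractional transformation are proportional. -/
lemma exists_scalar_of_mobiusHom_eq {M N : GL (Fin 2) ℂ} (h : mobiusHom M = mobiusHom N) :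
    ∃ c : ℂ, ∀ i j, M i j = c * N i j := by
  set P := N⁻¹ * M with hP
  have hP1 : ∀ x : OnePoint ℂ, P • x = x := fun x => by
    rw [← mobiusHom_apply, hP, map_mul, map_inv, h, inv_mul_cancel]; rfl
  obtain ⟨h10, h01, h00⟩ := entries_of_fix (hP1 _) (hP1 _) (hP1 _)
  refine ⟨P 1 1, fun i j => ?_⟩
  have hM : M = N * P := by rw [hP, mul_inv_cancel_left]
  have : M i j = N i 0 * P 0 j + N i 1 * P 1 j := by
    conv_lhs => rw [hM]
    rw [Units.val_mul, Matrix.mul_apply, Fin.sum_univ_two]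
  rw [this]
  fin_cases j
  · change N i 0 * P 0 0 + N i 1 * P 1 0 = P 1 1 * N i 0
    rw [h10, h00]; ring
  · change N i 0 * P 0 1 + N i 1 * P 1 1 = P 1 1 * N i 1
    rw [h01]; ring

section Field

variable {K : Type*} [Field K] [NumberField K]

lemma integerEmb_discrete (hK : Module.finrank ℚ K = 2) (hd : discr K ≤ -15) (φ : K →+* ℂ)
    {z : ℂ} (hz : z ∈ (integerEmb φ).range) (h1 : ‖z‖ < 1) : z = 0 := by
  have he := eta_gt hd
  obtain ⟨m, n, rfl⟩ := (range_integerEmb hK (by linarith) φ z).mp (RingHom.mem_range.mp hz)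
  have h2 := (Complex.abs_im_le_norm _).trans_lt h1
  have h3 := (Complex.abs_re_le_norm _).trans_lt h1
  simp only [Complex.add_im, Complex.mul_im, Complex.intCast_im, Complex.intCast_re, zero_mul,
    add_zero, zero_add, tau_im] at h2
  have hn : n = 0 := by
    by_contra hne
    have : (1 : ℝ) ≤ |(n : ℝ)| := by exact_mod_cast Int.one_le_abs hne
    rw [abs_mul, abs_of_pos (by linarith : (0 : ℝ) < eta (discr K) / 2)] at h2
    nlinarith
  rw [hn] at h3 ⊢
  simp at h3 ⊢
  have : |m| < 1 := by exact_mod_cast h3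
  exact_mod_cast Int.abs_lt_one_iff.mp this

/-- An element of SL₂(ℂ) in question is `c Q` with `Q` integral and `c² det Q = 1`, so `c² = ±1` and
products of two entries are integers of K. These form a discrete set, and the products determine the
matrix up to sign. -/
lemma isKleinian_groupA (hK : Module.finrank ℚ K = 2) (hd : discr K ≤ -15) (φ : K →+* ℂ) :
    IsKleinian (groupA (discr K)) := by
  refine ⟨groupA_le_Mob _, ?_⟩
  have hprod : ∀ M : {M : SpecialLinearGroup (Fin 2) ℂ //
      mobiusHom (M : GL (Fin 2) ℂ) ∈ groupA (discr K)}, ∀ i j k l, M.1 i j * M.1 k l ∈ (integerEmb φ).range := by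
    rintro ⟨M, hM⟩ i j k l
    obtain ⟨N, hN, e⟩ := mem_groupA.mp hM
    obtain ⟨c, hc⟩ := exists_scalar_of_mobiusHom_eq e.symm
    obtain ⟨Q, hQ, rfl⟩ := mem_signedUnimodular.mp (matrixGroup_le hK hd φ hN)
    have hc' : ∀ i j, M i j = c * integerEmb φ (Q i j) := hc
    have hdetM : M 0 0 * M 1 1 - M 0 1 * M 1 0 = 1 := by
      have := M.2
      rwa [det_fin_two] at this
    have hdetQ : integerEmb φ (Q 0 0) * integerEmb φ (Q 1 1) -
        integerEmb φ (Q 0 1) * integerEmb φ (Q 1 0) = integerEmb φ Q.1.det := by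
      rw [det_fin_two]; simp only [map_sub, map_mul]
    simp only [hc'] at hdetM ⊢
    have h1 : c ^ 2 * integerEmb φ Q.1.det = 1 := by rw [← hdetQ]; linear_combination hdetM
    have h2 : c * integerEmb φ (Q i j) * (c * integerEmb φ (Q k l)) =
        c ^ 2 * integerEmb φ (Q i j * Q k l) := by rw [map_mul]; ring
    rw [h2]
    rcases hQ with hQ | hQ
    · rw [hQ, map_one, mul_one] at h1
      rw [h1, one_mul]; exact ⟨_, rfl⟩
    · rw [hQ, map_neg, map_one] at h1
      refine ⟨-(Q i j * Q k l), ?_⟩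
      rw [map_neg]; linear_combination (integerEmb φ (Q i j * Q k l)) * h1
  have hcont : ∀ i j, Continuous (fun M : {M : SpecialLinearGroup (Fin 2) ℂ //
      mobiusHom (M : GL (Fin 2) ℂ) ∈ groupA (discr K)} => M.1 i j) := fun i j =>
    (show Continuous (fun M : SpecialLinearGroup (Fin 2) ℂ => M.1 i j) from
      continuous_subtype_val.matrix_elem i j).comp continuous_subtype_val
  rw [discreteTopology_iff_isOpen_singleton]
  intro M₀
  obtain ⟨i, j, hij⟩ : ∃ i j, M₀.1 i j ≠ 0 := by
    by_contra hall
    push Not at hall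
    have := M₀.1.2
    rw [det_fin_two] at this
    have h2 : ∀ i j, M₀.1.1 i j = 0 := hall
    simp [h2] at this
  -- Products with a fixed nonzero entry are pinned down by being within distance one; the last
  -- condition selects the sign.
  have hset : ({M₀} : Set {M : SpecialLinearGroup (Fin 2) ℂ //
      mobiusHom (M : GL (Fin 2) ℂ) ∈ groupA (discr K)}) = {M | ‖M.1 i j * M.1 0 0 - M₀.1 i j * M₀.1 0 0‖ < 1} ∩
      {M | ‖M.1 i j * M.1 0 1 - M₀.1 i j * M₀.1 0 1‖ < 1} ∩
      {M | ‖M.1 i j * M.1 1 0 - M₀.1 i j * M₀.1 1 0‖ < 1} ∩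
      {M | ‖M.1 i j * M.1 1 1 - M₀.1 i j * M₀.1 1 1‖ < 1} ∩ {M | M.1 i j ≠ -M₀.1 i j} := by
    ext M
    constructor
    · rintro rfl
      refine ⟨⟨⟨⟨?_, ?_⟩, ?_⟩, ?_⟩, fun h => hij ?_⟩
      any_goals simp
      linear_combination h / 2
    · rintro ⟨⟨⟨⟨h00, h01⟩, h10⟩, h11⟩, hne⟩
      have heq : ∀ k l, M.1 i j * M.1 k l = M₀.1 i j * M₀.1 k l := by
        have hd' : ∀ k l, ‖M.1 i j * M.1 k l - M₀.1 i j * M₀.1 k l‖ < 1 →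
            M.1 i j * M.1 k l = M₀.1 i j * M₀.1 k l := fun k l h =>
          sub_eq_zero.mp (integerEmb_discrete hK hd φ
            (sub_mem (hprod M i j k l) (hprod M₀ i j k l)) h)
        intro k l
        fin_cases k <;> fin_cases l
        · exact hd' 0 0 h00
        · exact hd' 0 1 h01
        · exact hd' 1 0 h10
        · exact hd' 1 1 h11
      have hsame : M.1 i j = M₀.1 i j := by
        rcases mul_self_eq_mul_self_iff.mp (heq i j) with h | h
        · exact h
        · exact absurd h hne
      rw [Set.mem_singleton_iff]
      apply Subtype.ext
      apply Matrix.SpecialLinearGroup.ext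
      intro k l
      have := heq k l
      rw [hsame] at this
      exact mul_left_cancel₀ hij this
  rw [hset]
  have hop : ∀ k l, IsOpen {M : {M : SpecialLinearGroup (Fin 2) ℂ //
      mobiusHom (M : GL (Fin 2) ℂ) ∈ groupA (discr K)} | ‖M.1 i j * M.1 k l - M₀.1 i j * M₀.1 k l‖ < 1} := fun k l =>
    isOpen_lt ((((hcont i j).mul (hcont k l)).sub continuous_const).norm) continuous_const
  exact ((((hop 0 0).inter (hop 0 1)).inter (hop 1 0)).inter (hop 1 1)).inter
    (isOpen_ne_fun (hcont i j) continuous_const)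

lemma groupA_le_extendedBianchi (hK : Module.finrank ℚ K = 2) (hd : discr K ≤ -15)
    (φ : K →+* ℂ) : groupA (discr K) ≤ extendedBianchi φ := by
  intro g hg
  obtain ⟨N, hN, rfl⟩ := mem_groupA.mp hg
  obtain ⟨Q, -, rfl⟩ := mem_signedUnimodular.mp (matrixGroup_le hK hd φ hN)
  exact Subgroup.subset_closure (Or.inl ⟨Q, rfl⟩)

lemma isWeakApollonianGroup_groupA (hK : Module.finrank ℚ K = 2) (hd : discr K ≤ -15)
    (φ : K →+* ℂ) : IsWeakApollonianGroup φ (groupA (discr K)) where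
  fg := by
    rw [Subgroup.fg_iff]
    exact ⟨_, rfl, by simp⟩
  kleinian := isKleinian_groupA hK hd φ
  le_bianchi := groupA_le_extendedBianchi hK hd φ
  limitSet_eq := by rw [fundamentalPacking_eq hK hd φ, limitSet_groupA hd]

end Field

open ClusterData

/-! ### Clusters -/

/-- The cluster type with four circles given by an integral change of variables. -/
def quadData (R : Matrix (Fin 4) (Fin 4) ℝ) (S : Matrix (Fin 4) (Fin 4) ℤ) : ClusterData := ⟨4, R, S⟩

lemma kCluster_of_even {d : ℤ} (h : d % 4 = 0) : kCluster d = quadData (gram0 d) 1 := if_pos h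

lemma kCluster_of_odd {d : ℤ} (h : d % 4 = 1) : kCluster d = quadData (gram1 d) changeS :=
  if_neg (by omega)

lemma det_gram0 (d : ℤ) : (gram0 d).det = (d : ℝ) ^ 3 / 4 := by
  simp [gram0, Matrix.det_succ_row_zero, Fin.sum_univ_succ, Fin.succAbove]
  ring

lemma det_gram1 (d : ℤ) : (gram1 d).det = (d : ℝ) ^ 3 / 16 := by
  simp [gram1, Matrix.det_succ_row_zero, Fin.sum_univ_succ, Fin.succAbove]
  ring

lemma isUnit_changeS : IsUnit (changeS.map (Int.cast : ℤ → ℝ)).det := by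
  rw [isUnit_iff_ne_zero]
  simp [changeS, Matrix.det_succ_row_zero, Fin.sum_univ_succ, Fin.succAbove]

lemma changeS_gram1 (d : ℤ) :
    (changeS.map (Int.cast : ℤ → ℝ))ᵀ * gram1 d * changeS.map (Int.cast : ℤ → ℝ) = gram0 d := by
  ext i j
  fin_cases i <;> fin_cases j <;>
    simp [changeS, gram1, gram0, Matrix.mul_apply, Fin.sum_univ_four] <;> ring

/-- The Pedoe vectors of a quadruple of circles as columns. -/
def pedoeMatrix (c : Fin 4 → OrientedCircle) : Matrix (Fin 4) (Fin 4) ℝ :=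
  Matrix.of fun i j => (c j).pedoe i

lemma transpose_mul_gramM_mul_apply (V : Matrix (Fin 4) (Fin 4) ℝ) (i j : Fin 4) :
    (Vᵀ * gramM * V) i j = V.col i ⬝ᵥ (gramM *ᵥ V.col j) := by
  rw [Matrix.mul_assoc]
  simp only [Matrix.mul_apply, Matrix.mulVec, dotProduct, Matrix.transpose_apply, Matrix.col_apply]

lemma pedoeMatrix_gram (c : Fin 4 → OrientedCircle) (i j : Fin 4) :
    ((pedoeMatrix c)ᵀ * gramM * pedoeMatrix c) i j = pair (c i) (c j) := by
  rw [transpose_mul_gramM_mul_apply, ← pair_eq]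
  rfl

/-- The quadruples of circles with Gram matrix `R₀`. -/
def IsProng (d : ℤ) (c : Fin 4 → OrientedCircle) : Prop :=
  ∀ i j, pair (c i) (c j) = gram0 d i j

lemma isProng_iff {d : ℤ} {c : Fin 4 → OrientedCircle} :
    IsProng d c ↔ (pedoeMatrix c)ᵀ * gramM * pedoeMatrix c = gram0 d := by
  rw [← Matrix.ext_iff]
  simp only [pedoeMatrix_gram]; rfl

section quadData

variable {R : Matrix (Fin 4) (Fin 4) ℝ} {S : Matrix (Fin 4) (Fin 4) ℤ} {d : ℤ}

lemma quadData_gram (hS : (S.map (Int.cast : ℤ → ℝ))ᵀ * R * S.map (Int.cast : ℤ → ℝ) = gram0 d)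
    {W : Matrix (Fin 4) (Fin 4) ℝ} (hW : W ∈ clusterSpace R) :
    (W * S.map (Int.cast : ℤ → ℝ))ᵀ * gramM * (W * S.map (Int.cast : ℤ → ℝ)) = gram0 d := by
  have hW' : Wᵀ * gramM * W = R := hW
  rw [← hS, ← hW', Matrix.transpose_mul]
  simp only [Matrix.mul_assoc]

lemma isClusterType_quadData (hR : IsUnit R.det)
    (hu : IsUnit (S.map (Int.cast : ℤ → ℝ)).det)
    (hS : (S.map (Int.cast : ℤ → ℝ))ᵀ * R * S.map (Int.cast : ℤ → ℝ) = gram0 d) :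
    (quadData R S).IsClusterType where
  four_le := le_rfl
  invertible := hR
  mem W hW j := by
    have h := quadData_gram hS hW
    have h2 := transpose_mul_gramM_mul_apply (W * S.map (Int.cast : ℤ → ℝ)) j j
    rw [h] at h2
    refine h2.symm.trans ?_
    change Fin 4 at j
    fin_cases j <;> simp [gram0]
  finite_to_one V := by
    refine Set.Subsingleton.finite fun W hW W' hW' => ?_
    have h : W * S.map (Int.cast : ℤ → ℝ) = W' * S.map (Int.cast : ℤ → ℝ) := hW.2.trans hW'.2.symm
    rw [← Matrix.mul_nonsing_inv_cancel_right _ W hu, h, Matrix.mul_nonsing_inv_cancel_right _ _ hu]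

lemma isOrderedCluster_quadData_iff {W : Matrix (Fin 4) (Fin 4) ℝ} {c : Fin 4 → OrientedCircle} :
    (quadData R S).IsOrderedCluster W c ↔
      W ∈ clusterSpace R ∧ pedoeMatrix c = W * S.map (Int.cast : ℤ → ℝ) := by
  refine and_congr_right fun _ => ⟨fun h => ?_, fun h j => ?_⟩
  · ext i j
    exact congrFun (h j) i
  · ext i
    exact congrFun (congrFun h i) j

/-- As `S` is invertible over ℝ, the matrix `W` is recovered as `V S⁻¹`. Both parities of the
discriminant thus reduce to quadruples with Gram matrix R₀. -/
lemma exists_isOrderedCluster_iff (hu : IsUnit (S.map (Int.cast : ℤ → ℝ)).det)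
    (hS : (S.map (Int.cast : ℤ → ℝ))ᵀ * R * S.map (Int.cast : ℤ → ℝ) = gram0 d)
    {c : Fin 4 → OrientedCircle} :
    (∃ W, (quadData R S).IsOrderedCluster W c) ↔ IsProng d c := by
  simp only [isOrderedCluster_quadData_iff]
  rw [isProng_iff]
  constructor
  · rintro ⟨W, hW, e⟩
    rw [e]
    exact quadData_gram hS hW
  · intro h
    have e := (Matrix.mul_nonsing_inv_cancel_right _ (pedoeMatrix c) hu)
    set T := S.map (Int.cast : ℤ → ℝ)
    refine ⟨pedoeMatrix c * T⁻¹, ?_, ?_⟩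
    · change (pedoeMatrix c * T⁻¹)ᵀ * gramM * (pedoeMatrix c * T⁻¹) = R
      have h1 : (pedoeMatrix c * T⁻¹)ᵀ * gramM * (pedoeMatrix c * T⁻¹) =
          (T⁻¹)ᵀ * ((pedoeMatrix c)ᵀ * gramM * pedoeMatrix c) * T⁻¹ := by
        rw [Matrix.transpose_mul]; simp only [Matrix.mul_assoc]
      rw [h1, h, ← hS]
      have h2 : (T⁻¹)ᵀ * (Tᵀ * R * T) * T⁻¹ = (T * T⁻¹)ᵀ * R * (T * T⁻¹) := by
        rw [Matrix.transpose_mul]; simp only [Matrix.mul_assoc]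
      rw [h2, Matrix.mul_nonsing_inv _ hu, Matrix.transpose_one, Matrix.one_mul, Matrix.mul_one]
    · rw [Matrix.mul_assoc, Matrix.nonsing_inv_mul _ hu, Matrix.mul_one]

end quadData

lemma map_one_intCast : (1 : Matrix (Fin 4) (Fin 4) ℤ).map (Int.cast : ℤ → ℝ) = 1 := by
  ext i j; simp [Matrix.one_apply]

lemma gram_det_isUnit {d : ℤ} (hd : d ≤ -15) : IsUnit (gram0 d).det ∧ IsUnit (gram1 d).det := by
  have h : (d : ℝ) ≠ 0 := by exact_mod_cast (by omega : d ≠ 0)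
  rw [det_gram0, det_gram1, isUnit_iff_ne_zero, isUnit_iff_ne_zero]
  constructor <;> positivity

lemma isClusterType_kCluster {d : ℤ} (hd : d ≤ -15) (hm : d % 4 = 0 ∨ d % 4 = 1) :
    (kCluster d).IsClusterType := by
  rcases hm with h | h
  · rw [kCluster_of_even h]
    refine isClusterType_quadData (d := d) (gram_det_isUnit hd).1 ?_ ?_ <;> rw [map_one_intCast]
    · simp
    · simp
  · rw [kCluster_of_odd h]
    exact isClusterType_quadData (gram_det_isUnit hd).2 isUnit_changeS (changeS_gram1 d)

lemma mem_clustersIn_kCluster {d : ℤ} (hm : d % 4 = 0 ∨ d % 4 = 1) {P s : Set OrientedCircle} :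
    s ∈ (kCluster d).clustersIn P ↔
      s ⊆ P ∧ ∃ c : Fin 4 → OrientedCircle, IsProng d c ∧ s = Set.range c := by
  have key : ∀ R S, IsUnit (S.map (Int.cast : ℤ → ℝ)).det →
      (S.map (Int.cast : ℤ → ℝ))ᵀ * R * S.map (Int.cast : ℤ → ℝ) = gram0 d →
      (s ∈ (quadData R S).clustersIn P ↔
        s ⊆ P ∧ ∃ c : Fin 4 → OrientedCircle, IsProng d c ∧ s = Set.range c) := by
    intro R S hu hS
    refine and_congr_right fun _ => ?_
    rw [exists_comm]
    refine exists_congr fun c => ?_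
    rw [exists_and_right]
    exact and_congr_left fun _ => exists_isOrderedCluster_iff hu hS
  rcases hm with h | h
  · rw [kCluster_of_even h]
    refine key _ _ ?_ ?_ <;> rw [map_one_intCast] <;> simp
  · rw [kCluster_of_odd h]
    exact key _ _ isUnit_changeS (changeS_gram1 d)

/-! ### The base cluster -/

/-- The base cluster in the order of the columns of its matrix. -/
def baseProng (d : ℤ) : Fin 4 → OrientedCircle :=
  ![realCircle, tangentCircle d 0 1, tangentCircle d 1 0, tangentCircle d 1 1]

lemma range_baseProng (d : ℤ) : Set.range (baseProng d) = basicProng d := by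
  simp only [baseProng, Matrix.range_cons, Matrix.range_empty, Set.union_empty, basicProng]
  ext C
  simp only [Set.mem_union, Set.mem_singleton_iff, Set.mem_insert_iff]
  tauto

lemma pair_tangentCircle (d : ℤ) (p q p' q' : ℤ) :
    pair (tangentCircle d p q) (tangentCircle d p' q') =
      1 - eta d ^ 2 / 2 * ((p * q' - p' * q : ℤ) : ℝ) ^ 2 := by
  simp [pair, tangentCircle]; ring

lemma isProng_baseProng {d : ℤ} (hd : d ≤ -15) : IsProng d (baseProng d) := by
  have he := eta_sq hd
  intro i j
  fin_cases i <;> fin_cases j <;>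
    simp [baseProng, gram0, pair_self, pair_tangentCircle, he] <;>
    first | simp [pair, realCircle, tangentCircle] | ring

lemma pedoeMatrix_baseProng_even {d : ℤ} (h : d % 4 = 0) :
    pedoeMatrix (baseProng d) = baseW d := by
  rw [baseW, if_pos h]
  ext i j
  fin_cases i <;> fin_cases j <;>
    simp [pedoeMatrix, baseProng, pedoe, realCircle, tangentCircle, eta]

lemma pedoeMatrix_baseProng_odd {d : ℤ} (h : d % 4 = 1) :
    pedoeMatrix (baseProng d) = baseW d * changeS.map (Int.cast : ℤ → ℝ) := by
  rw [baseW, if_neg (by omega)]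
  ext i j
  fin_cases i <;> fin_cases j <;>
    simp [pedoeMatrix, baseProng, pedoe, realCircle, tangentCircle, eta, changeS, Matrix.mul_apply,
      Fin.sum_univ_four] <;> ring

lemma baseW_mem_clusterSpace {d : ℤ} (hd : d ≤ -15) (hm : d % 4 = 0 ∨ d % 4 = 1) :
    baseW d ∈ clusterSpace (kCluster d).R := by
  have he := eta_sq hd
  have h0 := isProng_iff.mp (isProng_baseProng hd)
  rcases hm with h | h
  · rw [pedoeMatrix_baseProng_even h] at h0
    rw [kCluster_of_even h]
    exact h0
  · rw [kCluster_of_odd h]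
    have hb : (eta d) * eta d = -d := by rw [← sq]; exact he
    change (baseW d)ᵀ * gramM * baseW d = gram1 d
    rw [baseW, if_neg (by omega)]
    change (!![0, eta d, 0, 0; 0, 0, eta d, 0; 0, eta d/2, eta d/2, -eta d/2; -1, 1/2, 1/2, 1/2])ᵀ *
      gramM * !![0, eta d, 0, 0; 0, 0, eta d, 0; 0, eta d/2, eta d/2, -eta d/2; -1, 1/2, 1/2, 1/2]
        = gram1 d
    ext i j
    fin_cases i <;> fin_cases j <;>
      simp [gramM, gram1, Matrix.mul_apply, Fin.sum_univ_four] <;> nlinarith [hb]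

lemma exists_isOrderedCluster_baseW {d : ℤ} (hd : d ≤ -15) (hm : d % 4 = 0 ∨ d % 4 = 1) :
    ∃ c, (kCluster d).IsOrderedCluster (baseW d) c ∧ Set.range c = basicProng d := by
  have h0 := baseW_mem_clusterSpace hd hm
  rcases hm with h | h
  · rw [kCluster_of_even h] at h0 ⊢
    refine ⟨baseProng d, isOrderedCluster_quadData_iff.mpr ⟨h0, ?_⟩, range_baseProng d⟩
    rw [map_one_intCast, Matrix.mul_one, pedoeMatrix_baseProng_even h]
  · rw [kCluster_of_odd h] at h0 ⊢
    exact ⟨baseProng d, isOrderedCluster_quadData_iff.mpr ⟨h0, pedoeMatrix_baseProng_odd h⟩,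
      range_baseProng d⟩

/-! ### The action on clusters -/

lemma mapCircles_mobiusHom (N : GL (Fin 2) ℂ) (s : Set OrientedCircle) :
    mapCircles (mobiusHom N) s = act N '' s := by
  ext C
  simp only [mapCircles, isImage_mobius_iff, Set.mem_ofPred_eq, Set.mem_image, eq_comm]

lemma IsProng.act {d : ℤ} {c : Fin 4 → OrientedCircle} (hc : IsProng d c) (N : GL (Fin 2) ℂ) :
    IsProng d (fun i => KApollonian.act N (c i)) := fun i j => by
  rw [pair_act]; exact hc i j

/-- Change signs so that the second and third vectors have determinant 1 with the first. Their
difference is then a multiple of the first, by ±1 because of the remaining determinant; so one of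
them is the sum of the other two. -/
lemma exists_sl_of_det_sq {d p₁ q₁ p₂ q₂ p₃ q₃ : ℤ} (h12 : (p₁ * q₂ - p₂ * q₁) ^ 2 = 1)
    (h13 : (p₁ * q₃ - p₃ * q₁) ^ 2 = 1) (h23 : (p₂ * q₃ - p₃ * q₂) ^ 2 = 1) :
    ∃ M : SpecialLinearGroup (Fin 2) ℤ, act (zHom M) '' basicProng d =
      {realCircle, tangentCircle d p₁ q₁, tangentCircle d p₂ q₂, tangentCircle d p₃ q₃} := by
  have scale : ∀ e p q : ℤ, e ^ 2 = 1 → tangentCircle d (e * p) (e * q) = tangentCircle d p q := by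
    intro e p q he
    rcases sq_eq_one_iff.mp he with rfl | rfl
    · simp
    · simp [tangentCircle_neg]
  have exists_sl : ∀ a b c d : ℤ, a * d - b * c = 1 → ∃ M : SpecialLinearGroup (Fin 2) ℤ,
      M 0 0 = a ∧ M 0 1 = b ∧ M 1 0 = c ∧ M 1 1 = d := fun a b c d h =>
    ⟨⟨!![a, b; c, d], by rw [det_fin_two_of]; exact h⟩, rfl, rfl, rfl, rfl⟩
  set e := p₁ * q₂ - p₂ * q₁ with he
  set y := p₁ * q₃ - p₃ * q₁ with hy
  have h2 : p₁ * (e * q₂) - (e * p₂) * q₁ = 1 := by linear_combination h12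
  have h3 : p₁ * (y * q₃) - (y * p₃) * q₁ = 1 := by linear_combination h13
  rw [← scale e p₂ q₂ h12, ← scale y p₃ q₃ h13]
  have h23' : ((e * p₂) * (y * q₃) - (y * p₃) * (e * q₂)) ^ 2 = 1 := by
    have : ((e * p₂) * (y * q₃) - (y * p₃) * (e * q₂)) ^ 2 =
      e ^ 2 * y ^ 2 * (p₂ * q₃ - p₃ * q₂) ^ 2 := by ring
    rw [this, h12, h13, h23]; norm_num
  generalize e * p₂ = P₂ at *
  generalize e * q₂ = Q₂ at *
  generalize y * p₃ = P₃ at *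
  generalize y * q₃ = Q₃ at *
  rcases sq_eq_one_iff.mp h23' with h | h
  · have ep : p₁ + P₃ = P₂ := by linear_combination P₂ * h3 - P₃ * h2 - p₁ * h
    have eq : q₁ + Q₃ = Q₂ := by linear_combination Q₂ * h3 - Q₃ * h2 - q₁ * h
    obtain ⟨M, h00, h01, h10, h11⟩ := exists_sl _ _ _ _ h3
    refine ⟨M, ?_⟩
    rw [act_zHom_basicProng, h00, h01, h10, h11, ep, eq, Set.pair_comm (tangentCircle d P₃ Q₃)]
  · have ep : p₁ + P₂ = P₃ := by linear_combination P₃ * h2 - P₂ * h3 + p₁ * h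
    have eq : q₁ + Q₂ = Q₃ := by linear_combination Q₃ * h2 - Q₂ * h3 + q₁ * h
    obtain ⟨M, h00, h01, h10, h11⟩ := exists_sl _ _ _ _ h2
    refine ⟨M, ?_⟩
    rw [act_zHom_basicProng, h00, h01, h10, h11, ep, eq]

/-- The central circle must be fixed, so the ping-pong result makes the element elliptic; it
permutes the cusps ∞, 0, 1 and is therefore ±1. -/
lemma stabilizer_basicProng {d : ℤ} (hd : d ≤ -15) (hm : d % 4 = 0 ∨ d % 4 = 1)
    {N : GL (Fin 2) ℂ} (hN : N ∈ matrixGroup d) (h : act N '' basicProng d = basicProng d) :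
    mobiusHom N = 1 := by
  have he := eta_sq hd
  have hd' : (d : ℝ) ≤ -15 := by exact_mod_cast hd
  have hp := eta_gt hd
  -- R is singled out in the prong by having product ±1 with every member; two different outer
  -- circles have product `1 + Δ/2 < -1`.
  have hpair : ∀ C ∈ basicProng d, pair (act N realCircle) C = 1 ∨
      pair (act N realCircle) C = -1 := by
    intro C hC
    rw [← h] at hC
    obtain ⟨D, hD, rfl⟩ := hC
    rw [pair_act]
    rcases hD with rfl | rfl | rfl | rfl <;> simp [pair, realCircle, tangentCircle]
  have hR : act N realCircle = realCircle := by
    have h1 : act N realCircle ∈ basicProng d := h ▸ ⟨_, by simp [basicProng], rfl⟩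
    have c10 := hpair (tangentCircle d 1 0) (by simp [basicProng])
    have c01 := hpair (tangentCircle d 0 1) (by simp [basicProng])
    rcases h1 with h1 | h1 | h1 | h1
    · exact h1
    all_goals
      exfalso
      rw [h1, pair_tangentCircle, he] at c10 c01
      norm_num at c10 c01
    · rcases c01 with c | c <;> linarith
    · rcases c10 with c | c <;> linarith
    · rcases c10 with c | c <;> linarith
  obtain ⟨k, hk, e⟩ := exists_elliptic_of_stabilizes hd hm (mem_groupA.mpr ⟨N, hN, rfl⟩)
    (fun x hx => by
      have := carrier_act N realCircle
      rw [hR] at this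
      rw [this]; exact ⟨x, hx, rfl⟩)
  have h2 : act (zHom k) '' basicProng d = basicProng d := by
    refine Eq.trans ?_ h
    exact Set.image_congr fun C _ => (act_congr e C).symm
  rw [act_zHom_basicProng] at h2
  have key : ∀ p q : ℤ, tangentCircle d p q ∈ basicProng d →
      (p ^ 2 = 1 ∧ q ^ 2 = 0) ∨ (p ^ 2 = 0 ∧ q ^ 2 = 1) ∨
        (p ^ 2 = 1 ∧ q ^ 2 = 1 ∧ p * q = 1) := by
    intro p q hpq
    have cancel : ∀ {x y : ℤ}, eta d * (x : ℝ) = eta d * (y : ℝ) → x = y := fun hxy => by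
      exact_mod_cast mul_left_cancel₀ (by positivity) hxy
    have coords : ∀ p' q' : ℤ, tangentCircle d p q = tangentCircle d p' q' →
        p ^ 2 = p' ^ 2 ∧ q ^ 2 = q' ^ 2 ∧ p * q = p' * q' := by
      intro p' q' hpq'
      have e1 := congrArg (fun C => C.b') hpq'
      have e2 := congrArg (fun C => C.b) hpq'
      have e3 := congrArg (fun C => C.a.re) hpq'
      simp only [tangentCircle] at e1 e2 e3
      refine ⟨cancel ?_, cancel ?_, cancel ?_⟩ <;> push_cast <;> linarith
    rcases hpq with hpq | hpq | hpq | hpq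
    · have := congrArg (fun C => C.a.im) hpq
      norm_num [realCircle, tangentCircle] at this
    all_goals
      obtain ⟨e1, e2, e3⟩ := coords _ _ hpq
      simp only [e1, e2, e3]
      norm_num
  have hk1 := elliptic_eq_one hk (fun p q hpq => key p q (by
    rw [← h2]
    rcases hpq with ⟨rfl, rfl⟩ | ⟨rfl, rfl⟩ | ⟨rfl, rfl⟩ <;> simp))
  rw [e]
  rcases hk1 with rfl | rfl
  · rw [map_one, map_one]
  · exact mobiusHom_zHom_neg_one

section Field

variable {K : Type*} [Field K] [NumberField K]

lemma exists_sl_of_isProng (hK : Module.finrank ℚ K = 2) (hd : discr K ≤ -15) (φ : K →+* ℂ)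
    {c : Fin 4 → OrientedCircle} (hc : IsProng (discr K) c)
    (hs : Set.range c ⊆ orbitPacking (discr K)) (h0 : c 0 = realCircle) :
    ∃ M : SpecialLinearGroup (Fin 2) ℤ,
      act (zHom M) '' basicProng (discr K) = Set.range c := by
  have he := eta_sq hd
  have hd' : (discr K : ℝ) ≤ -15 := by exact_mod_cast hd
  have him : ∀ i, i ≠ 0 → (c i).a.im = 1 := by
    intro i hi
    have := hc i 0
    rw [h0, pair_realCircle] at this
    have hg : gram0 (discr K) i 0 = -1 := by fin_cases i <;> simp_all [gram0]
    linarith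
  have hg : ∀ i j, i ≠ 0 → j ≠ 0 → i ≠ j → pair (c i) (c j) = 1 + (discr K : ℝ) / 2 := by
    intro i j hi hj hij
    rw [hc i j]
    fin_cases i <;> fin_cases j <;> simp_all [gram0]
  have htc : ∀ i j, i ≠ 0 → j ≠ 0 → i ≠ j → ∃ p q, c i = tangentCircle (discr K) p q := by
    intro i j hi hj hij
    obtain ⟨M, hM⟩ := exists_zHom_of_tangent hK hd (orbitPacking_isPrePacking hK hd φ)
      (realCircle_mem_orbitPacking _) (hs ⟨i, rfl⟩) (by rw [him i hi]; norm_num)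
      (fun h => by
        have := him i hi
        rw [h] at this
        norm_num [realCircle] at this)
      -- The reversed real line is excluded by the product with a second outer circle, which would
      -- be 1 instead of `1 + Δ/2`.
      (fun h => by
        have := hg i j hi hj hij
        rw [h, pair_comm] at this
        have h2 : pair (c j) realCircle.neg = (c j).a.im := by
          simp [pair, realCircle, OrientedCircle.neg]
        rw [h2, him j hj] at this
        linarith)
    exact ⟨_, _, hM.trans (act_zHom_tangentCircle _ _ _ _)⟩
  obtain ⟨p₁, q₁, e1⟩ := htc 1 2 (by decide) (by decide) (by decide)
  obtain ⟨p₂, q₂, e2⟩ := htc 2 1 (by decide) (by decide) (by decide)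
  obtain ⟨p₃, q₃, e3⟩ := htc 3 1 (by decide) (by decide) (by decide)
  have hdet : ∀ p q p' q' : ℤ, pair (tangentCircle (discr K) p q) (tangentCircle (discr K) p' q') =
      1 + (discr K : ℝ) / 2 → (p * q' - p' * q) ^ 2 = 1 := by
    intro p q p' q' h
    rw [pair_tangentCircle, he] at h
    have h2 : (discr K : ℝ) * (((p * q' - p' * q : ℤ) : ℝ) ^ 2) = (discr K : ℝ) * 1 := by
      linear_combination 2 * h
    have := mul_left_cancel₀ (by linarith : (discr K : ℝ) ≠ 0) h2
    exact_mod_cast this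
  have h12 := hg 1 2 (by decide) (by decide) (by decide)
  have h13 := hg 1 3 (by decide) (by decide) (by decide)
  have h23 := hg 2 3 (by decide) (by decide) (by decide)
  rw [e1, e2] at h12
  rw [e1, e3] at h13
  rw [e2, e3] at h23
  obtain ⟨M, hM⟩ := exists_sl_of_det_sq (hdet _ _ _ _ h12) (hdet _ _ _ _ h13) (hdet _ _ _ _ h23)
  refine ⟨M, hM.trans ?_⟩
  rw [← e1, ← e2, ← e3, ← h0]
  ext C
  simp only [Set.mem_insert_iff, Set.mem_singleton_iff, Set.mem_range, Fin.exists_fin_succ,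
    Fin.exists_fin_zero, eq_comm (a := C)]
  simp

lemma exists_matrix_of_isProng (hK : Module.finrank ℚ K = 2) (hd : discr K ≤ -15) (φ : K →+* ℂ)
    {c : Fin 4 → OrientedCircle} (hc : IsProng (discr K) c)
    (hs : Set.range c ⊆ orbitPacking (discr K)) :
    ∃ N ∈ matrixGroup (discr K), act N '' basicProng (discr K) = Set.range c := by
  obtain ⟨N, hN, h0⟩ := hs ⟨0, rfl⟩
  have hs' : Set.range (fun i => act N⁻¹ (c i)) ⊆ orbitPacking (discr K) := by
    rintro _ ⟨i, rfl⟩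
    exact act_mem_orbitPacking (inv_mem hN) (hs ⟨i, rfl⟩)
  obtain ⟨M, hM⟩ := exists_sl_of_isProng hK hd φ (hc.act N⁻¹) hs' (by
    simp only [h0, act_inv_act])
  obtain ⟨h, hh, e⟩ := exists_elliptic_basicProng (discr K) M
  refine ⟨N * zHom h, mul_mem hN (zHom_mem_matrixGroup hh), ?_⟩
  rw [image_act_mul, ← e, hM, ← Set.range_comp]
  congr 1
  funext i
  exact act_act_inv _ _

lemma isPrincipalHomogeneous_groupA (hK : Module.finrank ℚ K = 2) (hd : discr K ≤ -15)
    (φ : K →+* ℂ) : IsPrincipalHomogeneous (groupA (discr K))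
      ((kCluster (discr K)).clustersIn (orbitPacking (discr K))) := by
  have hm := discr_mod_four hK
  have key : ∀ s ∈ (kCluster (discr K)).clustersIn (orbitPacking (discr K)),
      ∃ N ∈ matrixGroup (discr K), act N '' basicProng (discr K) = s := by
    intro s hs
    obtain ⟨h1, c, hc, rfl⟩ := (mem_clustersIn_kCluster hm).mp hs
    exact exists_matrix_of_isProng hK hd φ hc h1
  refine ⟨⟨basicProng (discr K), (mem_clustersIn_kCluster hm).mpr ⟨basicProng_subset _, baseProng _,
    isProng_baseProng hd, (range_baseProng _).symm⟩⟩, ?_, ?_⟩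
  · intro g hg s hs
    obtain ⟨N, hN, rfl⟩ := mem_groupA.mp hg
    obtain ⟨h1, c, hc, rfl⟩ := (mem_clustersIn_kCluster hm).mp hs
    rw [mapCircles_mobiusHom]
    refine (mem_clustersIn_kCluster hm).mpr ⟨?_, _, hc.act N, (Set.range_comp _ _).symm⟩
    rintro _ ⟨C, hC, rfl⟩
    exact act_mem_orbitPacking hN (h1 hC)
  · intro s hs s' hs'
    obtain ⟨N, hN, rfl⟩ := key s hs
    obtain ⟨N', hN', rfl⟩ := key s' hs'
    refine ⟨mobiusHom (N' * N⁻¹), ⟨mem_groupA.mpr ⟨_, mul_mem hN' (inv_mem hN), rfl⟩, ?_⟩, ?_⟩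
    · rw [mapCircles_mobiusHom, ← image_act_mul, inv_mul_cancel_right]
    · rintro g ⟨hg, hgs⟩
      obtain ⟨M, hM, rfl⟩ := mem_groupA.mp hg
      rw [mapCircles_mobiusHom, ← image_act_mul] at hgs
      have h1 : act (N'⁻¹ * (M * N)) '' basicProng (discr K) = basicProng (discr K) := by
        rw [image_act_mul, hgs, ← image_act_mul, inv_mul_cancel]
        simp only [act_one, Set.image_id']
      have h2 := stabilizer_basicProng hd hm
        (mul_mem (inv_mem hN') (mul_mem hM hN)) h1
      rw [map_mul, map_mul, map_inv, inv_mul_eq_one] at h2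
      rw [map_mul, map_inv, h2, mul_inv_cancel_right]

lemma isApollonianGroup_groupA (hK : Module.finrank ℚ K = 2) (hd : discr K ≤ -15) (φ : K →+* ℂ) :
    IsApollonianGroup φ (kCluster (discr K)) (groupA (discr K)) where
  clusterType := isClusterType_kCluster hd (discr_mod_four hK)
  weak := isWeakApollonianGroup_groupA hK hd φ
  torsor := by
    rw [fundamentalPacking_eq hK hd φ]
    exact isPrincipalHomogeneous_groupA hK hd φ

end Field

/-! ### The exceptional isomorphism -/

/-- The inverse of the identification of Minkowski space with Hermitian matrices. -/
def hermitianCoords (T : Matrix (Fin 2) (Fin 2) ℂ) : Fin 4 → ℝ :=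
  ![(T 0 0).re, (T 1 1).re, (T 0 1).re, (T 0 1).im]

lemma hermitianCoords_hermitianMatrix (v : Fin 4 → ℝ) :
    hermitianCoords (hermitianMatrix v) = v := by
  ext i; fin_cases i <;> simp [hermitianCoords, hermitianMatrix]

lemma hermitianMatrix_hermitianCoords {T : Matrix (Fin 2) (Fin 2) ℂ} (hT : Tᴴ = T) :
    hermitianMatrix (hermitianCoords T) = T := by
  have h : ∀ i j, (starRingEnd ℂ) (T j i) = T i j := fun i j => by
    conv_rhs => rw [← hT]
    rfl
  have h00 := Complex.conj_eq_iff_im.mp (h 0 0)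
  have h11 := Complex.conj_eq_iff_im.mp (h 1 1)
  have h01 := h 1 0
  ext i j
  fin_cases i <;> fin_cases j
  · exact Complex.ext (by simp [hermitianCoords, hermitianMatrix]) (by
      simp [hermitianCoords, hermitianMatrix, h00])
  · exact Complex.ext (by simp [hermitianCoords, hermitianMatrix]) (by
      simp [hermitianCoords, hermitianMatrix])
  · change _ = T 1 0
    rw [← h01]
    exact Complex.ext (by simp [hermitianCoords, hermitianMatrix]) (by
      simp [hermitianCoords, hermitianMatrix])
  · exact Complex.ext (by simp [hermitianCoords, hermitianMatrix]) (by
      simp [hermitianCoords, hermitianMatrix, h11])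

lemma hermitianMatrix_injective : Function.Injective hermitianMatrix :=
  Function.LeftInverse.injective hermitianCoords_hermitianMatrix

lemma conjTranspose_hermitianMatrix (v : Fin 4 → ℝ) : (hermitianMatrix v)ᴴ = hermitianMatrix v := by
  ext i j
  fin_cases i <;> fin_cases j <;> simp [hermitianMatrix, sub_eq_add_neg]

lemma hermitianMatrix_add (v w : Fin 4 → ℝ) :
    hermitianMatrix (v + w) = hermitianMatrix v + hermitianMatrix w := by
  ext i j
  fin_cases i <;> fin_cases j <;> simp [hermitianMatrix] <;> ring

lemma hermitianMatrix_smul (r : ℝ) (v : Fin 4 → ℝ) :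
    hermitianMatrix (r • v) = r • hermitianMatrix v := by
  ext i j
  fin_cases i <;> fin_cases j <;> simp [hermitianMatrix] <;> ring

/-- The action of a matrix on Hermitian matrices, normalized so as to preserve the determinant. -/
def hermitianAct (M : GL (Fin 2) ℂ) (T : Matrix (Fin 2) (Fin 2) ℂ) : Matrix (Fin 2) (Fin 2) ℂ :=
  ((‖M.1.det‖⁻¹ : ℝ) : ℂ) • (M.1 * T * M.1ᴴ)

lemma hermitianAct_mul (M N : GL (Fin 2) ℂ) (T : Matrix (Fin 2) (Fin 2) ℂ) :
    hermitianAct (M * N) T = hermitianAct M (hermitianAct N T) := by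
  unfold hermitianAct
  rw [Units.val_mul, det_mul, norm_mul, mul_inv, conjTranspose_mul, Matrix.mul_smul, Matrix.smul_mul,
    smul_smul, Complex.ofReal_mul]
  simp only [Matrix.mul_assoc]

/-- A scalar `c` contributes `|c|²` both to `M T M†` and to `|det M|`. -/
lemma hermitianAct_congr {M N : GL (Fin 2) ℂ} (h : mobiusHom M = mobiusHom N) :
    hermitianAct M = hermitianAct N := by
  obtain ⟨c, hc⟩ := exists_scalar_of_mobiusHom_eq h
  have hM : M.1 = c • N.1 := by ext i j; exact hc i j
  have hN : ‖N.1.det‖ ≠ 0 := norm_ne_zero_iff.mpr N.det_ne_zero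
  have hc0 : ‖c‖ ≠ 0 := by
    intro h0
    rw [norm_eq_zero] at h0
    have := M.det_ne_zero
    rw [hM, h0, zero_smul] at this
    simp at this
  funext T
  unfold hermitianAct
  rw [hM, conjTranspose_smul, Matrix.mul_smul, Matrix.smul_mul, Matrix.smul_mul, smul_smul, smul_smul,
    det_smul, Fintype.card_fin]
  congr 1
  rw [norm_mul, norm_pow]
  have : star c * c = ((‖c‖ ^ 2 : ℝ) : ℂ) := by
    rw [← Complex.normSq_eq_norm_sq, Complex.normSq_eq_conj_mul_self]; rfl
  rw [mul_assoc, this, ← Complex.ofReal_mul]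
  congr 1
  field_simp

/-- The matrix of the action on Minkowski space. -/
def rhoMatrix (M : GL (Fin 2) ℂ) : Matrix (Fin 4) (Fin 4) ℝ :=
  LinearMap.toMatrix'
    { toFun := fun v => hermitianCoords (hermitianAct M (hermitianMatrix v))
      map_add' := fun v w => by
        rw [hermitianMatrix_add, hermitianAct, Matrix.mul_add, Matrix.add_mul, smul_add]
        ext i
        fin_cases i <;> simp [hermitianCoords, hermitianAct]
      map_smul' := fun r v => by
        rw [hermitianMatrix_smul, hermitianAct, Matrix.mul_smul, Matrix.smul_mul, smul_comm]
        ext i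
        fin_cases i <;> simp [hermitianCoords, hermitianAct] }

lemma hermitianMatrix_rhoMatrix (M : GL (Fin 2) ℂ) (v : Fin 4 → ℝ) :
    hermitianMatrix (rhoMatrix M *ᵥ v) = hermitianAct M (hermitianMatrix v) := by
  rw [rhoMatrix, LinearMap.toMatrix'_mulVec]
  refine hermitianMatrix_hermitianCoords ?_
  rw [hermitianAct, conjTranspose_smul, conjTranspose_mul, conjTranspose_mul,
    conjTranspose_conjTranspose, conjTranspose_hermitianMatrix, Matrix.mul_assoc]
  simp

lemma eq_rhoMatrix {M : GL (Fin 2) ℂ} {N : Matrix (Fin 4) (Fin 4) ℝ}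
    (h : ∀ v, hermitianMatrix (N *ᵥ v) = hermitianAct M (hermitianMatrix v)) :
    N = rhoMatrix M := by
  apply Matrix.ext_of_mulVec_single
  intro i
  apply hermitianMatrix_injective
  rw [h, hermitianMatrix_rhoMatrix]

lemma rhoMatrix_mul (M N : GL (Fin 2) ℂ) : rhoMatrix (M * N) = rhoMatrix M * rhoMatrix N := by
  refine (eq_rhoMatrix fun v => ?_).symm
  rw [← Matrix.mulVec_mulVec, hermitianMatrix_rhoMatrix, hermitianMatrix_rhoMatrix, hermitianAct_mul]

lemma rhoMatrix_one : rhoMatrix 1 = 1 := by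
  refine (eq_rhoMatrix fun v => ?_).symm
  simp [hermitianAct]

/-- Conjugation fixes ∞, 0 and 1, so the matrix would be scalar and would fix `i`. This rules out
the conjugate-linear alternative in `IsRho`. -/
lemma mobiusHom_ne_conjPerm (M : GL (Fin 2) ℂ) : mobiusHom M ≠ conjPerm := by
  intro h
  have hfix : ∀ x : OnePoint ℂ, conjPerm x = x → M • x = x := fun x hx => by
    rw [← mobiusHom_apply, h, hx]
  have hcoe : ∀ z : ℂ, conjPerm (z : OnePoint ℂ) = (((starRingEnd ℂ) z : ℂ) : OnePoint ℂ) :=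
    fun z => rfl
  obtain ⟨h10, h01, h00⟩ := entries_of_fix (hfix _ rfl) (hfix ((0 : ℂ) : OnePoint ℂ) (by simp [hcoe]))
    (hfix ((1 : ℂ) : OnePoint ℂ) (by simp [hcoe]))
  have hdet := M.det_ne_zero
  rw [det_fin_two, h10, mul_zero, sub_zero] at hdet
  have h11 : M 1 1 ≠ 0 := right_ne_zero_of_mul hdet
  have hI : mobiusHom M ((Complex.I : ℂ) : OnePoint ℂ) = ((Complex.I : ℂ) : OnePoint ℂ) := by
    rw [mobiusHom_apply, OnePoint.smul_some_eq_ite, if_neg (by simpa [h10] using h11), h10, h01, h00]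
    rw [OnePoint.coe_eq_coe]
    rw [zero_mul, zero_add, add_zero, mul_div_cancel_left₀ _ h11]
  rw [h, hcoe, OnePoint.coe_eq_coe] at hI
  have := congrArg Complex.im hI
  norm_num at this

lemma isRho_mobiusHom_iff {M : GL (Fin 2) ℂ} {N : Matrix (Fin 4) (Fin 4) ℝ} :
    IsRho (mobiusHom M) N ↔ N = rhoMatrix M := by
  constructor
  · rintro ⟨M', ⟨e, h⟩ | ⟨e, -⟩⟩
    · refine eq_rhoMatrix fun v => ?_
      rw [hermitianAct_congr e]
      exact h v
    · refine absurd ?_ (mobiusHom_ne_conjPerm (M'⁻¹ * M))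
      rw [map_mul, map_inv, e, inv_mul_cancel_left]
  · rintro rfl
    exact ⟨M, Or.inl ⟨rfl, hermitianMatrix_rhoMatrix M⟩⟩

/-! ### The matrices of the generators -/

lemma rhoMatrix_real {M : GL (Fin 2) ℂ} {p q r s : ℝ} (hM : M.1 = !![(p : ℂ), q; r, s])
    (h : p * s - q * r = 1) :
    rhoMatrix M =
      !![p ^ 2, q ^ 2, 2 * p * q, 0;
         r ^ 2, s ^ 2, 2 * r * s, 0;
         p * r, q * s, p * s + q * r, 0;
         0, 0, 0, 1] := by
  have hdet : M.1.det = 1 := by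
    rw [hM, det_fin_two_of]; exact_mod_cast h
  refine (eq_rhoMatrix fun v => ?_).symm
  rw [hermitianAct, hdet, norm_one, inv_one, Complex.ofReal_one, one_smul, hM]
  ext i j
  apply Complex.ext
  all_goals
    fin_cases i <;> fin_cases j <;>
      simp [hermitianMatrix, Matrix.mul_apply, Matrix.mulVec, dotProduct, Fin.sum_univ_four,
        Fin.sum_univ_two, sq]
  all_goals first | ring1 | linear_combination v 3 * h | linear_combination -v 3 * h

lemma rhoMatrix_gamma1 : rhoMatrix gamma1 =
    !![1, 4, -4, 0; 1, 1, -2, 0; 1, 2, -3, 0; 0, 0, 0, 1] := by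
  rw [rhoMatrix_real (p := -1) (q := 2) (r := -1) (s := 1) (by simp [gamma1]) (by norm_num)]
  norm_num

lemma rhoMatrix_gamma2 : rhoMatrix gamma2 =
    !![1, 1, -2, 0; 4, 1, -4, 0; 2, 1, -3, 0; 0, 0, 0, 1] := by
  rw [rhoMatrix_real (p := 1) (q := -1) (r := 2) (s := -1) (by simp [gamma2]) (by norm_num)]
  norm_num

lemma rhoMatrix_gamma3 : rhoMatrix gamma3 =
    !![0, 1, 0, 0; 1, 0, 0, 0; 0, 0, -1, 0; 0, 0, 0, 1] := by
  rw [rhoMatrix_real (p := 0) (q := 1) (r := -1) (s := 0) (by simp [gamma3]) (by norm_num)]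
  norm_num

lemma rhoMatrix_gamma4 (d : ℤ) : rhoMatrix (gamma4 d) =
    !![1, (1 - (eps d : ℝ) / 2) ^ 2 + eta d ^ 2 / 4, 2 - (eps d : ℝ), -eta d;
       0, 1, 0, 0;
       0, (eps d : ℝ) / 2 - 1, -1, 0;
       0, eta d / 2, 0, -1] := by
  have hM : (gamma4 d).1 = !![1, 1 - tau d; 0, -1] := rfl
  have hre := tau_re d
  have him := tau_im d
  refine (eq_rhoMatrix fun v => ?_).symm
  rw [hermitianAct, hM, det_fin_two_of, mul_zero, sub_zero, mul_neg, one_mul, norm_neg, norm_one,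
    inv_one, Complex.ofReal_one, one_smul]
  ext i j
  apply Complex.ext
  all_goals
    fin_cases i <;> fin_cases j <;>
      simp [hermitianMatrix, Matrix.mul_apply, Matrix.mulVec, dotProduct, Fin.sum_univ_four,
        Fin.sum_univ_two, hre, him, sq]
  all_goals ring

/-! ### The algebraic group -/

/-- The homomorphism `M ↦ W⁻¹ ρ(M) W`. -/
def conjRho (W : Matrix (Fin 4) (Fin 4) ℝ) (hW : IsUnit W.det) :
    GL (Fin 2) ℂ →* Matrix (Fin 4) (Fin 4) ℝ where
  toFun M := W⁻¹ * rhoMatrix M * W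
  map_one' := by rw [rhoMatrix_one, Matrix.mul_one, Matrix.nonsing_inv_mul _ hW]
  map_mul' M N := by
    have h : rhoMatrix N * W = W * (W⁻¹ * (rhoMatrix N * W)) := by
      rw [Matrix.mul_nonsing_inv_cancel_left _ _ hW]
    simp only [rhoMatrix_mul, Matrix.mul_assoc]
    rw [← h]

lemma algebraicImage_groupA (d : ℤ) (W : Matrix (Fin 4) (Fin 4) ℝ) (hW : IsUnit W.det) :
    algebraicImage W (groupA d) = (fun X : GL (Fin 4) ℝ => X.1) ''
      ((matrixGroup d).map (conjRho W hW).toHomUnits : Set (GL (Fin 4) ℝ)) := by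
  ext X
  constructor
  · rintro ⟨g, hg, N, hN, rfl⟩
    obtain ⟨M, hM, rfl⟩ := mem_groupA.mp hg
    rw [isRho_mobiusHom_iff.mp hN]
    exact ⟨_, ⟨M, hM, rfl⟩, rfl⟩
  · rintro ⟨_, ⟨M, hM, rfl⟩, rfl⟩
    exact ⟨_, mem_groupA.mpr ⟨M, hM, rfl⟩, _, isRho_mobiusHom_iff.mpr rfl, rfl⟩

lemma baseW_det {d : ℤ} (hd : d ≤ -15) (hm : d % 4 = 0 ∨ d % 4 = 1) : IsUnit (baseW d).det := by
  have h : (baseW d)ᵀ * gramM * baseW d = (kCluster d).R := baseW_mem_clusterSpace hd hm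
  have h2 := (isClusterType_kCluster hd hm).invertible
  rw [← h, det_mul] at h2
  exact isUnit_of_mul_isUnit_right h2

/-- Comparing `ρ(M) W` with `W X` avoids computing the inverse of `W`. -/
lemma conjRho_eq_ofInvolution {W : Matrix (Fin 4) (Fin 4) ℝ} {hW : IsUnit W.det} {M : GL (Fin 2) ℂ}
    {X : Matrix (Fin 4) (Fin 4) ℝ} {hX : X * X = 1} (h : rhoMatrix M * W = W * X) :
    (conjRho W hW).toHomUnits M = ofInvolution X hX := by
  apply Units.ext
  change W⁻¹ * rhoMatrix M * W = X
  rw [Matrix.mul_assoc, h, Matrix.nonsing_inv_mul_cancel_left _ _ hW]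

lemma map_matrixGroup_even {d : ℤ} (hd : d ≤ -15) (hm : d % 4 = 0) (hW : IsUnit (baseW d).det) :
    (matrixGroup d).map (conjRho (baseW d) hW).toHomUnits = groupAhat d := by
  have he := eta_sq hd
  have hb : eta d * eta d = -d := by rw [← sq]; exact he
  have hε : eps d = 0 := if_pos hm
  have hBW : baseW d =
      !![0, 0, eta d, eta d; 0, eta d, 0, eta d; 0, 0, 0, eta d; -1, 1, 1, 1] := if_pos hm
  rw [matrixGroup, groupAhat, if_pos hm, MonoidHom.map_closure]
  simp only [Set.image_insert_eq, Set.image_singleton, matGens0]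
  congr 2
  · apply conjRho_eq_ofInvolution
    rw [rhoMatrix_gamma1, hBW]
    ext i j
    fin_cases i <;> fin_cases j <;> simp [Matrix.mul_apply, Fin.sum_univ_four] <;> ring
  congr 1
  · apply conjRho_eq_ofInvolution
    rw [rhoMatrix_gamma2, hBW]
    ext i j
    fin_cases i <;> fin_cases j <;> simp [Matrix.mul_apply, Fin.sum_univ_four] <;> ring
  congr 1
  · apply conjRho_eq_ofInvolution
    rw [rhoMatrix_gamma3, hBW]
    ext i j
    fin_cases i <;> fin_cases j <;> simp [Matrix.mul_apply, Fin.sum_univ_four] <;> ring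
  congr 1
  · apply conjRho_eq_ofInvolution
    rw [rhoMatrix_gamma4, hBW, hε, he]
    ext i j
    fin_cases i <;> fin_cases j <;> simp [Matrix.mul_apply, Fin.sum_univ_four] <;>
      first | ring1 | linear_combination hb | linear_combination hb / 2

lemma map_matrixGroup_odd {d : ℤ} (hd : d ≤ -15) (hm : d % 4 = 1) (hW : IsUnit (baseW d).det) :
    (matrixGroup d).map (conjRho (baseW d) hW).toHomUnits = groupAhat d := by
  have he := eta_sq hd
  have hb : eta d * eta d = -d := by rw [← sq]; exact he
  have hm' : ¬ d % 4 = 0 := by omega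
  have hε : eps d = 1 := if_neg hm'
  have hBW : baseW d =
      !![0, eta d, 0, 0; 0, 0, eta d, 0; 0, eta d/2, eta d/2, -eta d/2; -1, 1/2, 1/2, 1/2] :=
    if_neg hm'
  rw [matrixGroup, groupAhat, if_neg hm', MonoidHom.map_closure]
  simp only [Set.image_insert_eq, Set.image_singleton, matGens1]
  congr 2
  · apply conjRho_eq_ofInvolution
    rw [rhoMatrix_gamma1, hBW]
    ext i j
    fin_cases i <;> fin_cases j <;> simp [Matrix.mul_apply, Fin.sum_univ_four] <;> ring
  congr 1
  · apply conjRho_eq_ofInvolution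
    rw [rhoMatrix_gamma2, hBW]
    ext i j
    fin_cases i <;> fin_cases j <;> simp [Matrix.mul_apply, Fin.sum_univ_four] <;> ring
  congr 1
  · apply conjRho_eq_ofInvolution
    rw [rhoMatrix_gamma3, hBW]
    ext i j
    fin_cases i <;> fin_cases j <;> simp [Matrix.mul_apply, Fin.sum_univ_four] <;> ring
  congr 1
  · apply conjRho_eq_ofInvolution
    rw [rhoMatrix_gamma4, hBW, hε, he]
    ext i j
    fin_cases i <;> fin_cases j <;> simp [Matrix.mul_apply, Fin.sum_univ_four] <;>
      first | ring1 | linear_combination hb | linear_combination hb / 2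

lemma mul_mem_integralOrthogonal {R X Y : Matrix (Fin 4) (Fin 4) ℝ}
    (hX : X ∈ integralOrthogonal R) (hY : Y ∈ integralOrthogonal R) :
    X * Y ∈ integralOrthogonal R := by
  obtain ⟨h1, X', rfl⟩ := hX
  obtain ⟨h2, Y', rfl⟩ := hY
  refine ⟨?_, X' * Y', ?_⟩
  · generalize X'.map (Int.cast : ℤ → ℝ) = X at h1 ⊢
    generalize Y'.map (Int.cast : ℤ → ℝ) = Y at h2 ⊢
    have e : (X * Y)ᵀ * R * (X * Y) = Yᵀ * (Xᵀ * R * X) * Y := by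
      rw [transpose_mul]; simp only [Matrix.mul_assoc]
    rw [e, h1, h2]
  · exact (Matrix.map_mul (f := Int.castRingHom ℝ)).symm

/-- Since the generators are involutions, integrality of inverses needs no separate argument. -/
lemma closure_subset_integralOrthogonal {R : Matrix (Fin 4) (Fin 4) ℝ} {S : Set (GL (Fin 4) ℝ)}
    (hS : ∀ X ∈ S, X⁻¹ = X ∧ X.1 ∈ integralOrthogonal R) :
    ∀ X ∈ Subgroup.closure S, X.1 ∈ integralOrthogonal R := by
  intro X hX
  induction hX using Subgroup.closure_induction_left with
  | one =>
    refine ⟨by simp, 1, ?_⟩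
    rw [map_one_intCast]; rfl
  | mul_left x hx y hy ih => exact mul_mem_integralOrthogonal (hS x hx).2 ih
  | inv_mul_cancel x hx y hy ih =>
    rw [(hS x hx).1]
    exact mul_mem_integralOrthogonal (hS x hx).2 ih

lemma ofInvolution_integral {R X : Matrix (Fin 4) (Fin 4) ℝ} {hX : X * X = 1}
    (Y : Matrix (Fin 4) (Fin 4) ℤ) (hY : X = Y.map (Int.cast : ℤ → ℝ)) (hR : Xᵀ * R * X = R) :
    (ofInvolution X hX)⁻¹ = ofInvolution X hX ∧ (ofInvolution X hX).1 ∈ integralOrthogonal R :=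
  ⟨rfl, hR, Y, hY⟩

lemma matGens0_integral {d : ℤ} (hm : d % 4 = 0) : ∀ X ∈ matGens0 d,
    X⁻¹ = X ∧ X.1 ∈ integralOrthogonal (gram0 d) := by
  obtain ⟨k, hk⟩ : ∃ k, d = 4 * k := ⟨d / 4, by omega⟩
  have hk' : (d : ℝ) = 4 * k := by exact_mod_cast hk
  rintro X (rfl | rfl | rfl | rfl)
  · refine ofInvolution_integral !![1, 2, 0, 0; 0, -1, 0, 0; 0, 2, 0, 1; 0, 2, 1, 0] ?_ ?_
    · ext i j; fin_cases i <;> fin_cases j <;> simp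
    · ext i j
      fin_cases i <;> fin_cases j <;>
        simp [gram0, Matrix.mul_apply, Fin.sum_univ_four] <;> ring
  · refine ofInvolution_integral !![1, 0, 2, 0; 0, 0, 2, 1; 0, 0, -1, 0; 0, 1, 2, 0] ?_ ?_
    · ext i j; fin_cases i <;> fin_cases j <;> simp
    · ext i j
      fin_cases i <;> fin_cases j <;>
        simp [gram0, Matrix.mul_apply, Fin.sum_univ_four] <;> ring
  · refine ofInvolution_integral !![1, 0, 0, 2; 0, 0, 1, 2; 0, 1, 0, 2; 0, 0, 0, -1] ?_ ?_
    · ext i j; fin_cases i <;> fin_cases j <;> simp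
    · ext i j
      fin_cases i <;> fin_cases j <;>
        simp [gram0, Matrix.mul_apply, Fin.sum_univ_four] <;> ring
  · refine ofInvolution_integral
      !![0, 3 + k, 1, 7 + k; 0, 2, 0, 3; 1, 1 - k, 0, 5 - k; 0, -1, 0, -2] ?_ ?_
    · ext i j; fin_cases i <;> fin_cases j <;> simp [hk']
    · ext i j
      fin_cases i <;> fin_cases j <;>
        simp [gram0, Matrix.mul_apply, Fin.sum_univ_four] <;> ring

lemma matGens1_integral {d : ℤ} (hm : d % 4 = 1) : ∀ X ∈ matGens1 d,
    X⁻¹ = X ∧ X.1 ∈ integralOrthogonal (gram1 d) := by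
  obtain ⟨k, hk⟩ : ∃ k, d = 4 * k + 1 := ⟨d / 4, by omega⟩
  have hk' : (d : ℝ) = 4 * k + 1 := by exact_mod_cast hk
  rintro X (rfl | rfl | rfl | rfl)
  · refine ofInvolution_integral !![1, -1, 1, 1; 0, -1, 2, 2; 0, 0, 0, 1; 0, 0, 1, 0] ?_ ?_
    · ext i j; fin_cases i <;> fin_cases j <;> simp
    · ext i j
      fin_cases i <;> fin_cases j <;>
        simp [gram1, Matrix.mul_apply, Fin.sum_univ_four] <;> ring
  · refine ofInvolution_integral !![1, 1, -1, 1; 0, 0, 0, 1; 0, 2, -1, 2; 0, 1, 0, 0] ?_ ?_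
    · ext i j; fin_cases i <;> fin_cases j <;> simp
    · ext i j
      fin_cases i <;> fin_cases j <;>
        simp [gram1, Matrix.mul_apply, Fin.sum_univ_four] <;> ring
  · refine ofInvolution_integral !![1, 1, 1, -1; 0, 0, 1, 0; 0, 1, 0, 0; 0, 2, 2, -1] ?_ ?_
    · ext i j; fin_cases i <;> fin_cases j <;> simp
    · ext i j
      fin_cases i <;> fin_cases j <;>
        simp [gram1, Matrix.mul_apply, Fin.sum_univ_four] <;> ring
  · refine ofInvolution_integral
      !![0, 2, k + 3, -1; 1, 1, -k, -1; 0, 0, 1, 0; 1, 2, 3 - k, -2] ?_ ?_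
    · ext i j; fin_cases i <;> fin_cases j <;> simp [hk'] <;> ring
    · ext i j
      fin_cases i <;> fin_cases j <;>
        simp [gram1, Matrix.mul_apply, Fin.sum_univ_four] <;> ring

section Field

variable {K : Type*} [Field K] [NumberField K]

lemma isAlgebraicApollonianGroup_groupAhat (hK : Module.finrank ℚ K = 2) (hd : discr K ≤ -15)
    (φ : K →+* ℂ) : IsAlgebraicApollonianGroup φ (kCluster (discr K)) (baseW (discr K))
      (groupA (discr K)) (groupAhat (discr K)) where
  geometric := isApollonianGroup_groupA hK hd φ
  base := by
    obtain ⟨c, hc, e⟩ := exists_isOrderedCluster_baseW hd (discr_mod_four hK)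
    refine ⟨c, hc, ?_⟩
    rw [e, fundamentalPacking_eq hK hd φ]
    exact basicProng_subset _
  corresponds := by
    have hW := baseW_det hd (discr_mod_four hK)
    have h : (matrixGroup (discr K)).map (conjRho _ hW).toHomUnits = groupAhat (discr K) := by
      rcases discr_mod_four hK with hm | hm
      · exact map_matrixGroup_even hd hm hW
      · exact map_matrixGroup_odd hd hm hW
    rw [algebraicImage_groupA _ _ hW, h]
  integral := by
    rcases discr_mod_four hK with hm | hm
    · rw [kCluster_of_even hm, groupAhat, if_pos hm]
      exact closure_subset_integralOrthogonal (matGens0_integral hm)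
    · rw [kCluster_of_odd hm, groupAhat, if_neg (by omega)]
      exact closure_subset_integralOrthogonal (matGens1_integral hm)

end Field

end KApollonian

end

theorem mainTheorem3 (K : Type*) [Field K] [NumberField K] (hK : Module.finrank ℚ K = 2)
    (hd : NumberField.discr K ≤ -15) (φ : K →+* ℂ) :
    (∃! P : Set KApollonian.OrientedCircle,
      KApollonian.IsApollonianPacking φ P ∧ KApollonian.realCircle ∈ P) ∧
    KApollonian.IsApollonianGroup φ (KApollonian.kCluster (NumberField.discr K))
      (KApollonian.groupA (NumberField.discr K)) ∧
    KApollonian.IsAlgebraicApollonianGroup φ (KApollonian.kCluster (NumberField.discr K))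
      (KApollonian.baseW (NumberField.discr K)) (KApollonian.groupA (NumberField.discr K))
      (KApollonian.groupAhat (NumberField.discr K)) := by
  have h := KApollonian.isAlgebraicApollonianGroup_groupAhat hK hd φ
  exact ⟨⟨_, ⟨KApollonian.isApollonianPacking_orbitPacking hK hd φ,
    KApollonian.realCircle_mem_orbitPacking _⟩,
    fun _ hP => KApollonian.eq_orbitPacking hK hd hP.1 hP.2⟩, h.geometric, h⟩
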